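/- Let $M^n$, $n\ge 4$, be a smooth manifold and let $f:M^n\to\mathbb{R}^{n+p}$ be a smooth immersion; $M$ carries the induced metric $\langle\cdot,\cdot\rangle$, with second fundamental form $\alpha$, mean curvature vector $\mathcal H=\frac1n\operatorname{tr}\alpha$ and normal connection $\nabla^\perp$ with curvature $R^\perp$. Assume that $f$ is umbilic-free, i.e. at no point $\alpha=\langle\cdot,\cdot\rangle\mathcal H$. Put $\rho=\sqrt{\tfrac{n}{n-1}\left(\|\alpha\|^2-n\|\mathcal H\|^2\right)}>0$, let $\langle\cdot,\cdot\rangle^*=\rho^2\langle\cdot,\cdot\rangle$ be the Moebius metric, with Levi-Civita connection $\nabla^*$ and curvature tensor $R^*$, and let $\beta=\rho(\alpha-\langle\cdot,\cdot\rangle\mathcal H)$ be the Moebius second fundamental form. Assume that $f$ has flat normal bundle ($R^\perp=0$) and that $\beta$ is semi-parallel, i.e. for all $X,Y,Z,W$ $$R^\perp(X,Y)\beta(Z,W)-\beta(R^*(X,Y)Z,W)-\beta(Z,R^*(X,Y)W)=0 .$$ A principal normal vector at $x$ is a normal vector $\eta$ with $E_\eta=\{X\in T_xM:\alpha(X,Y)=\langle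 X,Y\rangle\eta\ \ \forall\, Y\in T_xM\}\neq 0$; its multiplicity is $\dim E_\eta$. Assume that $f$ is proper: there are smooth normal vector fields $\eta_1,\dots,\eta_k$ which are pairwise distinct at every point and whose values at each point are exactly the principal normal vectors of $f$ there. The Moebius principal normal vector fields of $f$ are $\bar\eta_i=\rho^{-1}(\eta_i-\mathcal H)$, $1\le i\le k$. If at least three of the $\bar\eta_i$ are parallel in the normal connection ($\nabla^\perp\bar\eta_i=0$), and at least one of these parallel fields has multiplicity greater than one at every point, then $f$ has parallel Moebius second fundamental form: for all vector fields $X,Y,Z$ on $M$, $$(\nabla^\perp_X\beta)(Y,Z)=\nabla^\perp_X\big(\beta(Y,Z)\big)-\beta(\nabla^*_XY,Z)-\beta(Y,\nabla^*_XZ)=0 .$$ (In particular, up to Moebius transformations, $f(M)$ is locally a submanifold with parallel Moebius second fundamental form.) -/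

import Mathlib

open scoped Manifold ContDiff

/-! Moebius geometry of immersed submanifolds of Euclidean space.

The first part treats a parametrized submanifold, that is, a map `F` from (an open subset of) `ℝⁿ`
to `ℝᵐ`, at a point `x`.  Tangent vectors of the submanifold are represented by vectors `X` of `ℝⁿ`
through `X ↦ dF_x X`.  All tensors are evaluated on vectors `X, Y, …` of `ℝⁿ` by extending these to
constant (hence commuting) vector fields.  The second part transports the notions to an immersion of
a manifold by means of all its smooth charts. -/

namespace MoebiusGeometry

/-- Euclidean space `ℝⁿ`. -/
abbrev Euc (n : ℕ) : Type := EuclideanSpace ℝ (Fin n)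

/-- The standard basis vectors of `ℝⁿ`. -/
noncomputable def stdVec {n : ℕ} (i : Fin n) : Euc n := EuclideanSpace.single i (1 : ℝ)

section Metric

/-- The matrix `(h_{ij})` of a field of bilinear forms `h` at `x` in the standard basis. -/
noncomputable def gram {n : ℕ} (h : Euc n → Euc n → Euc n → ℝ) (x : Euc n) :
    Matrix (Fin n) (Fin n) ℝ :=
  Matrix.of fun i j => h x (stdVec i) (stdVec j)

/-- The right-hand side of the Koszul formula
`h(∇_X Y, Z) = (X h(Y,Z) + Y h(X,Z) - Z h(X,Y)) / 2` for constant vector fields `X, Y, Z`. -/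
noncomputable def koszul {n : ℕ} (h : Euc n → Euc n → Euc n → ℝ) (x X Y Z : Euc n) : ℝ :=
  (1 / 2 : ℝ) * (fderiv ℝ (fun y => h y Y Z) x X + fderiv ℝ (fun y => h y X Z) x Y
    - fderiv ℝ (fun y => h y X Y) x Z)

/-- The Levi-Civita connection of the metric `h`: the value `∇_X Y` at `x` for the constant vector
fields `X, Y`.  In general `∇_X Y = DY(X) + leviCivita h x X Y`. -/
noncomputable def leviCivita {n : ℕ} (h : Euc n → Euc n → Euc n → ℝ) (x X Y : Euc n) : Euc n :=
  ∑ i, ∑ j, ((gram h x)⁻¹ i j * koszul h x X Y (stdVec j)) • stdVec i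

/-- The curvature tensor `R(X,Y)Z = ∇_X ∇_Y Z - ∇_Y ∇_X Z - ∇_{[X,Y]} Z` of the metric `h`. -/
noncomputable def curvature {n : ℕ} (h : Euc n → Euc n → Euc n → ℝ) (x X Y Z : Euc n) : Euc n :=
  (fderiv ℝ (fun y => leviCivita h y Y Z) x X + leviCivita h x X (leviCivita h x Y Z))
    - (fderiv ℝ (fun y => leviCivita h y X Z) x Y + leviCivita h x Y (leviCivita h x X Z))

end Metric

section Local

/-- The metric induced by `F`. -/
noncomputable def inducedMetric {n m : ℕ} (F : Euc n → Euc m) (x X Y : Euc n) : ℝ :=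
  inner ℝ (fderiv ℝ F x X) (fderiv ℝ F x Y)

/-- The normal space of `F` at `x`. -/
noncomputable def normalSpace {n m : ℕ} (F : Euc n → Euc m) (x : Euc n) : Submodule ℝ (Euc m) :=
  (LinearMap.range (fderiv ℝ F x : Euc n →ₗ[ℝ] Euc m))ᗮ

/-- The orthogonal projection of `ℝᵐ` onto the normal space of `F` at `x`. -/
noncomputable def normalProj {n m : ℕ} (F : Euc n → Euc m) (x : Euc n) : Euc m →L[ℝ] Euc m :=
  (normalSpace F x).starProjection

/-- The normal connection: `∇^⊥_X ξ` at `x`, for a normal vector field `ξ` along `F`. -/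
noncomputable def normalDeriv {n m : ℕ} (F : Euc n → Euc m) (ξ : Euc n → Euc m) (x X : Euc n) :
    Euc m :=
  normalProj F x (fderiv ℝ ξ x X)

/-- The curvature tensor `R^⊥(X,Y)v = ∇^⊥_X ∇^⊥_Y ξ - ∇^⊥_Y ∇^⊥_X ξ - ∇^⊥_{[X,Y]} ξ` of the normal
connection at a normal vector `v` at `x`, where `v` is extended to the normal vector field
`ξ y = normalProj F y v`. -/
noncomputable def normalCurvature {n m : ℕ} (F : Euc n → Euc m) (x X Y : Euc n) (v : Euc m) :
    Euc m :=
  normalDeriv F (fun y => normalDeriv F (fun z => normalProj F z v) y Y) x X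
    - normalDeriv F (fun y => normalDeriv F (fun z => normalProj F z v) y X) x Y

/-- The second fundamental form `α(X,Y)`: the normal component of the second derivative of `F`. -/
noncomputable def secondFund {n m : ℕ} (F : Euc n → Euc m) (x X Y : Euc n) : Euc m :=
  normalProj F x (fderiv ℝ (fderiv ℝ F) x X Y)

/-- The mean curvature vector `H = (1/n) tr α`. -/
noncomputable def meanCurv {n m : ℕ} (F : Euc n → Euc m) (x : Euc n) : Euc m :=
  (1 / (n : ℝ)) • ∑ i, ∑ j,
    (gram (inducedMetric F) x)⁻¹ i j • secondFund F x (stdVec i) (stdVec j)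

/-- The squared norm `‖α‖² = ∑ g^{ik} g^{jl} ⟨α_{ij}, α_{kl}⟩` of the second fundamental form with
respect to the induced metric, that is, `∑ ‖α(X_i,X_j)‖²` over any orthonormal basis `(X_i)`. -/
noncomputable def secondFundNormSq {n m : ℕ} (F : Euc n → Euc m) (x : Euc n) : ℝ :=
  ∑ i, ∑ j, ∑ k, ∑ l, (gram (inducedMetric F) x)⁻¹ i k * (gram (inducedMetric F) x)⁻¹ j l *
    inner ℝ (secondFund F x (stdVec i) (stdVec j)) (secondFund F x (stdVec k) (stdVec l))

/-- `x` is an umbilical point of `F` if `α(X,Y) = ⟨X,Y⟩ H` at `x`. -/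
def IsUmbilicAt {n m : ℕ} (F : Euc n → Euc m) (x : Euc n) : Prop :=
  ∀ X Y : Euc n, secondFund F x X Y = inducedMetric F x X Y • meanCurv F x

/-- The conformal factor `ρ ≥ 0` with `ρ² = n/(n-1) (‖α‖² - n ‖H‖²)`. -/
noncomputable def moebiusFactor {n m : ℕ} (F : Euc n → Euc m) (x : Euc n) : ℝ :=
  Real.sqrt ((n : ℝ) / ((n : ℝ) - 1) * (secondFundNormSq F x - (n : ℝ) * ‖meanCurv F x‖ ^ 2))

/-- The Moebius metric `⟨X,Y⟩* = ρ² ⟨X,Y⟩`. -/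
noncomputable def moebiusMetric {n m : ℕ} (F : Euc n → Euc m) (x X Y : Euc n) : ℝ :=
  moebiusFactor F x ^ 2 * inducedMetric F x X Y

/-- The Moebius second fundamental form `β = ρ (α - ⟨ , ⟩ H)`. -/
noncomputable def moebiusForm {n m : ℕ} (F : Euc n → Euc m) (x X Y : Euc n) : Euc m :=
  moebiusFactor F x • (secondFund F x X Y - inducedMetric F x X Y • meanCurv F x)

/-- `(R̄ · β)(X,Y,Z,W) = R^⊥(X,Y) β(Z,W) - β(R*(X,Y)Z,W) - β(Z,R*(X,Y)W)`. -/
noncomputable def curvatureOnMoebiusForm {n m : ℕ} (F : Euc n → Euc m) (x X Y Z W : Euc n) :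
    Euc m :=
  normalCurvature F x X Y (moebiusForm F x Z W)
    - moebiusForm F x (curvature (moebiusMetric F) x X Y Z) W
    - moebiusForm F x Z (curvature (moebiusMetric F) x X Y W)

/-- `(∇^⊥_X β)(Y,Z) = ∇^⊥_X (β(Y,Z)) - β(∇*_X Y,Z) - β(Y,∇*_X Z)`. -/
noncomputable def moebiusFormDeriv {n m : ℕ} (F : Euc n → Euc m) (x X Y Z : Euc n) : Euc m :=
  normalDeriv F (fun y => moebiusForm F y Y Z) x X
    - moebiusForm F x (leviCivita (moebiusMetric F) x X Y) Z
    - moebiusForm F x Y (leviCivita (moebiusMetric F) x X Z)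

/-- The eigenspace `E_η = {X | α(X,Y) = ⟨X,Y⟩ η for all Y}` of a normal vector `η` at `x`. -/
noncomputable def eigenspace {n m : ℕ} (F : Euc n → Euc m) (x : Euc n) (η : Euc m) :
    Submodule ℝ (Euc n) where
  carrier := {X | ∀ Y : Euc n, secondFund F x X Y = inducedMetric F x X Y • η}
  add_mem' := by
    intro a b ha hb Y
    have h1 := ha Y
    have h2 := hb Y
    simp only [secondFund, inducedMetric] at h1 h2 ⊢
    simp [map_add, inner_add_left, add_smul, h1, h2]
  zero_mem' := by
    intro Y
    simp [secondFund, inducedMetric]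
  smul_mem' := by
    intro c a ha Y
    have h1 := ha Y
    simp only [secondFund, inducedMetric] at h1 ⊢
    simp [map_smul, inner_smul_left, mul_smul, h1]

/-- `η` is a principal normal vector of `F` at `x`: a normal vector with `E_η ≠ 0`. Its
multiplicity is the dimension of `E_η`. -/
def IsPrincipalNormalAt {n m : ℕ} (F : Euc n → Euc m) (x : Euc n) (η : Euc m) : Prop :=
  η ∈ normalSpace F x ∧ eigenspace F x η ≠ ⊥

/-- The Moebius principal normal vector field `ρ⁻¹ (η - H)` associated with a field `η` of principal
normal vectors. -/
noncomputable def moebiusPrincipalNormal {n m : ℕ} (F : Euc n → Euc m) (η : Euc n → Euc m)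
    (x : Euc n) : Euc m :=
  (moebiusFactor F x)⁻¹ • (η x - meanCurv F x)

end Local

section Manifold

/-- A statement `P F φ u` about parametrized submanifolds holds for `f : M → ℝᵐ` if it holds for the
parametrization `F = f ∘ φ⁻¹` at all points `u` of the target of `φ`, for all smooth charts `φ`. -/
def InAllCharts (n : ℕ) {m : ℕ} {M : Type*} [TopologicalSpace M] [ChartedSpace (Euc n) M] (f : M → Euc m)
    (P : (Euc n → Euc m) → OpenPartialHomeomorph M (Euc n) → Euc n → Prop) : Prop :=
  ∀ φ ∈ IsManifold.maximalAtlas (𝓡 n) ∞ M, ∀ u ∈ φ.target, P (f ∘ φ.symm) φ u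

/-- `f` is a smooth immersion; `M` is endowed with the induced metric, so `f` is isometric. -/
def IsSmoothImmersion (n : ℕ) {m : ℕ} {M : Type*} [TopologicalSpace M] [ChartedSpace (Euc n) M]
    (f : M → Euc m) : Prop :=
  ContMDiff (𝓡 n) (𝓡 m) ∞ f ∧ ∀ x, Function.Injective (mfderiv (𝓡 n) (𝓡 m) f x)

/-- `f` has no umbilical points. -/
def UmbilicFree (n : ℕ) {m : ℕ} {M : Type*} [TopologicalSpace M] [ChartedSpace (Euc n) M]
    (f : M → Euc m) : Prop :=
  InAllCharts n f fun F _ u => ¬ IsUmbilicAt F u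

/-- The normal bundle of `f` is flat: `R^⊥ = 0`. -/
def HasFlatNormalBundle (n : ℕ) {m : ℕ} {M : Type*} [TopologicalSpace M] [ChartedSpace (Euc n) M]
    (f : M → Euc m) : Prop :=
  InAllCharts n f fun F _ u => ∀ X Y : Euc n, ∀ v ∈ normalSpace F u, normalCurvature F u X Y v = 0

/-- The Moebius second fundamental form of `f` is semi-parallel: `R̄ · β = 0`. -/
def IsMoebiusSemiParallel (n : ℕ) {m : ℕ} {M : Type*} [TopologicalSpace M] [ChartedSpace (Euc n) M]
    (f : M → Euc m) : Prop :=
  InAllCharts n f fun F _ u => ∀ X Y Z W : Euc n, curvatureOnMoebiusForm F u X Y Z W = 0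

/-- The Moebius second fundamental form of `f` is parallel: `∇^⊥ β = 0`. -/
def IsMoebiusParallel (n : ℕ) {m : ℕ} {M : Type*} [TopologicalSpace M] [ChartedSpace (Euc n) M]
    (f : M → Euc m) : Prop :=
  InAllCharts n f fun F _ u => ∀ X Y Z : Euc n, moebiusFormDeriv F u X Y Z = 0

/-- `η₁, …, η_k` are the distinct principal normal vector fields of `f`: smooth fields which take
pairwise distinct values at every point, and whose values at a point are precisely the principal
normal vectors of `f` there. -/
def ArePrincipalNormals (n : ℕ) {m k : ℕ} {M : Type*} [TopologicalSpace M] [ChartedSpace (Euc n) M]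
    (f : M → Euc m) (η : Fin k → M → Euc m) : Prop :=
  (∀ i, ContMDiff (𝓡 n) (𝓡 m) ∞ (η i)) ∧
  (∀ x, Function.Injective fun i => η i x) ∧
  InAllCharts n f fun F φ u => ∀ v : Euc m, IsPrincipalNormalAt F u v ↔ ∃ i, η i (φ.symm u) = v

/-- The Moebius principal normal vector field `ρ⁻¹ (η - H)` is parallel in the normal connection. -/
def IsMoebiusPrincipalNormalParallel (n : ℕ) {m : ℕ} {M : Type*} [TopologicalSpace M]
    [ChartedSpace (Euc n) M] (f : M → Euc m) (η : M → Euc m) : Prop :=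
  InAllCharts n f fun F φ u => ∀ X : Euc n,
    normalDeriv F (moebiusPrincipalNormal F (η ∘ φ.symm)) u X = 0

/-- The principal normal vector field `η` has multiplicity greater than one. -/
def HasMultiplicityGtOne (n : ℕ) {m : ℕ} {M : Type*} [TopologicalSpace M] [ChartedSpace (Euc n) M]
    (f : M → Euc m) (η : M → Euc m) : Prop :=
  InAllCharts n f fun F φ u => 1 < Module.finrank ℝ (eigenspace F u (η (φ.symm u)))

end Manifold

end MoebiusGeometry

open MoebiusGeometry

/-!
The proof takes place in the light cone model.  With `cone z = (1, ‖z‖², z)`, a point of the light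
cone of the Lorentz space `ℝ^{m+2}`, the map `ρ · cone ∘ F` is an isometric immersion of `M`, endowed
with the Moebius metric `h`, into a flat space, so that its Gauss and Codazzi equations contain the
structure equations of Moebius geometry.  Its second fundamental form is the Moebius second
fundamental form up to a component that is a multiple of the metric and a component along the
position vector.

*Principal normals.*  Since the normal bundle is flat, the eigenspaces `E_i` of the principal normals
span the tangent space (`IsImmersionOn.iSup_eigenspace`, from the Ricci equation).  If the Moebius
second fundamental form `β` is semi-parallel, the curvature operators of `h` preserve the `E_i`; by
the Gauss equation and because there are at least three eigenspaces, the immersion into the Lorentz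
space has principal normals `B_i` with the same eigenspaces (`coneForm_of_mem`).  These are pairwise
orthogonal (`lorentz_coneNormal`), and `B_i - B_j` is a lift of the difference `β_i - β_j` of the
Moebius principal normals (`coneNormal_sub`), whence `|B_i|² + |B_j|² = ‖β_i - β_j‖² > 0`: at most
one of the numbers `q_i = |B_i|²` fails to be positive.

*Derivatives.*  By the Codazzi equation, the normal derivative of `B_j` in a direction of `E_i`,
`j ≠ i`, is `λ_j (B_j - B_i)`.  If three of the `β_j` are parallel, the corresponding `q_j` are
constant, so that `λ_j q_j = 0` for them.  One of them has `j ≠ i` and `q_j ≠ 0`, so `λ_j = 0` for it,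
and therefore the normal derivatives of all the lifts agree with those of the `β_j`; that is, the
Moebius form vanishes.  The orthogonality of the `B_j` and the relations `∑ m_j β_j = 0` and
`∑ m_j ‖β_j‖² = (n-1)/n`, in which the multiplicities `m_j` are locally constant, then give
`λ_j (m_i q_i + m_j q_j) = 0` and `∑ m_j λ_j (q_i + q_j) = 0`.  When `m_i ≥ 2`, the Codazzi equation
gives `λ_j q_i = 0` in addition.  Together with `q_i + q_j > 0` these equations force all `λ_j` to
vanish (`lam_eq_zero`), hence all `β_j` are parallel.  Finally the mixed components of `∇^⊥ β` vanish
by the Codazzi equation, because three of the vectors `B_i` never lie on a line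
(`moebiusFormDeriv_eq_zero`).
-/

namespace MoebiusGeometry

open Filter Topology

/-! ### Inner products given by functions of two vectors -/

/-- `g` is an inner product on `ℝⁿ`. -/
structure IsInner {n : ℕ} (g : Euc n → Euc n → ℝ) : Prop where
  bilin : IsBilinearMap ℝ g
  symm : ∀ X Y, g X Y = g Y X
  pos : ∀ X, X ≠ 0 → 0 < g X X

theorem sum_coord_smul {n : ℕ} (X : Euc n) : ∑ i, X i • stdVec i = X := by
  have := (EuclideanSpace.basisFun (Fin n) ℝ).sum_repr X
  simpa [stdVec] using this

section IsBilinearMap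

variable {n : ℕ} {V : Type*} [AddCommGroup V] [Module ℝ V] {t : Euc n → Euc n → V}

theorem _root_.IsBilinearMap.coe_toLinearMap (ht : IsBilinearMap ℝ t) (X Y : Euc n) :
    ht.toLinearMap X Y = t X Y := rfl

theorem _root_.IsBilinearMap.zero_left (ht : IsBilinearMap ℝ t) (Y : Euc n) : t 0 Y = 0 := by
  simpa using ht.smul_left 0 0 Y

theorem _root_.IsBilinearMap.zero_right (ht : IsBilinearMap ℝ t) (X : Euc n) : t X 0 = 0 := by
  simpa using ht.smul_right 0 X 0

theorem _root_.IsBilinearMap.sub_left (ht : IsBilinearMap ℝ t) (X Y Z : Euc n) :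
    t (X - Y) Z = t X Z - t Y Z :=
  LinearMap.map_sub₂ ht.toLinearMap X Y Z

theorem bilin_expand (ht : IsBilinearMap ℝ t) (X Y : Euc n) :
    t X Y = ∑ i, ∑ j, (X i * Y j) • t (stdVec i) (stdVec j) := by
  have h : ht.toLinearMap X Y =
      ∑ i, ∑ j, (X i * Y j) • ht.toLinearMap (stdVec i) (stdVec j) := by
    conv_lhs => rw [← sum_coord_smul X, ← sum_coord_smul Y]
    rw [LinearMap.map_sum₂]
    refine Finset.sum_congr rfl fun i _ => ?_
    rw [map_smul, LinearMap.smul_apply, map_sum, Finset.smul_sum]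
    refine Finset.sum_congr rfl fun j _ => ?_
    rw [map_smul, smul_smul]
  exact h

end IsBilinearMap

theorem IsInner.eq_of_forall {n : ℕ} {g : Euc n → Euc n → ℝ} (hg : IsInner g) {X Y : Euc n}
    (h : ∀ Z, g X Z = g Y Z) : X = Y := by
  by_contra hne
  have h1 := hg.pos (X - Y) (sub_ne_zero.mpr hne)
  rw [hg.bilin.sub_left, h, sub_self] at h1
  exact lt_irrefl _ h1

/-- The vector with components `∑ⱼ Gⁱʲ ℓⱼ`, obtained by raising the index of the covector `ℓ`. -/
noncomputable def sharp {n : ℕ} (G : Matrix (Fin n) (Fin n) ℝ) (l : Fin n → ℝ) : Euc n :=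
  ∑ i, ∑ j, (G⁻¹ i j * l j) • stdVec i

theorem gram_apply {n : ℕ} (h : Euc n → Euc n → Euc n → ℝ) (x : Euc n) (i j : Fin n) :
    gram h x i j = h x (stdVec i) (stdVec j) := rfl

theorem isUnit_det_gram {n : ℕ} {h : Euc n → Euc n → Euc n → ℝ} {x : Euc n} (hh : IsInner (h x)) :
    IsUnit (gram h x).det := by
  rw [isUnit_iff_ne_zero]
  intro h0
  obtain ⟨v, hv, hGv⟩ := Matrix.exists_mulVec_eq_zero_iff.mpr h0
  have hne : (WithLp.toLp 2 v : Euc n) ≠ 0 := by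
    intro h
    apply hv
    ext i
    simpa using congrArg (fun w : Euc n => w i) h
  have h1 := hh.pos _ hne
  rw [bilin_expand hh.bilin] at h1
  have h2 : ∑ i, ∑ j, (v i * v j) • h x (stdVec i) (stdVec j) = 0 := by
    apply Finset.sum_eq_zero
    intro i _
    have := congrFun hGv i
    simp only [Matrix.mulVec, dotProduct, gram_apply, Pi.zero_apply] at this
    calc _ = v i * ∑ j, h x (stdVec i) (stdVec j) * v j := by
          rw [Finset.mul_sum]; refine Finset.sum_congr rfl fun j _ => ?_
          simp only [smul_eq_mul]; ring
      _ = 0 := by rw [this, mul_zero]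
  simp only at h1
  rw [h2] at h1
  exact lt_irrefl _ h1

theorem sharp_coord {n : ℕ} (G : Matrix (Fin n) (Fin n) ℝ) (l : Fin n → ℝ) (i : Fin n) :
    sharp G l i = ∑ j, G⁻¹ i j * l j := by
  simp [sharp, stdVec, Finset.sum_apply, Pi.single_apply, Finset.sum_ite_eq]

theorem apply_sharp {n : ℕ} {h : Euc n → Euc n → Euc n → ℝ} {x : Euc n} (hh : IsInner (h x))
    (l : Euc n →ₗ[ℝ] ℝ) (Z : Euc n) :
    h x (sharp (gram h x) fun j => l (stdVec j)) Z = l Z := by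
  have hdet := isUnit_det_gram hh
  have key : ∀ k, h x (sharp (gram h x) fun j => l (stdVec j)) (stdVec k) = l (stdVec k) := by
    intro k
    have h1 : (gram h x * (gram h x)⁻¹) = 1 := Matrix.mul_nonsing_inv _ hdet
    have h2 : ((gram h x).mulVec ((gram h x)⁻¹.mulVec fun j => l (stdVec j))) k = l (stdVec k) := by
      rw [Matrix.mulVec_mulVec, h1, Matrix.one_mulVec]
    rw [hh.symm, bilin_expand hh.bilin]
    rw [← h2]
    simp only [Matrix.mulVec, dotProduct, gram_apply, sharp_coord]
    rw [Finset.sum_eq_single k]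
    · refine Finset.sum_congr rfl fun j _ => ?_
      simp [stdVec, mul_comm]
    · intro b _ hb
      simp [stdVec, hb]
    · simp
  conv_lhs => rw [← sum_coord_smul Z]
  conv_rhs => rw [← sum_coord_smul Z]
  have h3 := map_sum (hh.bilin.toLinearMap (sharp (gram h x) fun j => l (stdVec j)))
    (fun i => Z i • stdVec i) Finset.univ
  simp only [map_smul, IsBilinearMap.coe_toLinearMap] at h3
  rw [h3, map_sum]
  simp [key]

/-! ### Smoothness of inverse matrices and the product rule -/

theorem contDiffOn_det {n : ℕ} {E : Type*} [NormedAddCommGroup E] [NormedSpace ℝ E] {U : Set E}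
    {M : E → Matrix (Fin n) (Fin n) ℝ} (hM : ∀ i j, ContDiffOn ℝ ∞ (fun y => M y i j) U) :
    ContDiffOn ℝ ∞ (fun y => (M y).det) U := by
  simp only [Matrix.det_apply]
  refine ContDiffOn.sum fun σ _ => ?_
  refine ContDiffOn.const_smul _ ?_
  exact contDiffOn_prod fun i _ => hM _ _

theorem contDiffOn_inv_entry {n : ℕ} {E : Type*} [NormedAddCommGroup E] [NormedSpace ℝ E]
    {U : Set E} {M : E → Matrix (Fin n) (Fin n) ℝ}
    (hM : ∀ i j, ContDiffOn ℝ ∞ (fun y => M y i j) U) (hdet : ∀ y ∈ U, IsUnit (M y).det)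
    (i j : Fin n) : ContDiffOn ℝ ∞ (fun y => (M y)⁻¹ i j) U := by
  have h1 : ∀ y, (M y)⁻¹ i j = (M y).det⁻¹ * ((M y).updateRow j (Pi.single i 1)).det := by
    intro y
    rw [Matrix.inv_def, Matrix.smul_apply, Ring.inverse_eq_inv', Matrix.adjugate_apply, smul_eq_mul]
  simp only [h1]
  refine (ContDiffOn.inv (contDiffOn_det hM) fun y hy => (hdet y hy).ne_zero).mul ?_
  refine contDiffOn_det fun a c => ?_
  by_cases ha : a = j
  · subst ha
    simp only [Matrix.updateRow_self]
    exact contDiffOn_const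
  · simp only [Matrix.updateRow_ne ha]
    exact hM _ _

theorem contDiffOn_sharp {n : ℕ} {E : Type*} [NormedAddCommGroup E] [NormedSpace ℝ E]
    {U : Set E} {M : E → Matrix (Fin n) (Fin n) ℝ} {l : E → Fin n → ℝ}
    (hM : ∀ i j, ContDiffOn ℝ ∞ (fun y => M y i j) U) (hdet : ∀ y ∈ U, IsUnit (M y).det)
    (hl : ∀ j, ContDiffOn ℝ ∞ (fun y => l y j) U) :
    ContDiffOn ℝ ∞ (fun y => sharp (M y) (l y)) U := by
  unfold sharp
  refine ContDiffOn.sum fun i _ => ContDiffOn.sum fun j _ => ?_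
  exact ((contDiffOn_inv_entry hM hdet i j).mul (hl j)).smul contDiffOn_const

theorem hasFDerivAt_coord {n : ℕ} {E : Type*} [NormedAddCommGroup E] [NormedSpace ℝ E]
    {Y : E → Euc n} {x : E} (hY : DifferentiableAt ℝ Y x) (i : Fin n) :
    HasFDerivAt (fun y => Y y i) ((EuclideanSpace.proj i : Euc n →L[ℝ] ℝ) ∘L fderiv ℝ Y x) x :=
  ((EuclideanSpace.proj i : Euc n →L[ℝ] ℝ).hasFDerivAt).comp x hY.hasFDerivAt

section ProductRule

variable {n : ℕ} {V : Type*} [NormedAddCommGroup V] [NormedSpace ℝ V]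
  {t : Euc n → Euc n → Euc n → V} {x : Euc n} {Y Z : Euc n → Euc n}

theorem hasFDerivAt_bilin_expand
    (ht : ∀ᶠ y in 𝓝 x, IsBilinearMap ℝ (t y))
    (hd : ∀ X Y, DifferentiableAt ℝ (fun y => t y X Y) x)
    (hY : DifferentiableAt ℝ Y x) (hZ : DifferentiableAt ℝ Z x) :
    ∃ L : Euc n →L[ℝ] V, HasFDerivAt (fun y => t y (Y y) (Z y)) L x ∧
      ∀ X, L X = ∑ i, ∑ j, (Y x i * Z x j) • fderiv ℝ (fun y => t y (stdVec i) (stdVec j)) x X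
        + (t x (fderiv ℝ Y x X) (Z x) + t x (Y x) (fderiv ℝ Z x X)) := by
  have h1 := fun i j => (((hasFDerivAt_coord hY i).mul (hasFDerivAt_coord hZ j)).smul
    (hd (stdVec i) (stdVec j)).hasFDerivAt)
  have h2 := HasFDerivAt.fun_sum (u := Finset.univ)
    fun i _ => HasFDerivAt.fun_sum (u := Finset.univ) fun j _ => h1 i j
  refine ⟨_, h2.congr_of_eventuallyEq ?_, fun X => ?_⟩
  · filter_upwards [ht] with y hy
    rw [bilin_expand hy]
    rfl
  · rw [bilin_expand ht.self_of_nhds (fderiv ℝ Y x X), bilin_expand ht.self_of_nhds (Y x)]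
    simp only [← Finset.sum_add_distrib, sum_apply]
    refine Finset.sum_congr rfl fun i _ => Finset.sum_congr rfl fun j _ => ?_
    simp
    module

theorem differentiableAt_bilin
    (ht : ∀ᶠ y in 𝓝 x, IsBilinearMap ℝ (t y))
    (hd : ∀ X Y, DifferentiableAt ℝ (fun y => t y X Y) x)
    (hY : DifferentiableAt ℝ Y x) (hZ : DifferentiableAt ℝ Z x) :
    DifferentiableAt ℝ (fun y => t y (Y y) (Z y)) x := by
  obtain ⟨L, hL, -⟩ := hasFDerivAt_bilin_expand ht hd hY hZ
  exact hL.differentiableAt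

/-- The product rule for a field `t` of bilinear maps evaluated on the vector fields `Y`, `Z`. -/
theorem fderiv_bilin
    (ht : ∀ᶠ y in 𝓝 x, IsBilinearMap ℝ (t y))
    (hd : ∀ X Y, DifferentiableAt ℝ (fun y => t y X Y) x)
    (hY : DifferentiableAt ℝ Y x) (hZ : DifferentiableAt ℝ Z x) (X : Euc n) :
    fderiv ℝ (fun y => t y (Y y) (Z y)) x X = fderiv ℝ (fun y => t y (Y x) (Z x)) x X
      + (t x (fderiv ℝ Y x X) (Z x) + t x (Y x) (fderiv ℝ Z x X)) := by
  obtain ⟨L, hL, hLX⟩ := hasFDerivAt_bilin_expand ht hd hY hZ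
  obtain ⟨L', hL', hLX'⟩ := hasFDerivAt_bilin_expand ht hd
    (differentiableAt_const (Y x)) (differentiableAt_const (Z x))
  rw [hL.fderiv, hL'.fderiv, hLX, hLX']
  have h0 := ht.self_of_nhds
  simp [h0.zero_left, h0.zero_right]

end ProductRule

/-! ### Immersions into a space with a symmetric bilinear form -/

section Ambient

variable {n : ℕ} {V : Type*} [NormedAddCommGroup V] [NormedSpace ℝ V]

/-- `h` is the (positive definite) metric induced on the open set `U` by a smooth map `Ψ` into the
vector space `V` endowed with the possibly indefinite symmetric bilinear form `b`. -/
structure IsMetricOf (b : V →L[ℝ] V →L[ℝ] ℝ) (U : Set (Euc n)) (Ψ : Euc n → V)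
    (h : Euc n → Euc n → Euc n → ℝ) : Prop where
  isOpen : IsOpen U
  form_symm : ∀ v w, b v w = b w v
  smooth : ContDiffOn ℝ ∞ Ψ U
  metric : ∀ y ∈ U, ∀ X Y, h y X Y = b (fderiv ℝ Ψ y X) (fderiv ℝ Ψ y Y)
  pos : ∀ y ∈ U, ∀ X, X ≠ 0 → 0 < h y X X

/-- The second fundamental form `D²Ψ(X,Y) - dΨ(∇_X Y)` of `Ψ`. -/
noncomputable def ambientForm (Ψ : Euc n → V) (h : Euc n → Euc n → Euc n → ℝ) (x X Y : Euc n) : V :=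
  fderiv ℝ (fderiv ℝ Ψ) x X Y - fderiv ℝ Ψ x (leviCivita h x X Y)

/-- The covariant derivative `(∇_X t)(Y,Z) = X(t(Y,Z)) - t(∇_X Y,Z) - t(Y,∇_X Z)` of a field `t` of
bilinear maps with values in a fixed vector space. -/
noncomputable def covDeriv (h : Euc n → Euc n → Euc n → ℝ) (t : Euc n → Euc n → Euc n → V)
    (x X Y Z : Euc n) : V :=
  fderiv ℝ (fun y => t y Y Z) x X - t x (leviCivita h x X Y) Z - t x Y (leviCivita h x X Z)

theorem fderiv_form {E : Type*} [NormedAddCommGroup E] [NormedSpace ℝ E]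
    (b : V →L[ℝ] V →L[ℝ] ℝ) {f g : E → V} {x : E} (hf : DifferentiableAt ℝ f x)
    (hg : DifferentiableAt ℝ g x) (X : E) :
    fderiv ℝ (fun y => b (f y) (g y)) x X
      = b (fderiv ℝ f x X) (g x) + b (f x) (fderiv ℝ g x X) := by
  rw [b.fderiv_of_bilinear hf hg]
  simp [add_comm]

theorem differentiableAt_form {E : Type*} [NormedAddCommGroup E] [NormedSpace ℝ E]
    (b : V →L[ℝ] V →L[ℝ] ℝ) {f g : E → V} {x : E} (hf : DifferentiableAt ℝ f x)
    (hg : DifferentiableAt ℝ g x) : DifferentiableAt ℝ (fun y => b (f y) (g y)) x :=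
  (b.hasFDerivAt_of_bilinear hf.hasFDerivAt hg.hasFDerivAt).differentiableAt

theorem fderiv_clm_apply_const {E : Type*} [NormedAddCommGroup E] [NormedSpace ℝ E] {W : Type*}
    [NormedAddCommGroup W] [NormedSpace ℝ W]
    {f : E → W →L[ℝ] V} {x : E} (hf : DifferentiableAt ℝ f x) (w : W) (X : E) :
    fderiv ℝ (fun y => f y w) x X = fderiv ℝ f x X w := by
  rw [fderiv_clm_apply hf (differentiableAt_const w)]
  simp

theorem contDiffOn_fderiv {E : Type*} [NormedAddCommGroup E] [NormedSpace ℝ E] {f : E → V}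
    {U : Set E} (hU : IsOpen U) (hf : ContDiffOn ℝ ∞ f U) : ContDiffOn ℝ ∞ (fderiv ℝ f) U :=
  hf.fderiv_of_isOpen hU (by simp)

theorem differentiableAt_of_contDiffOn {E : Type*} [NormedAddCommGroup E] [NormedSpace ℝ E]
    {f : E → V} {U : Set E} (hU : IsOpen U) (hf : ContDiffOn ℝ ∞ f U) {x : E} (hx : x ∈ U) :
    DifferentiableAt ℝ f x :=
  (hf.contDiffAt (hU.mem_nhds hx)).differentiableAt (by simp)

theorem fderiv_fderiv_symm {E : Type*} [NormedAddCommGroup E] [NormedSpace ℝ E]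
    {f : E → V} {U : Set E} (hU : IsOpen U) (hf : ContDiffOn ℝ ∞ f U) {x : E} (hx : x ∈ U)
    (X Y : E) : fderiv ℝ (fderiv ℝ f) x X Y = fderiv ℝ (fderiv ℝ f) x Y X :=
  (hf.contDiffAt (hU.mem_nhds hx)).isSymmSndFDerivAt (by
    rw [minSmoothness_of_isRCLikeNormedField]; exact WithTop.coe_le_coe.mpr le_top) X Y

theorem contDiffOn_form {E : Type*} [NormedAddCommGroup E] [NormedSpace ℝ E]
    (b : V →L[ℝ] V →L[ℝ] ℝ) {U : Set E} {f g : E → V} (hf : ContDiffOn ℝ ∞ f U)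
    (hg : ContDiffOn ℝ ∞ g U) : ContDiffOn ℝ ∞ (fun y => b (f y) (g y)) U :=
  (b.contDiff.comp_contDiffOn hf).clm_apply hg

theorem form_ambientForm {b : V →L[ℝ] V →L[ℝ] ℝ} {Ψ : Euc n → V}
    {h : Euc n → Euc n → Euc n → ℝ} {x : Euc n} {v : V} (hv : ∀ Z, b (fderiv ℝ Ψ x Z) v = 0)
    (X Y : Euc n) :
    b (ambientForm Ψ h x X Y) v = b (fderiv ℝ (fderiv ℝ Ψ) x X Y) v := by
  rw [ambientForm, map_sub, sub_apply, hv, sub_zero]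

namespace IsMetricOf

variable {b : V →L[ℝ] V →L[ℝ] ℝ} {U : Set (Euc n)} {Ψ : Euc n → V}
  {h : Euc n → Euc n → Euc n → ℝ} (H : IsMetricOf b U Ψ h) {x : Euc n}
include H

theorem isInner (hx : x ∈ U) : IsInner (h x) where
  bilin := by constructor <;> intros <;> simp [H.metric x hx]
  symm X Y := by rw [H.metric x hx, H.metric x hx, H.form_symm]
  pos := H.pos x hx

theorem smooth_fderiv : ContDiffOn ℝ ∞ (fderiv ℝ Ψ) U := contDiffOn_fderiv H.isOpen H.smooth

theorem smooth_fderiv_fderiv : ContDiffOn ℝ ∞ (fderiv ℝ (fderiv ℝ Ψ)) U :=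
  contDiffOn_fderiv H.isOpen H.smooth_fderiv

theorem smooth_fderiv_apply (X : Euc n) : ContDiffOn ℝ ∞ (fun y => fderiv ℝ Ψ y X) U :=
  H.smooth_fderiv.clm_apply contDiffOn_const

theorem smooth_fderiv_fderiv_apply (X Y : Euc n) :
    ContDiffOn ℝ ∞ (fun y => fderiv ℝ (fderiv ℝ Ψ) y X Y) U :=
  (H.smooth_fderiv_fderiv.clm_apply contDiffOn_const).clm_apply contDiffOn_const

theorem smooth_metric (X Y : Euc n) : ContDiffOn ℝ ∞ (fun y => h y X Y) U :=
  (contDiffOn_form b (H.smooth_fderiv_apply X) (H.smooth_fderiv_apply Y)).congr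
    fun y hy => H.metric y hy X Y

theorem fderiv_metric (hx : x ∈ U) (X Y Z : Euc n) :
    fderiv ℝ (fun y => h y Y Z) x X
      = b (fderiv ℝ (fderiv ℝ Ψ) x X Y) (fderiv ℝ Ψ x Z)
        + b (fderiv ℝ Ψ x Y) (fderiv ℝ (fderiv ℝ Ψ) x X Z) := by
  have h1 : (fun y => h y Y Z) =ᶠ[𝓝 x] fun y => b (fderiv ℝ Ψ y Y) (fderiv ℝ Ψ y Z) := by
    filter_upwards [H.isOpen.mem_nhds hx] with y hy using H.metric y hy Y Z
  have hd := differentiableAt_of_contDiffOn H.isOpen H.smooth_fderiv hx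
  rw [h1.fderiv_eq, fderiv_form b
    (differentiableAt_of_contDiffOn H.isOpen (H.smooth_fderiv_apply Y) hx)
    (differentiableAt_of_contDiffOn H.isOpen (H.smooth_fderiv_apply Z) hx),
    fderiv_clm_apply_const hd, fderiv_clm_apply_const hd]

theorem koszul_eq (hx : x ∈ U) (X Y Z : Euc n) :
    koszul h x X Y Z = b (fderiv ℝ (fderiv ℝ Ψ) x X Y) (fderiv ℝ Ψ x Z) := by
  unfold koszul
  rw [H.fderiv_metric hx, H.fderiv_metric hx, H.fderiv_metric hx,
    fderiv_fderiv_symm H.isOpen H.smooth hx Y X, fderiv_fderiv_symm H.isOpen H.smooth hx Z X,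
    fderiv_fderiv_symm H.isOpen H.smooth hx Z Y, H.form_symm (fderiv ℝ Ψ x X),
    H.form_symm (fderiv ℝ Ψ x Y)]
  ring

/-- The Levi-Civita connection is the tangent component of the second derivative. -/
theorem metric_leviCivita (hx : x ∈ U) (X Y Z : Euc n) :
    h x (leviCivita h x X Y) Z = b (fderiv ℝ (fderiv ℝ Ψ) x X Y) (fderiv ℝ Ψ x Z) := by
  have h1 := apply_sharp (H.isInner hx)
    ((b (fderiv ℝ (fderiv ℝ Ψ) x X Y)).comp (fderiv ℝ Ψ x) : Euc n →ₗ[ℝ] ℝ) Z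
  have h2 : leviCivita h x X Y = sharp (gram h x) fun j =>
      ((b (fderiv ℝ (fderiv ℝ Ψ) x X Y)).comp (fderiv ℝ Ψ x) : Euc n →ₗ[ℝ] ℝ) (stdVec j) := by
    simp only [leviCivita, sharp, H.koszul_eq hx]
    rfl
  rw [h2, h1]
  rfl

theorem leviCivita_symm (hx : x ∈ U) (X Y : Euc n) : leviCivita h x X Y = leviCivita h x Y X :=
  (H.isInner hx).eq_of_forall fun Z => by
    rw [H.metric_leviCivita hx, H.metric_leviCivita hx, fderiv_fderiv_symm H.isOpen H.smooth hx]

theorem isBilinearMap_leviCivita (hx : x ∈ U) : IsBilinearMap ℝ (leviCivita h x) := by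
  have hb := (H.isInner hx).bilin
  constructor <;> intros <;> refine (H.isInner hx).eq_of_forall fun Z => ?_ <;>
  simp only [hb.add_left, hb.smul_left, H.metric_leviCivita hx] <;> simp

theorem smooth_leviCivita (X Y : Euc n) : ContDiffOn ℝ ∞ (fun y => leviCivita h y X Y) U := by
  refine contDiffOn_sharp (M := fun y => gram h y)
    (l := fun y j => koszul h y X Y (stdVec j)) (fun i j => H.smooth_metric _ _)
    (fun y hy => isUnit_det_gram (H.isInner hy)) fun j => ?_
  exact (contDiffOn_form b (H.smooth_fderiv_fderiv_apply X Y) (H.smooth_fderiv_apply _)).congr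
    fun y hy => H.koszul_eq hy _ _ _

theorem ambientForm_normal (hx : x ∈ U) (X Y Z : Euc n) :
    b (ambientForm Ψ h x X Y) (fderiv ℝ Ψ x Z) = 0 := by
  rw [ambientForm, map_sub, sub_apply, ← H.metric_leviCivita hx, H.metric x hx,
    sub_self]

theorem ambientForm_symm (hx : x ∈ U) (X Y : Euc n) :
    ambientForm Ψ h x X Y = ambientForm Ψ h x Y X := by
  rw [ambientForm, ambientForm, fderiv_fderiv_symm H.isOpen H.smooth hx, H.leviCivita_symm hx]

theorem isBilinearMap_ambientForm (hx : x ∈ U) : IsBilinearMap ℝ (ambientForm Ψ h x) := by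
  have hb := H.isBilinearMap_leviCivita hx
  constructor <;> intros <;>
  simp only [ambientForm, hb.add_left, hb.smul_left, hb.add_right, hb.smul_right, map_add, map_smul,
    add_apply, smul_apply] <;> module

theorem differentiableAt_leviCivita (hx : x ∈ U) (X Y : Euc n) :
    DifferentiableAt ℝ (fun y => leviCivita h y X Y) x :=
  differentiableAt_of_contDiffOn H.isOpen (H.smooth_leviCivita X Y) hx

theorem smooth_ambientForm (X Y : Euc n) : ContDiffOn ℝ ∞ (fun y => ambientForm Ψ h y X Y) U :=
  (H.smooth_fderiv_fderiv_apply X Y).sub (H.smooth_fderiv.clm_apply (H.smooth_leviCivita X Y))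

theorem eventually_isBilinearMap (hx : x ∈ U) : ∀ᶠ y in 𝓝 x, IsBilinearMap ℝ (h y) := by
  filter_upwards [H.isOpen.mem_nhds hx] with y hy using (H.isInner hy).bilin

/-- The metric is parallel. -/
theorem covDeriv_metric (hx : x ∈ U) (X Y Z : Euc n) : covDeriv h h x X Y Z = 0 := by
  rw [covDeriv, H.fderiv_metric hx, H.metric_leviCivita hx, (H.isInner hx).symm Y,
    H.metric_leviCivita hx, H.form_symm (fderiv ℝ Ψ x Y)]
  ring

theorem metric_fderiv_leviCivita (hx : x ∈ U) (X Y Z W : Euc n) :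
    h x (fderiv ℝ (fun y => leviCivita h y Y Z) x X + leviCivita h x X (leviCivita h x Y Z)) W
      = b (fderiv ℝ (fderiv ℝ (fderiv ℝ Ψ)) x X Y Z) (fderiv ℝ Ψ x W)
        + b (ambientForm Ψ h x Y Z) (ambientForm Ψ h x X W) := by
  have hd1 := differentiableAt_of_contDiffOn H.isOpen H.smooth_fderiv hx
  have hd2 := differentiableAt_of_contDiffOn H.isOpen H.smooth_fderiv_fderiv hx
  have h1 : (fun y => h y (leviCivita h y Y Z) W)
      =ᶠ[𝓝 x] fun y => b (fderiv ℝ (fderiv ℝ Ψ) y Y Z) (fderiv ℝ Ψ y W) := by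
    filter_upwards [H.isOpen.mem_nhds hx] with y hy using H.metric_leviCivita hy Y Z W
  have h2 := fderiv_bilin (H.eventually_isBilinearMap hx)
    (fun X Y => differentiableAt_of_contDiffOn H.isOpen (H.smooth_metric X Y) hx)
    (H.differentiableAt_leviCivita hx Y Z) (differentiableAt_const W) X
  rw [h1.fderiv_eq, fderiv_form b
    (differentiableAt_of_contDiffOn H.isOpen (H.smooth_fderiv_fderiv_apply Y Z) hx)
    (differentiableAt_of_contDiffOn H.isOpen (H.smooth_fderiv_apply W) hx),
    fderiv_clm_apply_const hd1, fderiv_clm_apply_const (hd2.clm_apply (differentiableAt_const Y)),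
    fderiv_clm_apply_const hd2, H.fderiv_metric hx] at h2
  have h3 := H.ambientForm_normal hx Y Z (leviCivita h x X W)
  have h4 : b (ambientForm Ψ h x Y Z) (ambientForm Ψ h x X W)
      = b (fderiv ℝ (fderiv ℝ Ψ) x Y Z) (fderiv ℝ (fderiv ℝ Ψ) x X W)
        - b (fderiv ℝ Ψ x (leviCivita h x Y Z)) (fderiv ℝ (fderiv ℝ Ψ) x X W) := by
    conv_lhs => rw [ambientForm.eq_1 Ψ h x X W, map_sub, h3, sub_zero]
    rw [ambientForm, map_sub, sub_apply]
  have h5 : h x (leviCivita h x Y Z) (fderiv ℝ (fun _ : Euc n => W) x X) = 0 := by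
    simp [(H.isInner hx).bilin.zero_right]
  rw [h5] at h2
  rw [(H.isInner hx).bilin.add_left, H.metric_leviCivita hx, h4]
  linarith

/-- The Gauss equation. -/
theorem gauss (hx : x ∈ U) (X Y Z W : Euc n) :
    h x (curvature h x X Y Z) W = b (ambientForm Ψ h x Y Z) (ambientForm Ψ h x X W)
      - b (ambientForm Ψ h x X Z) (ambientForm Ψ h x Y W) := by
  rw [curvature, (H.isInner hx).bilin.sub_left, H.metric_fderiv_leviCivita hx,
    H.metric_fderiv_leviCivita hx, fderiv_fderiv_symm H.isOpen H.smooth_fderiv hx X Y]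
  ring

theorem form_covDeriv (hx : x ∈ U) {v : V} (hv : ∀ Z, b (fderiv ℝ Ψ x Z) v = 0)
    (X Y Z : Euc n) :
    b (covDeriv h (ambientForm Ψ h) x X Y Z) v
      = b (fderiv ℝ (fderiv ℝ (fderiv ℝ Ψ)) x X Y Z) v
        - b (ambientForm Ψ h x X (leviCivita h x Y Z)) v
        - b (ambientForm Ψ h x Y (leviCivita h x X Z)) v
        - b (ambientForm Ψ h x Z (leviCivita h x X Y)) v := by
  have hd1 := differentiableAt_of_contDiffOn H.isOpen H.smooth_fderiv hx
  have hd2 := differentiableAt_of_contDiffOn H.isOpen H.smooth_fderiv_fderiv hx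
  have h1 : fderiv ℝ (fun y => ambientForm Ψ h y Y Z) x X
      = fderiv ℝ (fderiv ℝ (fderiv ℝ Ψ)) x X Y Z
        - (fderiv ℝ (fderiv ℝ Ψ) x X (leviCivita h x Y Z)
          + fderiv ℝ Ψ x (fderiv ℝ (fun y => leviCivita h y Y Z) x X)) := by
    unfold ambientForm
    rw [fderiv_fun_sub (differentiableAt_of_contDiffOn H.isOpen
        (H.smooth_fderiv_fderiv_apply Y Z) hx)
      (hd1.clm_apply (H.differentiableAt_leviCivita hx Y Z)),
      fderiv_clm_apply hd1 (H.differentiableAt_leviCivita hx Y Z), sub_apply,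
      fderiv_clm_apply_const (hd2.clm_apply (differentiableAt_const Y)),
      fderiv_clm_apply_const hd2]
    simp [add_comm]
  rw [covDeriv, h1, H.ambientForm_symm hx (leviCivita h x X Y)]
  simp only [map_sub, sub_apply, map_add, add_apply, hv]
  rw [← form_ambientForm hv X (leviCivita h x Y Z)]
  ring

/-- The Codazzi equation. -/
theorem codazzi (hx : x ∈ U) {v : V} (hv : ∀ Z, b (fderiv ℝ Ψ x Z) v = 0) (X Y Z : Euc n) :
    b (covDeriv h (ambientForm Ψ h) x X Y Z) v = b (covDeriv h (ambientForm Ψ h) x Y X Z) v := by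
  rw [H.form_covDeriv hx hv, H.form_covDeriv hx hv,
    fderiv_fderiv_symm H.isOpen H.smooth_fderiv hx X Y, H.leviCivita_symm hx X Y]
  ring

/-- The covariant derivative computed with vector fields which are not constant. -/
theorem covDeriv_eq {W : Type*} [NormedAddCommGroup W] [NormedSpace ℝ W]
    {t : Euc n → Euc n → Euc n → W} {Y Z : Euc n → Euc n}
    (ht : ∀ y ∈ U, IsBilinearMap ℝ (t y)) (hx : x ∈ U)
    (hd : ∀ X Y, DifferentiableAt ℝ (fun y => t y X Y) x)
    (hY : DifferentiableAt ℝ Y x) (hZ : DifferentiableAt ℝ Z x) (X : Euc n) :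
    covDeriv h t x X (Y x) (Z x) = fderiv ℝ (fun y => t y (Y y) (Z y)) x X
      - t x (fderiv ℝ Y x X + leviCivita h x X (Y x)) (Z x)
      - t x (Y x) (fderiv ℝ Z x X + leviCivita h x X (Z x)) := by
  have h1 : ∀ᶠ y in 𝓝 x, IsBilinearMap ℝ (t y) := by
    filter_upwards [H.isOpen.mem_nhds hx] with y hy using ht y hy
  rw [fderiv_bilin h1 hd hY hZ, covDeriv, (ht x hx).add_left, (ht x hx).add_right]
  module

theorem covDeriv_add_left {W : Type*} [NormedAddCommGroup W] [NormedSpace ℝ W]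
    {t : Euc n → Euc n → Euc n → W} (ht : ∀ y ∈ U, IsBilinearMap ℝ (t y)) (hx : x ∈ U)
    (hd : ∀ X Y, DifferentiableAt ℝ (fun y => t y X Y) x) (X Y Y' Z : Euc n) :
    covDeriv h t x X (Y + Y') Z = covDeriv h t x X Y Z + covDeriv h t x X Y' Z := by
  have h1 : (fun y => t y (Y + Y') Z) =ᶠ[𝓝 x] fun y => t y Y Z + t y Y' Z := by
    filter_upwards [H.isOpen.mem_nhds hx] with y hy using (ht y hy).add_left _ _ _
  simp only [covDeriv]
  rw [h1.fderiv_eq, fderiv_fun_add (hd _ _) (hd _ _), (H.isBilinearMap_leviCivita hx).add_right,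
    (ht x hx).add_left, (ht x hx).add_left, add_apply]
  abel

theorem covDeriv_add_right {W : Type*} [NormedAddCommGroup W] [NormedSpace ℝ W]
    {t : Euc n → Euc n → Euc n → W} (ht : ∀ y ∈ U, IsBilinearMap ℝ (t y)) (hx : x ∈ U)
    (hd : ∀ X Y, DifferentiableAt ℝ (fun y => t y X Y) x) (X Y Z Z' : Euc n) :
    covDeriv h t x X Y (Z + Z') = covDeriv h t x X Y Z + covDeriv h t x X Y Z' := by
  have h1 : (fun y => t y Y (Z + Z')) =ᶠ[𝓝 x] fun y => t y Y Z + t y Y Z' := by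
    filter_upwards [H.isOpen.mem_nhds hx] with y hy using (ht y hy).add_right _ _ _
  simp only [covDeriv]
  rw [h1.fderiv_eq, fderiv_fun_add (hd _ _) (hd _ _), (H.isBilinearMap_leviCivita hx).add_right,
    (ht x hx).add_right, (ht x hx).add_right, add_apply]
  abel

theorem covDeriv_add_dir {W : Type*} [NormedAddCommGroup W] [NormedSpace ℝ W]
    {t : Euc n → Euc n → Euc n → W} (ht : ∀ y ∈ U, IsBilinearMap ℝ (t y)) (hx : x ∈ U)
    (X X' Y Z : Euc n) :
    covDeriv h t x (X + X') Y Z = covDeriv h t x X Y Z + covDeriv h t x X' Y Z := by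
  simp only [covDeriv]
  rw [map_add, (H.isBilinearMap_leviCivita hx).add_left, (H.isBilinearMap_leviCivita hx).add_left,
    (ht x hx).add_right, (ht x hx).add_left]
  abel

end IsMetricOf

end Ambient

/-! ### The normal bundle of an immersion -/

section Immersion

variable {n m : ℕ}

/-- The Euclidean inner product as a continuous bilinear map. -/
noncomputable def innerForm (m : ℕ) : Euc m →L[ℝ] Euc m →L[ℝ] ℝ :=
  (isBoundedBilinearMap_inner (𝕜 := ℝ) (E := Euc m)).toContinuousLinearMap

theorem innerForm_apply (v w : Euc m) : innerForm m v w = inner ℝ v w := rfl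

/-- `F` restricts to a smooth immersion of the open set `U`. -/
structure IsImmersionOn (U : Set (Euc n)) (F : Euc n → Euc m) : Prop where
  isOpen : IsOpen U
  smooth : ContDiffOn ℝ ∞ F U
  injective : ∀ y ∈ U, Function.Injective (fderiv ℝ F y)

/-- The shape operator `A_ζ`, defined by `⟨A_ζ Z, W⟩ = ⟨α(Z, W), ζ⟩`. -/
noncomputable def shape (F : Euc n → Euc m) (x : Euc n) (ζ : Euc m) (Z : Euc n) : Euc n :=
  sharp (gram (inducedMetric F) x) fun j => inner ℝ ζ (secondFund F x Z (stdVec j))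

theorem mem_normalSpace {F : Euc n → Euc m} {x : Euc n} {v : Euc m} :
    v ∈ normalSpace F x ↔ ∀ X, inner ℝ v (fderiv ℝ F x X) = 0 := by
  simp [normalSpace, Submodule.mem_orthogonal']

theorem normalProj_mem (F : Euc n → Euc m) (x : Euc n) (v : Euc m) :
    normalProj F x v ∈ normalSpace F x :=
  Submodule.starProjection_apply_mem _ _

theorem normalProj_eq_self {F : Euc n → Euc m} {x : Euc n} {v : Euc m} :
    normalProj F x v = v ↔ v ∈ normalSpace F x :=
  Submodule.starProjection_eq_self_iff

theorem normalProj_idem (F : Euc n → Euc m) (x : Euc n) (v : Euc m) :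
    normalProj F x (normalProj F x v) = normalProj F x v :=
  normalProj_eq_self.mpr (normalProj_mem F x v)

theorem inner_normalProj (F : Euc n → Euc m) (x : Euc n) (v w : Euc m) :
    inner ℝ (normalProj F x v) w = inner ℝ v (normalProj F x w) :=
  Submodule.inner_starProjection_left_eq_right _ _ _

theorem inner_normalProj_of_mem {F : Euc n → Euc m} {x : Euc n} (v : Euc m) {w : Euc m}
    (hw : w ∈ normalSpace F x) : inner ℝ (normalProj F x v) w = inner ℝ v w := by
  rw [inner_normalProj, normalProj_eq_self.mpr hw]

theorem inner_normalProj_fderiv (F : Euc n → Euc m) (x : Euc n) (v : Euc m) (X : Euc n) :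
    inner ℝ (normalProj F x v) (fderiv ℝ F x X) = 0 :=
  mem_normalSpace.mp (normalProj_mem F x v) X

theorem isBilinearMap_secondFund (F : Euc n → Euc m) (x : Euc n) :
    IsBilinearMap ℝ (secondFund F x) := by
  constructor <;> intros <;> simp [secondFund]

theorem secondFund_mem (F : Euc n → Euc m) (x X Y : Euc n) :
    secondFund F x X Y ∈ normalSpace F x := normalProj_mem _ _ _

theorem shape_normalProj (F : Euc n → Euc m) (x : Euc n) (ζ : Euc m) (Z : Euc n) :
    shape F x (normalProj F x ζ) Z = shape F x ζ Z := by
  unfold shape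
  congr 1
  ext j
  exact inner_normalProj_of_mem ζ (secondFund_mem F x Z (stdVec j))

namespace IsImmersionOn

variable {U : Set (Euc n)} {F : Euc n → Euc m} (H : IsImmersionOn U F) {x : Euc n}
include H

theorem isMetricOf : IsMetricOf (innerForm m) U F (inducedMetric F) where
  isOpen := H.isOpen
  form_symm v w := by rw [innerForm_apply, innerForm_apply, real_inner_comm]
  smooth := H.smooth
  metric _ _ _ _ := rfl
  pos y hy X hX := by
    rw [inducedMetric, real_inner_self_pos]
    intro h0
    exact hX (H.injective y hy (by rw [h0, map_zero]))

theorem isInner (hx : x ∈ U) : IsInner (inducedMetric F x) := H.isMetricOf.isInner hx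

/-- The projection onto the normal space in terms of the inverse Gram matrix, which shows that it
depends smoothly on the point. -/
theorem normalProj_eq (hx : x ∈ U) (v : Euc m) :
    normalProj F x v = v - fderiv ℝ F x
      (sharp (gram (inducedMetric F) x) fun j => inner ℝ v (fderiv ℝ F x (stdVec j))) := by
  refine Submodule.eq_starProjection_of_mem_orthogonal (K := normalSpace F x) ?_ ?_
  · refine mem_normalSpace.mpr fun X => ?_
    have h1 := apply_sharp (H.isInner hx)
      ((innerForm m v).comp (fderiv ℝ F x) : Euc n →ₗ[ℝ] ℝ) X
    rw [inner_sub_left, sub_eq_zero]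
    exact h1.symm
  · rw [sub_sub_cancel, normalSpace, Submodule.orthogonal_orthogonal]
    exact LinearMap.mem_range_self _ _

theorem smooth_gram (i j : Fin n) :
    ContDiffOn ℝ ∞ (fun y => gram (inducedMetric F) y i j) U := H.isMetricOf.smooth_metric _ _

theorem smooth_gram_inv (i j : Fin n) :
    ContDiffOn ℝ ∞ (fun y => (gram (inducedMetric F) y)⁻¹ i j) U :=
  contDiffOn_inv_entry (M := fun y => gram (inducedMetric F) y) H.smooth_gram
    (fun _ hy => isUnit_det_gram (H.isInner hy)) i j

theorem smooth_normalProj : ContDiffOn ℝ ∞ (normalProj F) U := by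
  refine contDiffOn_clm_apply.mpr fun v => ?_
  refine ContDiffOn.congr ?_ fun y hy => H.normalProj_eq hy v
  refine contDiffOn_const.sub (H.isMetricOf.smooth_fderiv.clm_apply ?_)
  exact contDiffOn_sharp (M := fun y => gram (inducedMetric F) y) H.smooth_gram
    (fun _ hy => isUnit_det_gram (H.isInner hy)) fun j =>
      contDiffOn_form (innerForm m) contDiffOn_const (H.isMetricOf.smooth_fderiv_apply _)

theorem smooth_secondFund (X Y : Euc n) : ContDiffOn ℝ ∞ (fun y => secondFund F y X Y) U :=
  H.smooth_normalProj.clm_apply (H.isMetricOf.smooth_fderiv_fderiv_apply X Y)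

theorem smooth_meanCurv : ContDiffOn ℝ ∞ (meanCurv F) U :=
  ContDiffOn.const_smul _ (ContDiffOn.sum fun i _ => ContDiffOn.sum fun j _ =>
    (H.smooth_gram_inv i j).smul (H.smooth_secondFund (stdVec i) (stdVec j)))

theorem smooth_secondFundNormSq : ContDiffOn ℝ ∞ (secondFundNormSq F) U :=
  ContDiffOn.sum fun i _ => ContDiffOn.sum fun j _ => ContDiffOn.sum fun k _ =>
    ContDiffOn.sum fun l _ => ((H.smooth_gram_inv i k).mul (H.smooth_gram_inv j l)).mul
      (contDiffOn_form (innerForm m) (H.smooth_secondFund _ _) (H.smooth_secondFund _ _))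

theorem secondFund_symm (hx : x ∈ U) (X Y : Euc n) : secondFund F x X Y = secondFund F x Y X := by
  rw [secondFund, fderiv_fderiv_symm H.isOpen H.smooth hx, secondFund]

theorem inducedMetric_shape (hx : x ∈ U) (ζ : Euc m) (Z W : Euc n) :
    inducedMetric F x (shape F x ζ Z) W = inner ℝ ζ (secondFund F x Z W) := by
  exact apply_sharp (H.isInner hx) ((innerForm m ζ).toLinearMap.comp
    ((isBilinearMap_secondFund F x).toLinearMap Z)) W

theorem shape_add (hx : x ∈ U) (ζ : Euc m) (Z W : Euc n) :
    shape F x ζ (Z + W) = shape F x ζ Z + shape F x ζ W := by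
  refine (H.isInner hx).eq_of_forall fun Y => ?_
  rw [(H.isInner hx).bilin.add_left]
  simp only [H.inducedMetric_shape hx, (isBilinearMap_secondFund F x).add_left, inner_add_right]

theorem shape_smul (hx : x ∈ U) (ζ : Euc m) (c : ℝ) (Z : Euc n) :
    shape F x ζ (c • Z) = c • shape F x ζ Z := by
  refine (H.isInner hx).eq_of_forall fun Y => ?_
  rw [(H.isInner hx).bilin.smul_left]
  simp only [H.inducedMetric_shape hx, (isBilinearMap_secondFund F x).smul_left,
    inner_smul_right, smul_eq_mul]

theorem shape_symm (hx : x ∈ U) (ζ : Euc m) (Z W : Euc n) :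
    inducedMetric F x (shape F x ζ Z) W = inducedMetric F x Z (shape F x ζ W) := by
  rw [(H.isInner hx).symm Z, H.inducedMetric_shape hx, H.inducedMetric_shape hx,
    H.secondFund_symm hx]

theorem shape_of_mem (hx : x ∈ U) {v : Euc m} (ζ : Euc m) {Z : Euc n}
    (hZ : Z ∈ eigenspace F x v) : shape F x ζ Z = (inner ℝ ζ v : ℝ) • Z := by
  refine (H.isInner hx).eq_of_forall fun Y => ?_
  rw [H.inducedMetric_shape hx, hZ Y, (H.isInner hx).bilin.smul_left, inner_smul_right,
    smul_eq_mul, mul_comm]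

theorem differentiableAt_shape (hx : x ∈ U) (ζ : Euc m) {Z : Euc n → Euc n}
    (hZ : DifferentiableAt ℝ Z x) : DifferentiableAt ℝ (fun y => shape F y ζ (Z y)) x := by
  unfold shape sharp
  refine DifferentiableAt.fun_sum fun i _ => DifferentiableAt.fun_sum fun j _ => ?_
  refine DifferentiableAt.smul_const (DifferentiableAt.mul
    (differentiableAt_of_contDiffOn H.isOpen (H.smooth_gram_inv i j) hx) ?_) _
  refine differentiableAt_form (innerForm m) (differentiableAt_const ζ) ?_
  exact differentiableAt_bilin (t := fun y => secondFund F y)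
    (Eventually.of_forall fun y => isBilinearMap_secondFund F y)
    (fun X Y => differentiableAt_of_contDiffOn H.isOpen (H.smooth_secondFund X Y) hx) hZ
    (differentiableAt_const _)

theorem differentiableAt_normalProj (hx : x ∈ U) : DifferentiableAt ℝ (normalProj F) x :=
  differentiableAt_of_contDiffOn H.isOpen H.smooth_normalProj hx

theorem inner_fderiv_normalProj (hx : x ∈ U) (X : Euc n) (v w : Euc m) :
    inner ℝ (fderiv ℝ (normalProj F) x X v) w = inner ℝ v (fderiv ℝ (normalProj F) x X w) := by
  have hP := H.differentiableAt_normalProj hx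
  have h1 := fderiv_form (innerForm m) (hP.clm_apply (differentiableAt_const v))
    (differentiableAt_const w) X
  have h2 := fderiv_form (innerForm m) (differentiableAt_const v)
    (hP.clm_apply (differentiableAt_const w)) X
  have h3 : (fun y => innerForm m (normalProj F y v) w)
      = fun y => innerForm m v (normalProj F y w) := by
    ext y
    exact inner_normalProj F y v w
  rw [h3, h2, fderiv_clm_apply_const hP, fderiv_clm_apply_const hP] at h1
  simp only [innerForm_apply] at h1
  simpa using h1.symm

/-- The Weingarten formula: the tangent component of the derivative of the normal field `P v`. -/
theorem fderiv_normalProj_of_mem (hx : x ∈ U) {v : Euc m} (hv : v ∈ normalSpace F x) (X : Euc n) :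
    fderiv ℝ (normalProj F) x X v = -fderiv ℝ F x (shape F x v X) := by
  have hP := H.differentiableAt_normalProj hx
  have hPv := hP.clm_apply (differentiableAt_const v)
  have h1 : (fun y => normalProj F y (normalProj F y v)) = fun y => normalProj F y v := by
    ext1 y
    exact normalProj_idem F y v
  have h2 : normalProj F x (fderiv ℝ (normalProj F) x X v) = 0 := by
    have h3 := fderiv_clm_apply hP hPv
    rw [h1] at h3
    have h4 := congrArg (fun L => L X) h3
    simp only [fderiv_clm_apply_const hP, add_apply, ContinuousLinearMap.comp_apply,
      ContinuousLinearMap.flip_apply, normalProj_eq_self.mpr hv] at h4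
    exact left_eq_add.mp (h4.trans (add_comm _ _))
  have h5 : ∀ Z, inner ℝ (fderiv ℝ (normalProj F) x X v) (fderiv ℝ F x Z)
      = -inner ℝ v (secondFund F x X Z) := by
    intro Z
    have hd := differentiableAt_of_contDiffOn H.isOpen H.isMetricOf.smooth_fderiv hx
    have h6 := fderiv_form (innerForm m) hPv (hd.clm_apply (differentiableAt_const Z)) X
    have h7 : (fun y => innerForm m (normalProj F y v) (fderiv ℝ F y Z)) = fun _ => 0 := by
      ext y
      exact inner_normalProj_fderiv F y v Z
    rw [h7, fderiv_clm_apply_const hP, fderiv_clm_apply_const hd, normalProj_eq_self.mpr hv] at h6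
    simp only [innerForm_apply, fderiv_fun_const, Pi.zero_apply, zero_apply] at h6
    rw [secondFund, ← inner_normalProj, normalProj_eq_self.mpr hv]
    linarith
  have h8 := H.normalProj_eq hx (fderiv ℝ (normalProj F) x X v)
  rw [h2] at h8
  rw [eq_comm, sub_eq_zero] at h8
  rw [h8, ← map_neg]
  congr 1
  refine (H.isInner hx).eq_of_forall fun Z => ?_
  have h9 := apply_sharp (H.isInner hx)
      ((innerForm m (fderiv ℝ (normalProj F) x X v)).comp (fderiv ℝ F x) : Euc n →ₗ[ℝ] ℝ) Z
  have h10 : inducedMetric F x (-shape F x v X) Z = - inner ℝ v (secondFund F x X Z) := by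
    rw [← H.inducedMetric_shape hx, ← neg_one_smul ℝ, (H.isInner hx).bilin.smul_left]
    simp
  rw [h10, ← h5 Z]
  exact h9

/-- The Ricci equation. -/
theorem inner_normalCurvature (hx : x ∈ U) {v w : Euc m} (hv : v ∈ normalSpace F x)
    (hw : w ∈ normalSpace F x) (X Y : Euc n) :
    inner ℝ (normalCurvature F x X Y v) w
      = inducedMetric F x (shape F x w X) (shape F x v Y)
        - inducedMetric F x (shape F x w Y) (shape F x v X) := by
  have hP := H.differentiableAt_normalProj hx
  have hDP : ContDiffOn ℝ ∞ (fderiv ℝ (normalProj F)) U :=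
    contDiffOn_fderiv H.isOpen H.smooth_normalProj
  have hDPx := differentiableAt_of_contDiffOn H.isOpen hDP hx
  have key : ∀ X Y, inner ℝ (normalDeriv F (fun y => normalDeriv F (fun z => normalProj F z v) y Y)
      x X) w = inducedMetric F x (shape F x w X) (shape F x v Y)
        + inner ℝ (fderiv ℝ (fderiv ℝ (normalProj F)) x X Y v) w := by
    intro X Y
    have h1 : (fun y => normalDeriv F (fun z => normalProj F z v) y Y)
        =ᶠ[𝓝 x] fun y => normalProj F y (fderiv ℝ (normalProj F) y Y v) := by
      filter_upwards [H.isOpen.mem_nhds hx] with y hy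
      rw [normalDeriv, fderiv_clm_apply_const (H.differentiableAt_normalProj hy)]
    have hd1 := hDPx.clm_apply (differentiableAt_const Y)
    have hd2 := hd1.clm_apply (differentiableAt_const v)
    have h2 : fderiv ℝ (fun y => normalDeriv F (fun z => normalProj F z v) y Y) x X
        = fderiv ℝ (normalProj F) x X (fderiv ℝ (normalProj F) x Y v)
          + normalProj F x (fderiv ℝ (fderiv ℝ (normalProj F)) x X Y v) := by
      rw [h1.fderiv_eq, fderiv_clm_apply hP hd2]
      simp only [add_apply, ContinuousLinearMap.comp_apply, ContinuousLinearMap.flip_apply]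
      rw [fderiv_clm_apply_const hd1, fderiv_clm_apply_const hDPx, add_comm]
    rw [normalDeriv, inner_normalProj_of_mem _ hw, h2, inner_add_left,
      inner_normalProj_of_mem _ hw, H.inner_fderiv_normalProj hx,
      H.fderiv_normalProj_of_mem hx hv, H.fderiv_normalProj_of_mem hx hw, inner_neg_neg,
      (H.isInner hx).symm]
    rfl
  rw [normalCurvature, inner_sub_left, key X Y, key Y X,
    fderiv_fderiv_symm H.isOpen H.smooth_normalProj hx X Y]
  ring

/-- With flat normal bundle, the shape operators commute. -/
theorem shape_comm (hx : x ∈ U)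
    (hflat : ∀ X Y : Euc n, ∀ v ∈ normalSpace F x, normalCurvature F x X Y v = 0)
    (v w : Euc m) (X : Euc n) :
    shape F x v (shape F x w X) = shape F x w (shape F x v X) := by
  rw [← shape_normalProj F x v, ← shape_normalProj F x w, ← shape_normalProj F x v X,
    ← shape_normalProj F x w (shape F x _ X)]
  refine (H.isInner hx).eq_of_forall fun Y => ?_
  have h1 := H.inner_normalCurvature hx (normalProj_mem F x v) (normalProj_mem F x w) X Y
  rw [hflat X Y _ (normalProj_mem F x v), inner_zero_left] at h1
  rw [H.shape_symm hx, H.shape_symm hx _ (shape F x _ X), (H.isInner hx).symm (shape F x _ X)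
    (shape F x (normalProj F x w) Y)]
  linarith

/-- With flat normal bundle, the eigenspaces of the principal normal vectors span. -/
theorem iSup_eigenspace {ι : Type*} (hx : x ∈ U)
    (hflat : ∀ X Y : Euc n, ∀ v ∈ normalSpace F x, normalCurvature F x X Y v = 0)
    (ν : ι → Euc m) (hν : ∀ v, IsPrincipalNormalAt F x v → ∃ i, ν i = v) :
    ⨆ i, eigenspace F x (ν i) = ⊤ := by
  let e : Euc n ≃ₗ[ℝ] LinearMap.range (fderiv ℝ F x : Euc n →ₗ[ℝ] Euc m) :=
    LinearEquiv.ofInjective (fderiv ℝ F x : Euc n →ₗ[ℝ] Euc m) (H.injective x hx)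
  have he : ∀ X Y, inner ℝ (e X) (e Y) = inducedMetric F x X Y := fun X Y => rfl
  let A : Euc m → (Euc n →ₗ[ℝ] Euc n) := fun ζ =>
    { toFun := shape F x ζ, map_add' := H.shape_add hx ζ, map_smul' := H.shape_smul hx ζ }
  let T := fun ζ => e.conj (A ζ)
  have hT : ∀ ζ X, T ζ (e X) = e (shape F x ζ X) := fun ζ X => by
    simp [T, LinearEquiv.conj_apply, A]
  have hsymm : ∀ ζ, (T ζ).IsSymmetric := by
    intro ζ v w
    obtain ⟨X, rfl⟩ := e.surjective v
    obtain ⟨Y, rfl⟩ := e.surjective w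
    rw [hT, hT, he, he, H.shape_symm hx]
  have hcomm : ∀ ζ ζ', Commute (T ζ) (T ζ') := by
    intro ζ ζ'
    refine LinearMap.ext fun v => ?_
    obtain ⟨X, rfl⟩ := e.surjective v
    simp only [Module.End.mul_apply, hT]
    rw [H.shape_comm hx hflat]
  have htop := LinearMap.IsSymmetric.iSup_iInf_eq_top_of_commute hsymm
    (fun ζ ζ' _ => hcomm ζ ζ')
  have hle : (⊤ : Submodule ℝ (LinearMap.range (fderiv ℝ F x : Euc n →ₗ[ℝ] Euc m)))
      ≤ (⨆ i, eigenspace F x (ν i)).map (e : Euc n →ₗ[ℝ] _) := by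
    rw [← htop]
    refine iSup_le fun χ w hw => ?_
    obtain ⟨X, rfl⟩ := e.surjective w
    refine Submodule.mem_map_of_mem ?_
    by_cases hX : X = 0
    · rw [hX]; exact zero_mem _
    have hpos := (H.isInner hx).pos X hX
    have hA : ∀ ζ, shape F x ζ X = χ ζ • X := by
      intro ζ
      have h1 := Module.End.mem_eigenspace_iff.mp ((Submodule.mem_iInf _).mp hw ζ)
      rw [hT, ← map_smul] at h1
      exact e.injective h1
    have hα : ∀ ζ Y, inner ℝ ζ (secondFund F x X Y) = χ ζ * inducedMetric F x X Y := by
      intro ζ Y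
      rw [← H.inducedMetric_shape hx, hA, (H.isInner hx).bilin.smul_left, smul_eq_mul]
    set v := (inducedMetric F x X X)⁻¹ • secondFund F x X X with hv
    have hmem : X ∈ eigenspace F x v := by
      intro Y
      refine ext_inner_left ℝ fun ζ => ?_
      rw [hα, inner_smul_right, hv, inner_smul_right, hα]
      field_simp
    obtain ⟨i, hi⟩ := hν v ⟨Submodule.smul_mem _ _ (secondFund_mem F x X X), by
      intro h0
      rw [h0] at hmem
      exact hX ((Submodule.mem_bot ℝ).mp hmem)⟩
    exact Submodule.mem_iSup_of_mem i (hi ▸ hmem)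
  refine eq_top_iff.mpr fun X _ => ?_
  obtain ⟨Y, hY, hYX⟩ := hle (Submodule.mem_top : e X ∈ ⊤)
  rwa [← e.injective hYX]

end IsImmersionOn

end Immersion

/-! ### Principal normal vector fields and the Moebius metric -/

section Adapted

variable {n m k : ℕ}

/-- `F` is an umbilic-free immersion of `U` with flat normal bundle, and `η₁, …, η_k` are its
principal normal vector fields, smooth and distinct at each point. -/
structure IsProperOn (U : Set (Euc n)) (F : Euc n → Euc m) (η : Fin k → Euc n → Euc m) : Prop
    extends IsImmersionOn U F where
  two_le : 2 ≤ n
  flat : ∀ y ∈ U, ∀ X Y : Euc n, ∀ v ∈ normalSpace F y, normalCurvature F y X Y v = 0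
  not_umbilic : ∀ y ∈ U, ¬ IsUmbilicAt F y
  smooth_normal : ∀ i, ContDiffOn ℝ ∞ (η i) U
  distinct : ∀ y ∈ U, ∀ i j, i ≠ j → η i y ≠ η j y
  principal : ∀ y ∈ U, ∀ v, IsPrincipalNormalAt F y v ↔ ∃ i, η i y = v

theorem isBilinearMap_moebiusForm {F : Euc n → Euc m} {x : Euc n}
    (hb : IsBilinearMap ℝ (inducedMetric F x)) : IsBilinearMap ℝ (moebiusForm F x) := by
  have ha := isBilinearMap_secondFund F x
  constructor <;> intros <;>
  simp only [moebiusForm, ha.add_left, ha.smul_left, ha.add_right, ha.smul_right, hb.add_left,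
    hb.smul_left, hb.add_right, hb.smul_right, smul_eq_mul] <;> module

theorem meanCurv_mem (F : Euc n → Euc m) (x : Euc n) : meanCurv F x ∈ normalSpace F x :=
  Submodule.smul_mem _ _ (Submodule.sum_mem _ fun _ _ => Submodule.sum_mem _ fun _ _ =>
    Submodule.smul_mem _ _ (secondFund_mem F x _ _))

theorem moebiusForm_mem (F : Euc n → Euc m) (x X Y : Euc n) :
    moebiusForm F x X Y ∈ normalSpace F x :=
  Submodule.smul_mem _ _ (Submodule.sub_mem _ (secondFund_mem F x X Y)
    (Submodule.smul_mem _ _ (meanCurv_mem F x)))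

/-- The multiplicity of the principal normal `η i` at `x`. -/
noncomputable def multiplicity (F : Euc n → Euc m) (η : Fin k → Euc n → Euc m) (x : Euc n)
    (i : Fin k) : ℕ :=
  Module.finrank ℝ (eigenspace F x (η i x))

namespace IsProperOn

variable {U : Set (Euc n)} {F : Euc n → Euc m} {η : Fin k → Euc n → Euc m}
  (H : IsProperOn U F η) {x : Euc n}
include H

theorem isPrincipalNormalAt (hx : x ∈ U) (i : Fin k) : IsPrincipalNormalAt F x (η i x) :=
  (H.principal x hx _).mpr ⟨i, rfl⟩

theorem normal_mem (hx : x ∈ U) (i : Fin k) : η i x ∈ normalSpace F x :=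
  (H.isPrincipalNormalAt hx i).1

theorem iSup_eq_top (hx : x ∈ U) : ⨆ i, eigenspace F x (η i x) = ⊤ :=
  H.toIsImmersionOn.iSup_eigenspace hx (H.flat x hx) (fun i => η i x)
    fun v hv => (H.principal x hx v).mp hv

theorem induced_eq_zero (hx : x ∈ U) {i j : Fin k} (hij : i ≠ j) {X Y : Euc n}
    (hX : X ∈ eigenspace F x (η i x)) (hY : Y ∈ eigenspace F x (η j x)) :
    inducedMetric F x X Y = 0 := by
  by_contra h0
  have h1 := hX Y
  rw [H.toIsImmersionOn.secondFund_symm hx, hY X, (H.toIsImmersionOn.isInner hx).symm Y] at h1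
  exact H.distinct x hx i j hij (smul_right_injective _ h0 h1).symm

/-- To prove an additive statement about all vectors it suffices to treat the eigenvectors. -/
theorem induction_on (hx : x ∈ U) {p : Euc n → Prop}
    (mem : ∀ i, ∀ X ∈ eigenspace F x (η i x), p X) (add : ∀ X Y, p X → p Y → p (X + Y))
    (X : Euc n) : p X := by
  have hX : X ∈ ⨆ i, eigenspace F x (η i x) := by rw [H.iSup_eq_top hx]; trivial
  by_cases hk : Nonempty (Fin k)
  · exact Submodule.iSup_induction _ (motive := p) hX mem (mem hk.some 0 (zero_mem _)) add
  · rw [not_nonempty_iff] at hk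
    rw [iSup_of_empty, Submodule.mem_bot] at hX
    -- without principal normals the tangent space would vanish
    exfalso
    have h0 : ∀ Y : Euc n, Y = 0 := fun Y => by
      have hY : Y ∈ ⨆ i, eigenspace F x (η i x) := by rw [H.iSup_eq_top hx]; trivial
      rwa [iSup_of_empty, Submodule.mem_bot] at hY
    have h2 := H.two_le
    have h1 := congrArg (fun Y : Euc n => Y ⟨0, by omega⟩) (h0 (stdVec ⟨0, by omega⟩))
    simp [stdVec] at h1

theorem isInternal (hx : x ∈ U) : DirectSum.IsInternal fun i => eigenspace F x (η i x) := by
  refine (DirectSum.isInternal_submodule_iff_iSupIndep_and_iSup_eq_top _).mpr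
    ⟨fun i => ?_, H.iSup_eq_top hx⟩
  have hg := H.toIsImmersionOn.isInner hx
  refine Submodule.disjoint_def.mpr fun X hX hX' => ?_
  have h1 : ∀ Y ∈ ⨆ j, ⨆ (_ : j ≠ i), eigenspace F x (η j x), inducedMetric F x X Y = 0 := by
    intro Y hY
    have hle : ⨆ j, ⨆ (_ : j ≠ i), eigenspace F x (η j x)
        ≤ LinearMap.ker (hg.bilin.toLinearMap X) := by
      refine iSup_le fun j => iSup_le fun hj Z hZ => ?_
      exact H.induced_eq_zero hx (Ne.symm hj) hX hZ
    exact hle hY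
  by_contra hne
  exact (hg.pos X hne).ne' (h1 X hX')

/-- The trace of an operator acting on each eigenspace as a scalar; the traces defining the mean
curvature and `‖α‖²` are of this kind. -/
theorem trace_eq (hx : x ∈ U) (A : Euc n →ₗ[ℝ] Euc n) (c : Fin k → ℝ)
    (hA : ∀ i, ∀ X ∈ eigenspace F x (η i x), A X = c i • X) :
    ∑ j, A (stdVec j) j = ∑ i, multiplicity F η x i * c i := by
  have h1 : ∀ i, Set.MapsTo A (eigenspace F x (η i x)) (eigenspace F x (η i x)) := by
    intro i X hX
    rw [hA i X hX]
    exact Submodule.smul_mem _ _ hX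
  have h2 := LinearMap.trace_eq_sum_trace_restrict (H.isInternal hx) h1
  have h3 : ∀ i, A.restrict (h1 i) = c i • LinearMap.id := by
    intro i
    exact LinearMap.ext fun X => Subtype.ext (hA i X X.2)
  have h4 : LinearMap.trace ℝ (Euc n) A = ∑ j, A (stdVec j) j := by
    rw [LinearMap.trace_eq_matrix_trace ℝ (EuclideanSpace.basisFun (Fin n) ℝ).toBasis]
    simp [Matrix.trace, LinearMap.toMatrix_apply, stdVec]
  rw [← h4, h2]
  refine Finset.sum_congr rfl fun i _ => ?_
  rw [h3, map_smul, LinearMap.trace_id, smul_eq_mul, mul_comm]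
  rfl

theorem sum_multiplicity (hx : x ∈ U) : ∑ i, (multiplicity F η x i : ℝ) = n := by
  have h1 := H.trace_eq hx LinearMap.id (fun _ => 1) (by simp)
  simp only [mul_one] at h1
  rw [← h1]
  simp [stdVec]

theorem multiplicity_pos (hx : x ∈ U) (i : Fin k) : 0 < multiplicity F η x i := by
  have h1 := (H.isPrincipalNormalAt hx i).2
  rw [multiplicity, Module.finrank_pos_iff]
  exact Submodule.nontrivial_iff_ne_bot.mpr h1

theorem exists_ne_zero (hx : x ∈ U) (i : Fin k) : ∃ X ∈ eigenspace F x (η i x), X ≠ 0 :=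
  Submodule.exists_mem_ne_zero_of_ne_bot (H.isPrincipalNormalAt hx i).2

theorem smul_meanCurv (hx : x ∈ U) :
    (n : ℝ) • meanCurv F x = ∑ i, (multiplicity F η x i : ℝ) • η i x := by
  have h2 := H.two_le
  have hn : (n : ℝ) ≠ 0 := by positivity
  have hI := H.toIsImmersionOn
  refine ext_inner_left ℝ fun ζ => ?_
  let A : Euc n →ₗ[ℝ] Euc n :=
    { toFun := shape F x ζ, map_add' := hI.shape_add hx ζ, map_smul' := hI.shape_smul hx ζ }
  have h1 := H.trace_eq hx A (fun i => inner ℝ ζ (η i x))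
    fun i X hX => hI.shape_of_mem hx ζ hX
  rw [meanCurv, smul_smul, mul_one_div_cancel hn, one_smul]
  simp only [inner_sum, inner_smul_right]
  rw [← h1]
  exact Finset.sum_congr rfl fun i _ => (sharp_coord _ _ i).symm

theorem secondFundNormSq_eq (hx : x ∈ U) :
    secondFundNormSq F x = ∑ i, multiplicity F η x i * ‖η i x‖ ^ 2 := by
  have hI := H.toIsImmersionOn
  have hn : ∀ a b : Euc m, inner ℝ a b = ∑ s, inner ℝ (stdVec s) a * inner ℝ (stdVec s) b := by
    intro a b
    simp [stdVec, PiLp.inner_apply, mul_comm]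
  have h1 : ∀ s : Fin m, ∑ j, shape F x (stdVec s) (shape F x (stdVec s) (stdVec j)) j
      = ∑ i, multiplicity F η x i * (inner ℝ (stdVec s) (η i x) * inner ℝ (stdVec s) (η i x)) := by
    intro s
    let A : Euc n →ₗ[ℝ] Euc n :=
      { toFun := shape F x (stdVec s), map_add' := hI.shape_add hx _,
        map_smul' := hI.shape_smul hx _ }
    refine H.trace_eq hx (A ∘ₗ A) _ fun i X hX => ?_
    change shape F x (stdVec s) (shape F x (stdVec s) X) = _
    rw [hI.shape_of_mem hx _ hX, hI.shape_smul hx, hI.shape_of_mem hx _ hX, smul_smul]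
  have hsymm : ∀ i j, (gram (inducedMetric F) x)⁻¹ i j = (gram (inducedMetric F) x)⁻¹ j i := by
    have h2 : (gram (inducedMetric F) x).transpose = gram (inducedMetric F) x := by
      ext i j
      exact (hI.isInner hx).symm _ _
    intro i j
    conv_lhs => rw [← h2, ← Matrix.transpose_nonsing_inv]
    rfl
  have h3 : ∀ s : Fin m, ∑ j, shape F x (stdVec s) (shape F x (stdVec s) (stdVec j)) j
      = ∑ i, ∑ j, ∑ k, ∑ l, (gram (inducedMetric F) x)⁻¹ i k * (gram (inducedMetric F) x)⁻¹ j l *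
        (inner ℝ (stdVec s) (secondFund F x (stdVec i) (stdVec j)) *
          inner ℝ (stdVec s) (secondFund F x (stdVec k) (stdVec l))) := by
    intro s
    refine Finset.sum_congr rfl fun a _ => ?_
    rw [shape, sharp_coord]
    have h4 : ∀ c, inner ℝ (stdVec s) (secondFund F x (shape F x (stdVec s) (stdVec a)) (stdVec c))
        = ∑ d, ∑ e, (gram (inducedMetric F) x)⁻¹ d e *
          inner ℝ (stdVec s) (secondFund F x (stdVec a) (stdVec e)) *
            inner ℝ (stdVec s) (secondFund F x (stdVec d) (stdVec c)) := by
      intro c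
      have h5 := map_sum ((innerForm m (stdVec s)).toLinearMap ∘ₗ
        ((isBilinearMap_secondFund F x).toLinearMap.flip (stdVec c)))
        (fun d => (shape F x (stdVec s) (stdVec a)) d • stdVec d) Finset.univ
      rw [sum_coord_smul] at h5
      refine h5.trans (Finset.sum_congr rfl fun d _ => ?_)
      rw [map_smul, shape, sharp_coord, smul_eq_mul, Finset.sum_mul]
      rfl
    simp only [h4, Finset.mul_sum]
    conv_rhs => rw [Finset.sum_comm]
    refine Finset.sum_congr rfl fun c _ => ?_
    conv_rhs => rw [Finset.sum_comm]
    refine Finset.sum_congr rfl fun d _ => Finset.sum_congr rfl fun e _ => ?_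
    rw [hsymm d e, hI.secondFund_symm hx (stdVec d)]
    ring
  have h6 : secondFundNormSq F x = ∑ s : Fin m, ∑ i, ∑ j, ∑ k, ∑ l,
      (gram (inducedMetric F) x)⁻¹ i k * (gram (inducedMetric F) x)⁻¹ j l *
        (inner ℝ (stdVec s) (secondFund F x (stdVec i) (stdVec j)) *
          inner ℝ (stdVec s) (secondFund F x (stdVec k) (stdVec l))) := by
    rw [secondFundNormSq]
    conv_rhs => rw [Finset.sum_comm]
    refine Finset.sum_congr rfl fun i _ => ?_
    conv_rhs => rw [Finset.sum_comm]
    refine Finset.sum_congr rfl fun j _ => ?_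
    conv_rhs => rw [Finset.sum_comm]
    refine Finset.sum_congr rfl fun a _ => ?_
    conv_rhs => rw [Finset.sum_comm]
    refine Finset.sum_congr rfl fun c _ => ?_
    rw [hn (secondFund F x (stdVec i) (stdVec j)), Finset.mul_sum]
  simp only [h6, ← h3, h1]
  rw [Finset.sum_comm]
  refine Finset.sum_congr rfl fun i _ => ?_
  rw [← real_inner_self_eq_norm_sq, hn (η i x), Finset.mul_sum]

/-- `ρ² = n/(n-1) ∑ᵢ mᵢ ‖ηᵢ - H‖²`. -/
theorem normSq_sub_eq (hx : x ∈ U) :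
    secondFundNormSq F x - n * ‖meanCurv F x‖ ^ 2
      = ∑ i, multiplicity F η x i * ‖η i x - meanCurv F x‖ ^ 2 := by
  have h1 := congrArg (fun v => inner ℝ v (meanCurv F x)) (H.smul_meanCurv hx)
  simp only [sum_inner, inner_smul_left, real_inner_self_eq_norm_sq] at h1
  simp only [norm_sub_sq_real, mul_add, mul_sub, Finset.sum_add_distrib, Finset.sum_sub_distrib,
    ← Finset.sum_mul, H.sum_multiplicity hx, H.secondFundNormSq_eq hx]
  have h2 : ∑ i, (multiplicity F η x i : ℝ) * (2 * inner ℝ (η i x) (meanCurv F x))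
      = 2 * (n * ‖meanCurv F x‖ ^ 2) := by
    simp only [conj_trivial] at h1
    rw [h1, Finset.mul_sum]
    exact Finset.sum_congr rfl fun i _ => by ring
  rw [h2]
  ring

theorem radicand_pos (hx : x ∈ U) :
    0 < (n : ℝ) / ((n : ℝ) - 1) * (secondFundNormSq F x - (n : ℝ) * ‖meanCurv F x‖ ^ 2) := by
  have hI := H.toIsImmersionOn
  have h2 : (2 : ℝ) ≤ n := by exact_mod_cast H.two_le
  refine mul_pos (div_pos (by linarith) (by linarith)) ?_
  rw [H.normSq_sub_eq hx]
  by_contra hle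
  have h0 : ∀ i ∈ Finset.univ,
      0 ≤ (multiplicity F η x i : ℝ) * ‖η i x - meanCurv F x‖ ^ 2 := fun i _ => by positivity
  have h1 := (Finset.sum_eq_zero_iff_of_nonneg h0).mp
    (le_antisymm (not_lt.mp hle) (Finset.sum_nonneg h0))
  refine H.not_umbilic x hx fun X Y => ?_
  refine H.induction_on hx (p := fun X => secondFund F x X Y
    = inducedMetric F x X Y • meanCurv F x) ?_ ?_ X
  · intro i Z hZ
    have h3 : (multiplicity F η x i : ℝ) ≠ 0 := by exact_mod_cast (H.multiplicity_pos hx i).ne'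
    have h4 := h1 i (Finset.mem_univ i)
    have h5 : η i x = meanCurv F x := by
      rw [← sub_eq_zero, ← norm_eq_zero]
      exact pow_eq_zero_iff (two_ne_zero) |>.mp ((mul_eq_zero.mp h4).resolve_left h3)
    rw [hZ Y, h5]
  · intro Z W hZ hW
    rw [(isBilinearMap_secondFund F x).add_left, (hI.isInner hx).bilin.add_left, hZ, hW, add_smul]

theorem moebiusFactor_pos (hx : x ∈ U) : 0 < moebiusFactor F x :=
  Real.sqrt_pos.mpr (H.radicand_pos hx)

theorem smooth_moebiusFactor : ContDiffOn ℝ ∞ (moebiusFactor F) U := by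
  have hI := H.toIsImmersionOn
  refine ContDiffOn.sqrt (contDiffOn_const.mul (hI.smooth_secondFundNormSq.sub
    (contDiffOn_const.mul (hI.smooth_meanCurv.norm_sq ℝ)))) fun y hy => (H.radicand_pos hy).ne'

theorem isInner_moebiusMetric (hx : x ∈ U) : IsInner (moebiusMetric F x) := by
  have hg := H.toIsImmersionOn.isInner hx
  have hρ := H.moebiusFactor_pos hx
  refine ⟨?_, fun X Y => by simp only [moebiusMetric, hg.symm X Y], fun X hX =>
    mul_pos (by positivity) (hg.pos X hX)⟩
  constructor <;> intros <;> simp only [moebiusMetric, hg.bilin.add_left, hg.bilin.smul_left,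
    hg.bilin.add_right, hg.bilin.smul_right, smul_eq_mul] <;> ring

theorem moebiusMetric_eq_zero (hx : x ∈ U) {i j : Fin k} (hij : i ≠ j) {X Y : Euc n}
    (hX : X ∈ eigenspace F x (η i x)) (hY : Y ∈ eigenspace F x (η j x)) :
    moebiusMetric F x X Y = 0 := by
  rw [moebiusMetric, H.induced_eq_zero hx hij hX hY, mul_zero]

theorem moebiusPrincipalNormal_mem (hx : x ∈ U) (i : Fin k) :
    moebiusPrincipalNormal F (η i) x ∈ normalSpace F x :=
  Submodule.smul_mem _ _ (Submodule.sub_mem _ (H.normal_mem hx i) (meanCurv_mem F x))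

theorem smooth_moebiusPrincipalNormal (i : Fin k) :
    ContDiffOn ℝ ∞ (moebiusPrincipalNormal F (η i)) U :=
  (H.smooth_moebiusFactor.inv fun _ hy => (H.moebiusFactor_pos hy).ne').smul
    ((H.smooth_normal i).sub H.toIsImmersionOn.smooth_meanCurv)

theorem moebiusForm_of_mem (hx : x ∈ U) {i : Fin k} {X : Euc n}
    (hX : X ∈ eigenspace F x (η i x)) (Y : Euc n) :
    moebiusForm F x X Y = moebiusMetric F x X Y • moebiusPrincipalNormal F (η i) x := by
  have hρ := (H.moebiusFactor_pos hx).ne'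
  rw [moebiusForm, hX Y, moebiusMetric, moebiusPrincipalNormal, ← smul_sub, smul_smul, smul_smul]
  congr 1
  field_simp

theorem moebiusForm_symm (hx : x ∈ U) (X Y : Euc n) :
    moebiusForm F x X Y = moebiusForm F x Y X := by
  rw [moebiusForm, H.toIsImmersionOn.secondFund_symm hx,
    (H.toIsImmersionOn.isInner hx).symm, moebiusForm]

theorem moebiusPrincipalNormal_ne (hx : x ∈ U) {i j : Fin k} (hij : i ≠ j) :
    moebiusPrincipalNormal F (η i) x ≠ moebiusPrincipalNormal F (η j) x := by
  intro h0
  have hρ := (inv_pos.mpr (H.moebiusFactor_pos hx)).ne'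
  exact H.distinct x hx i j hij (sub_left_injective (smul_right_injective _ hρ h0))

theorem smooth_moebiusForm (X Y : Euc n) : ContDiffOn ℝ ∞ (fun y => moebiusForm F y X Y) U :=
  H.smooth_moebiusFactor.smul ((H.toIsImmersionOn.smooth_secondFund X Y).sub
    ((H.toIsImmersionOn.isMetricOf.smooth_metric X Y).smul H.toIsImmersionOn.smooth_meanCurv))

/-- The trace of the Moebius second fundamental form vanishes. -/
theorem sum_smul_moebiusPrincipalNormal (hx : x ∈ U) :
    ∑ i, (multiplicity F η x i : ℝ) • moebiusPrincipalNormal F (η i) x = 0 := by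
  have h1 : ∀ i, (multiplicity F η x i : ℝ) • moebiusPrincipalNormal F (η i) x
      = (moebiusFactor F x)⁻¹ • ((multiplicity F η x i : ℝ) • η i x
        - (multiplicity F η x i : ℝ) • meanCurv F x) := fun i => by
    rw [moebiusPrincipalNormal, ← smul_sub, smul_comm]
  simp only [h1]
  rw [← Finset.smul_sum, Finset.sum_sub_distrib, ← Finset.sum_smul, H.sum_multiplicity hx,
    ← H.smul_meanCurv hx, sub_self, smul_zero]

/-- The Moebius second fundamental form has constant norm. -/
theorem sum_mul_norm_moebiusPrincipalNormal (hx : x ∈ U) :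
    ∑ i, (multiplicity F η x i : ℝ) * ‖moebiusPrincipalNormal F (η i) x‖ ^ 2
      = ((n : ℝ) - 1) / n := by
  have h2 : (2 : ℝ) ≤ n := by exact_mod_cast H.two_le
  have hρ := (H.moebiusFactor_pos hx).ne'
  have h3 : moebiusFactor F x ^ 2 = _ := Real.sq_sqrt (H.radicand_pos hx).le
  rw [H.normSq_sub_eq hx] at h3
  have h1 : ∀ i, (multiplicity F η x i : ℝ) * ‖moebiusPrincipalNormal F (η i) x‖ ^ 2
      = (moebiusFactor F x ^ 2)⁻¹ * (multiplicity F η x i * ‖η i x - meanCurv F x‖ ^ 2) := by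
    intro i
    rw [moebiusPrincipalNormal, norm_smul, mul_pow, norm_inv, inv_pow, Real.norm_eq_abs, sq_abs]
    ring
  simp only [h1]
  rw [← Finset.mul_sum]
  have h4 : (n : ℝ) - 1 ≠ 0 := by linarith
  have h5 : (n : ℝ) ≠ 0 := by linarith
  have h6 : moebiusFactor F x ^ 2 ≠ 0 := pow_ne_zero 2 hρ
  rw [div_mul_eq_mul_div, eq_div_iff h4] at h3
  field_simp
  linarith

end IsProperOn

end Adapted

/-! ### Sections of the eigenbundles -/

section Sections

variable {n m k : ℕ}

namespace IsProperOn

variable {U : Set (Euc n)} {F : Euc n → Euc m} {η : Fin k → Euc n → Euc m}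
  (H : IsProperOn U F η) {x : Euc n}
include H

/-- The operator `A_ζ - ⟨ζ, ηᵢ⟩` annihilates `E_i` and preserves the other eigenspaces. -/
theorem shape_sub_mem (hx : x ∈ U) (s : Finset (Fin k)) (i : Fin k) (ζ : Euc m) {X : Euc n}
    (hX : X ∈ ⨆ l, ⨆ (_ : l ∉ s), eigenspace F x (η l x)) :
    shape F x ζ X - (inner ℝ ζ (η i x) : ℝ) • X
      ∈ ⨆ l, ⨆ (_ : l ∉ insert i s), eigenspace F x (η l x) := by
  have hI := H.toIsImmersionOn
  let A : Euc n →ₗ[ℝ] Euc n :=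
    { toFun := shape F x ζ, map_add' := hI.shape_add hx ζ, map_smul' := hI.shape_smul hx ζ }
  have hle : ⨆ l, ⨆ (_ : l ∉ s), eigenspace F x (η l x)
      ≤ (⨆ l, ⨆ (_ : l ∉ insert i s), eigenspace F x (η l x)).comap
        (A - (inner ℝ ζ (η i x) : ℝ) • LinearMap.id) := by
    refine iSup_le fun l => iSup_le fun hl Z hZ => ?_
    have h1 : (A - (inner ℝ ζ (η i x) : ℝ) • LinearMap.id : Euc n →ₗ[ℝ] Euc n) Z
        = (inner ℝ ζ (η l x) - inner ℝ ζ (η i x) : ℝ) • Z := by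
      rw [sub_smul, ← hI.shape_of_mem hx ζ hZ]
      rfl
    rw [Submodule.mem_comap, h1]
    by_cases hli : l = i
    · rw [hli, sub_self, zero_smul]
      exact zero_mem _
    · exact Submodule.smul_mem _ _ (Submodule.mem_iSup_of_mem l
        (Submodule.mem_iSup_of_mem (by simp [hli, hl]) hZ))
  exact hle hX

/-- Every vector of `E_j` extends to a section of the eigenbundle of `η j`: apply to the constant
field the Lagrange product of the operators `A_ζ - ⟨ζ, ηᵢ⟩` with `i ≠ j`, `ζ = ηⱼ(x) - ηᵢ(x)`. -/
theorem exists_section (hx : x ∈ U) (j : Fin k) {Y₀ : Euc n} (hY₀ : Y₀ ∈ eigenspace F x (η j x)) :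
    ∃ Y : Euc n → Euc n, DifferentiableAt ℝ Y x ∧ Y x = Y₀ ∧
      ∀ y ∈ U, Y y ∈ eigenspace F y (η j y) := by
  have hI := H.toIsImmersionOn
  have key : ∀ s : Finset (Fin k), j ∉ s → ∃ Y : Euc n → Euc n, DifferentiableAt ℝ Y x ∧
      Y x = Y₀ ∧ ∀ y ∈ U, Y y ∈ ⨆ l, ⨆ (_ : l ∉ s), eigenspace F y (η l y) := by
    intro s
    induction s using Finset.induction_on with
    | empty =>
      intro _
      refine ⟨fun _ => Y₀, differentiableAt_const _, rfl, fun y hy => ?_⟩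
      simp [H.iSup_eq_top hy]
    | insert i s _ ih =>
      intro hj
      rw [Finset.mem_insert, not_or] at hj
      obtain ⟨Y, hYd, hYx, hY⟩ := ih hj.2
      set ζ := η j x - η i x with hζ
      have hζ0 : (inner ℝ ζ ζ : ℝ) ≠ 0 := by
        rw [inner_self_ne_zero, hζ]
        exact sub_ne_zero.mpr (H.distinct x hx j i hj.1)
      have hηd := differentiableAt_of_contDiffOn H.isOpen (H.smooth_normal i) hx
      refine ⟨fun y => (inner ℝ ζ ζ : ℝ)⁻¹ •
        (shape F y ζ (Y y) - (inner ℝ ζ (η i y) : ℝ) • Y y), ?_, ?_, fun y hy => ?_⟩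
      · have hd : DifferentiableAt ℝ (fun y => (inner ℝ ζ (η i y) : ℝ)) x :=
          differentiableAt_form (innerForm m) (differentiableAt_const ζ) hηd
        exact ((hI.differentiableAt_shape hx ζ hYd).sub (hd.fun_smul hYd)).const_smul
          (inner ℝ ζ ζ : ℝ)⁻¹
      · simp only [hYx]
        rw [hI.shape_of_mem hx ζ hY₀, ← sub_smul, ← inner_sub_right, ← hζ, smul_smul,
          inv_mul_cancel₀ hζ0, one_smul]
      · exact Submodule.smul_mem _ _ (H.shape_sub_mem hy s i ζ (hY y hy))
  obtain ⟨Y, hYd, hYx, hY⟩ := key (Finset.univ.erase j) (by simp)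
  refine ⟨Y, hYd, hYx, fun y hy => ?_⟩
  have hle : ⨆ l, ⨆ (_ : l ∉ Finset.univ.erase j), eigenspace F y (η l y)
      ≤ eigenspace F y (η j y) := by
    refine iSup_le fun l => iSup_le fun hl => ?_
    have hlj : l = j := by simpa using hl
    rw [hlj]
  exact hle (hY y hy)

theorem eventually_multiplicity_le (hx : x ∈ U) (i : Fin k) :
    ∀ᶠ y in 𝓝 x, multiplicity F η x i ≤ multiplicity F η y i := by
  let v := Module.finBasis ℝ (eigenspace F x (η i x))
  choose Y hYd hYx hY using fun a => H.exists_section hx i (v a).2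
  have hli : LinearIndependent ℝ fun a => Y a x := by
    simp only [hYx]
    exact v.linearIndependent.map' (Submodule.subtype _) (Submodule.ker_subtype _)
  have hcont : ContinuousAt (fun y a => Y a y) x :=
    continuousAt_pi.mpr fun a => (hYd a).continuousAt
  filter_upwards [hcont.eventually (isOpen_setOfPred_linearIndependent.mem_nhds hli),
    H.isOpen.mem_nhds hx] with y hy hyU
  have h1 : LinearIndependent ℝ fun a => (⟨Y a y, hY a y hyU⟩ : eigenspace F y (η i y)) :=
    LinearIndependent.of_comp (Submodule.subtype _) hy
  have h2 := h1.fintype_card_le_finrank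
  rwa [Fintype.card_fin] at h2

/-- The multiplicities are locally constant. -/
theorem eventually_multiplicity_eq (hx : x ∈ U) :
    ∀ᶠ y in 𝓝 x, ∀ i, multiplicity F η y i = multiplicity F η x i := by
  filter_upwards [eventually_all.mpr (H.eventually_multiplicity_le hx),
    H.isOpen.mem_nhds hx] with y hy hyU i
  have h1 : ∑ i, multiplicity F η x i = ∑ i, multiplicity F η y i := by
    have h2 := (H.sum_multiplicity hx).trans (H.sum_multiplicity hyU).symm
    exact_mod_cast h2
  exact ((Finset.sum_eq_sum_iff_of_le fun i _ => hy i).mp h1 i (Finset.mem_univ i)).symm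

end IsProperOn

end Sections

/-! ### The light cone -/

section LightCone

variable {n m : ℕ}

/-- The space `ℝ^{m+2}` carrying the Lorentz form `lorentz`; the first two coordinates are null. -/
abbrev Lor (m : ℕ) : Type := ℝ × ℝ × Euc m

/-- The Lorentz form `⟨z, z'⟩ - (a c' + c a') / 2` of `(a, c, z)` and `(a', c', z')`. -/
noncomputable def lorentz (m : ℕ) : Lor m →L[ℝ] Lor m →L[ℝ] ℝ :=
  (innerForm m).bilinearComp
      ((ContinuousLinearMap.snd ℝ ℝ (Euc m)).comp (ContinuousLinearMap.snd ℝ ℝ (ℝ × Euc m)))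
      ((ContinuousLinearMap.snd ℝ ℝ (Euc m)).comp (ContinuousLinearMap.snd ℝ ℝ (ℝ × Euc m)))
    - (1 / 2 : ℝ) • ((ContinuousLinearMap.mul ℝ ℝ).bilinearComp
        (ContinuousLinearMap.fst ℝ ℝ (ℝ × Euc m))
        ((ContinuousLinearMap.fst ℝ ℝ (Euc m)).comp (ContinuousLinearMap.snd ℝ ℝ (ℝ × Euc m)))
      + (ContinuousLinearMap.mul ℝ ℝ).bilinearComp
        ((ContinuousLinearMap.fst ℝ ℝ (Euc m)).comp (ContinuousLinearMap.snd ℝ ℝ (ℝ × Euc m)))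
        (ContinuousLinearMap.fst ℝ ℝ (ℝ × Euc m)))

theorem lorentz_apply (v w : Lor m) :
    lorentz m v w = inner ℝ v.2.2 w.2.2 - (1 / 2) * (v.1 * w.2.1 + v.2.1 * w.1) := rfl

theorem lorentz_symm (v w : Lor m) : lorentz m v w = lorentz m w v := by
  rw [lorentz_apply, lorentz_apply, real_inner_comm]
  ring

/-- The isometric embedding of `ℝᵐ` into the light cone. -/
noncomputable def cone (z : Euc m) : Lor m := (1, ‖z‖ ^ 2, z)

/-- The derivative of `cone`. -/
noncomputable def coneDeriv (z w : Euc m) : Lor m := (0, 2 * inner ℝ z w, w)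

theorem lorentz_cone_cone (z : Euc m) : lorentz m (cone z) (cone z) = 0 := by
  simp only [lorentz_apply, cone, real_inner_self_eq_norm_sq]
  ring

theorem lorentz_coneDeriv_cone (z w : Euc m) : lorentz m (coneDeriv z w) (cone z) = 0 := by
  simp only [lorentz_apply, cone, coneDeriv, real_inner_comm]
  ring

theorem lorentz_coneDeriv (z v w : Euc m) :
    lorentz m (coneDeriv z v) (coneDeriv z w) = inner ℝ v w := by
  simp [lorentz_apply, coneDeriv]

theorem coneDeriv_zero (z : Euc m) : coneDeriv z 0 = 0 := by
  simp [coneDeriv]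

theorem contDiff_cone : ContDiff ℝ ∞ (cone : Euc m → Lor m) :=
  contDiff_const.prodMk ((contDiff_norm_sq ℝ).prodMk contDiff_id)

theorem fderiv_cone_comp {E : Type*} [NormedAddCommGroup E] [NormedSpace ℝ E] {F : E → Euc m}
    {x : E} (hF : DifferentiableAt ℝ F x) (X : E) :
    fderiv ℝ (fun y => cone (F y)) x X = coneDeriv (F x) (fderiv ℝ F x X) := by
  have h1 : HasFDerivAt (fun y => cone (F y)) _ x :=
    (hasFDerivAt_const (1 : ℝ) x).prodMk (hF.hasFDerivAt.norm_sq.prodMk hF.hasFDerivAt)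
  rw [h1.fderiv]
  simp [coneDeriv]

theorem hasFDerivAt_coneDeriv_comp {E : Type*} [NormedAddCommGroup E] [NormedSpace ℝ E]
    {F G : E → Euc m} {x : E} (hF : DifferentiableAt ℝ F x) (hG : DifferentiableAt ℝ G x) :
    ∃ L : E →L[ℝ] Lor m, HasFDerivAt (fun y => coneDeriv (F y) (G y)) L x ∧
      ∀ X, L X = coneDeriv (F x) (fderiv ℝ G x X)
        + (0, 2 * inner ℝ (fderiv ℝ F x X) (G x), 0) := by
  have h2 := ((differentiableAt_form (innerForm m) hF hG).const_mul 2).hasFDerivAt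
  refine ⟨_, (hasFDerivAt_const (0 : ℝ) x).prodMk (h2.prodMk hG.hasFDerivAt), fun X => ?_⟩
  have h3 := fderiv_form (innerForm m) hF hG X
  have h4 : fderiv ℝ (fun y => 2 * (innerForm m (F y) (G y))) x X
      = 2 * (inner ℝ (fderiv ℝ F x X) (G x) + inner ℝ (F x) (fderiv ℝ G x X)) := by
    rw [fderiv_const_mul (differentiableAt_form (innerForm m) hF hG), smul_apply, h3]
    rfl
  simp only [ContinuousLinearMap.prod_apply, h4, coneDeriv, zero_apply, Prod.mk_add_mk,
    add_zero]
  refine Prod.ext rfl (Prod.ext ?_ rfl)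
  ring

/-- The immersion `ρ (1, ‖F‖², F)` into the light cone, which induces the Moebius metric. -/
noncomputable def coneMap (F : Euc n → Euc m) (x : Euc n) : Lor m :=
  moebiusFactor F x • cone (F x)

namespace IsProperOn

variable {k : ℕ} {U : Set (Euc n)} {F : Euc n → Euc m} {η : Fin k → Euc n → Euc m}
  (H : IsProperOn U F η) {x : Euc n}
include H

theorem fderiv_coneMap (hx : x ∈ U) (X : Euc n) :
    fderiv ℝ (coneMap F) x X = fderiv ℝ (moebiusFactor F) x X • cone (F x)
      + moebiusFactor F x • coneDeriv (F x) (fderiv ℝ F x X) := by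
  have hF := differentiableAt_of_contDiffOn H.isOpen H.smooth hx
  have hρ := differentiableAt_of_contDiffOn H.isOpen H.smooth_moebiusFactor hx
  have hc : DifferentiableAt ℝ (fun y => cone (F y)) x :=
    (contDiff_cone.differentiable (by simp) (F x)).comp x hF
  unfold coneMap
  rw [fderiv_fun_smul hρ hc]
  simp [fderiv_cone_comp hF, add_comm]

theorem isMetricOf_coneMap : IsMetricOf (lorentz m) U (coneMap F) (moebiusMetric F) where
  isOpen := H.isOpen
  form_symm := lorentz_symm
  smooth := H.smooth_moebiusFactor.smul (contDiff_cone.comp_contDiffOn H.smooth)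
  metric y hy X Y := by
    have h1 : ∀ w, lorentz m (cone (F y)) (coneDeriv (F y) w) = 0 := fun w => by
      rw [lorentz_symm, lorentz_coneDeriv_cone]
    simp only [H.fderiv_coneMap hy, map_add, map_smul, add_apply, smul_apply,
      lorentz_coneDeriv, lorentz_coneDeriv_cone, lorentz_cone_cone, h1, smul_eq_mul,
      moebiusMetric, inducedMetric]
    ring
  pos y hy := (H.isInner_moebiusMetric hy).pos

/-- The second derivative of `coneMap F`, up to a multiple of the position vector. -/
theorem exists_fderiv_fderiv_coneMap (hx : x ∈ U) (X Y : Euc n) : ∃ c : ℝ,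
    fderiv ℝ (fderiv ℝ (coneMap F)) x X Y = c • cone (F x)
      + fderiv ℝ (moebiusFactor F) x Y • coneDeriv (F x) (fderiv ℝ F x X)
      + fderiv ℝ (moebiusFactor F) x X • coneDeriv (F x) (fderiv ℝ F x Y)
      + moebiusFactor F x • (coneDeriv (F x) (fderiv ℝ (fderiv ℝ F) x X Y)
        + ((0, 2 * inducedMetric F x X Y, 0) : Lor m)) := by
  have hF := differentiableAt_of_contDiffOn H.isOpen H.smooth hx
  have hdF := differentiableAt_of_contDiffOn H.isOpen (contDiffOn_fderiv H.isOpen H.smooth) hx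
  have hρ := differentiableAt_of_contDiffOn H.isOpen H.smooth_moebiusFactor hx
  have hdρ := differentiableAt_of_contDiffOn H.isOpen
    (contDiffOn_fderiv H.isOpen H.smooth_moebiusFactor) hx
  have hc : DifferentiableAt ℝ (fun y => cone (F y)) x :=
    (contDiff_cone.differentiable (by simp) (F x)).comp x hF
  have hdΨ := differentiableAt_of_contDiffOn H.isOpen H.isMetricOf_coneMap.smooth_fderiv hx
  obtain ⟨L, hL, hLX⟩ := hasFDerivAt_coneDeriv_comp hF (hdF.clm_apply (differentiableAt_const Y))
  have h1 : (fun y => fderiv ℝ (coneMap F) y Y) =ᶠ[𝓝 x] fun y =>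
      fderiv ℝ (moebiusFactor F) y Y • cone (F y)
        + moebiusFactor F y • coneDeriv (F y) (fderiv ℝ F y Y) := by
    filter_upwards [H.isOpen.mem_nhds hx] with y hy using H.fderiv_coneMap hy Y
  have hρY := hdρ.clm_apply (differentiableAt_const Y)
  refine ⟨fderiv ℝ (fderiv ℝ (moebiusFactor F)) x X Y, ?_⟩
  rw [← fderiv_clm_apply_const hdΨ, h1.fderiv_eq,
    fderiv_fun_add (hρY.fun_smul hc) (hρ.fun_smul hL.differentiableAt),
    fderiv_fun_smul hρY hc, fderiv_fun_smul hρ hL.differentiableAt, hL.fderiv]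
  simp only [add_apply, smul_apply, ContinuousLinearMap.smulRight_apply, hLX,
    fderiv_clm_apply_const hdρ, fderiv_clm_apply_const hdF, fderiv_cone_comp hF, inducedMetric]
  abel

/-- Lifts of normal vectors of `F` are normal to `coneMap F`. -/
theorem lift_normal (hx : x ∈ U) {ξ : Euc m} (hξ : ξ ∈ normalSpace F x) (t : ℝ) (Z : Euc n) :
    lorentz m (fderiv ℝ (coneMap F) x Z) (coneDeriv (F x) ξ + t • cone (F x)) = 0 := by
  have h1 : ∀ w, lorentz m (cone (F x)) (coneDeriv (F x) w) = 0 := fun w => by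
    rw [lorentz_symm, lorentz_coneDeriv_cone]
  have h2 := mem_normalSpace.mp hξ Z
  rw [real_inner_comm] at h2
  simp only [H.fderiv_coneMap hx, map_add, map_smul, add_apply, smul_apply, lorentz_coneDeriv,
    lorentz_coneDeriv_cone, lorentz_cone_cone, h1, h2]
  simp

/-- The second fundamental form of the immersion into the light cone, paired with the normal
vectors orthogonal to the position vector. -/
theorem lorentz_ambientForm_lift (hx : x ∈ U) {ξ : Euc m} (hξ : ξ ∈ normalSpace F x) (t : ℝ)
    (X Y : Euc n) :
    lorentz m (ambientForm (coneMap F) (moebiusMetric F) x X Y)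
        (coneDeriv (F x) ξ + t • cone (F x))
      = moebiusFactor F x * (inner ℝ (secondFund F x X Y) ξ - t * inducedMetric F x X Y) := by
  obtain ⟨c, hc⟩ := H.exists_fderiv_fderiv_coneMap hx X Y
  have h1 : ∀ w, lorentz m (cone (F x)) (coneDeriv (F x) w) = 0 := fun w => by
    rw [lorentz_symm, lorentz_coneDeriv_cone]
  have h2 : ∀ Z, inner ℝ (fderiv ℝ F x Z) ξ = 0 := fun Z => by
    rw [real_inner_comm]
    exact mem_normalSpace.mp hξ Z
  have h3 : lorentz m ((0, 2 * inducedMetric F x X Y, 0) : Lor m) (cone (F x))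
      = - inducedMetric F x X Y := by
    simp [lorentz_apply, cone]
  have h4 : lorentz m ((0, 2 * inducedMetric F x X Y, 0) : Lor m) (coneDeriv (F x) ξ) = 0 := by
    simp [lorentz_apply, coneDeriv]
  rw [form_ambientForm (H.lift_normal hx hξ t), hc, secondFund, inner_normalProj_of_mem _ hξ]
  simp only [map_add, map_smul, add_apply, smul_apply, lorentz_coneDeriv,
    lorentz_coneDeriv_cone, lorentz_cone_cone, h1, h2, h3, h4, smul_eq_mul]
  ring

/-- The normal vectors of the immersion into the light cone which are orthogonal to the position
vector are the vectors `coneDeriv ξ + t cone` with `ξ` normal to `F`. -/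
theorem eq_lift (hx : x ∈ U) {v : Lor m} (hv : ∀ Z, lorentz m (fderiv ℝ (coneMap F) x Z) v = 0)
    (hv' : lorentz m v (cone (F x)) = 0) :
    v.2.2 - v.1 • F x ∈ normalSpace F x ∧
      v = coneDeriv (F x) (v.2.2 - v.1 • F x) + v.1 • cone (F x) := by
  obtain ⟨a, c, z⟩ := v
  have h1 : c = 2 * inner ℝ z (F x) - a * ‖F x‖ ^ 2 := by
    simp only [lorentz_apply, cone] at hv'
    linarith
  have h2 : ((a, c, z) : Lor m) = coneDeriv (F x) (z - a • F x) + a • cone (F x) := by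
    refine Prod.ext ?_ (Prod.ext ?_ ?_)
    · simp [coneDeriv, cone]
    · simp only [coneDeriv, cone, Prod.snd_add, Prod.fst_add, Prod.smul_snd, Prod.smul_fst,
        inner_sub_right, inner_smul_right, real_inner_self_eq_norm_sq, smul_eq_mul, h1,
        real_inner_comm]
      ring
    · simp [coneDeriv, cone]
  refine ⟨mem_normalSpace.mpr fun X => ?_, h2⟩
  have h3 := hv X
  rw [H.fderiv_coneMap hx, lorentz_symm] at h3
  simp only [map_add, map_smul] at h3
  rw [hv'] at h3
  rw [h2] at h3
  have h4 : ∀ w, lorentz m (cone (F x)) (coneDeriv (F x) w) = 0 := fun w => by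
    rw [lorentz_symm, lorentz_coneDeriv_cone]
  simp only [map_add, map_smul, add_apply, smul_apply, lorentz_coneDeriv, h4, smul_eq_mul,
    mul_zero, zero_add, add_zero] at h3
  exact (mul_eq_zero.mp h3).resolve_left (H.moebiusFactor_pos hx).ne'

end IsProperOn

end LightCone

/-! ### Semi-parallel Moebius second fundamental form -/

section SemiParallel

variable {n m k : ℕ}

/-- The second fundamental form of the immersion `coneMap F` into the Lorentz space. -/
noncomputable abbrev coneForm (F : Euc n → Euc m) (x X Y : Euc n) : Lor m :=
  ambientForm (coneMap F) (moebiusMetric F) x X Y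

/-- The principal normal vector of the immersion `coneMap F` on the eigenspace `E_η` of `F`, that
is, the vector `B` such that the second fundamental form is `⟨ , ⟩* B` on `E_η`. -/
noncomputable def coneNormal (F : Euc n → Euc m) (ν : Euc n → Euc m) (x : Euc n) : Lor m :=
  Classical.epsilon fun B => ∀ W ∈ eigenspace F x (ν x), ∀ X,
    coneForm F x W X = moebiusMetric F x W X • B

/-- A proper immersion with flat normal bundle, semi-parallel Moebius second fundamental form and
at least three principal normals. -/
structure IsSemiParallelOn (U : Set (Euc n)) (F : Euc n → Euc m) (η : Fin k → Euc n → Euc m) : Prop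
    extends IsProperOn U F η where
  semi : ∀ y ∈ U, ∀ X Y Z W : Euc n, curvatureOnMoebiusForm F y X Y Z W = 0
  three_le : 3 ≤ k

theorem exists_ne_ne {k : ℕ} (hk : 3 ≤ k) (i j : Fin k) : ∃ l, l ≠ i ∧ l ≠ j := by
  have h1 : ({i, j} : Finset (Fin k)).card < (Finset.univ : Finset (Fin k)).card := by
    rw [Finset.card_univ, Fintype.card_fin]
    exact lt_of_le_of_lt Finset.card_le_two (by omega)
  obtain ⟨l, -, hl⟩ := Finset.exists_mem_notMem_of_card_lt_card h1
  simp only [Finset.mem_insert, Finset.mem_singleton, not_or] at hl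
  exact ⟨l, hl⟩

namespace IsProperOn

variable {U : Set (Euc n)} {F : Euc n → Euc m} {η : Fin k → Euc n → Euc m}
  (H : IsProperOn U F η) {x : Euc n}
include H

theorem lorentz_coneForm_lift (hx : x ∈ U) {i : Fin k} {X : Euc n}
    (hX : X ∈ eigenspace F x (η i x)) (Y : Euc n) {ξ : Euc m} (hξ : ξ ∈ normalSpace F x) (t : ℝ) :
    lorentz m (coneForm F x X Y) (coneDeriv (F x) ξ + t • cone (F x))
      = moebiusMetric F x X Y * ((moebiusFactor F x)⁻¹ * (inner ℝ (η i x) ξ - t)) := by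
  have hρ := (H.moebiusFactor_pos hx).ne'
  rw [H.lorentz_ambientForm_lift hx hξ, hX Y, inner_smul_left, moebiusMetric, conj_trivial]
  field_simp

theorem lorentz_coneForm_cone (hx : x ∈ U) (X Y : Euc n) :
    lorentz m (coneForm F x X Y) (cone (F x))
      = - ((moebiusFactor F x)⁻¹ * moebiusMetric F x X Y) := by
  have hρ := (H.moebiusFactor_pos hx).ne'
  have h1 := H.lorentz_ambientForm_lift hx (zero_mem _) 1 X Y
  rw [coneDeriv_zero, zero_add, one_smul, inner_zero_right] at h1
  rw [h1, moebiusMetric]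
  field_simp
  ring

theorem coneForm_normal (hx : x ∈ U) (X Y Z : Euc n) :
    lorentz m (fderiv ℝ (coneMap F) x Z) (coneForm F x X Y) = 0 := by
  rw [lorentz_symm, H.isMetricOf_coneMap.ambientForm_normal hx]

theorem coneForm_symm (hx : x ∈ U) (X Y : Euc n) : coneForm F x X Y = coneForm F x Y X :=
  H.isMetricOf_coneMap.ambientForm_symm hx X Y

/-- A normal vector of `coneMap F` orthogonal to all lifts of normal vectors of `F` is a multiple
of the position vector. -/
theorem eq_smul_cone (hx : x ∈ U) {v : Lor m}
    (hv : ∀ Z, lorentz m (fderiv ℝ (coneMap F) x Z) v = 0)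
    (hv' : lorentz m v (cone (F x)) = 0)
    (hv'' : ∀ ξ ∈ normalSpace F x, lorentz m v (coneDeriv (F x) ξ) = 0) :
    v = v.1 • cone (F x) := by
  obtain ⟨h1, h2⟩ := H.eq_lift hx hv hv'
  have h3 := hv'' _ h1
  rw [h2] at h3
  simp only [map_add, map_smul, add_apply, smul_apply, lorentz_coneDeriv] at h3
  rw [← h2, lorentz_symm (cone (F x)), lorentz_coneDeriv_cone, smul_zero, add_zero,
    inner_self_eq_zero] at h3
  rw [h3, coneDeriv_zero, zero_add] at h2
  exact h2

theorem coneForm_eq_smul_cone (hx : x ∈ U) {i : Fin k} {X Y : Euc n}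
    (hX : X ∈ eigenspace F x (η i x)) (hXY : moebiusMetric F x X Y = 0) :
    ∃ t : ℝ, coneForm F x X Y = t • cone (F x) := by
  refine ⟨_, H.eq_smul_cone hx (H.coneForm_normal hx X Y) ?_ fun ξ hξ => ?_⟩
  · rw [H.lorentz_coneForm_cone hx, hXY]
    simp
  · have h1 := H.lorentz_coneForm_lift hx hX Y hξ 0
    rwa [zero_smul, add_zero, hXY, zero_mul] at h1

end IsProperOn

namespace IsSemiParallelOn

variable {U : Set (Euc n)} {F : Euc n → Euc m} {η : Fin k → Euc n → Euc m}
  (H : IsSemiParallelOn U F η) {x : Euc n}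
include H

/-- The curvature operators of the Moebius metric preserve the eigenspaces. -/
theorem metric_curvature_eq_zero (hx : x ∈ U) {i j : Fin k} (hij : i ≠ j) {Z W : Euc n}
    (hZ : Z ∈ eigenspace F x (η i x)) (hW : W ∈ eigenspace F x (η j x)) (X Y : Euc n) :
    moebiusMetric F x (curvature (moebiusMetric F) x X Y Z) W = 0 := by
  have hP := H.toIsProperOn
  have hM := hP.isMetricOf_coneMap
  have hh := hP.isInner_moebiusMetric hx
  have h1 := H.semi x hx X Y Z W
  rw [curvatureOnMoebiusForm, H.flat x hx X Y _ (moebiusForm_mem F x Z W), zero_sub,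
    hP.moebiusForm_symm hx _ W, hP.moebiusForm_of_mem hx hW, hP.moebiusForm_of_mem hx hZ] at h1
  have h2 : moebiusMetric F x Z (curvature (moebiusMetric F) x X Y W)
      = - moebiusMetric F x W (curvature (moebiusMetric F) x X Y Z) := by
    rw [hh.symm Z, hh.symm W, hM.gauss hx, hM.gauss hx, lorentz_symm (coneForm F x Y W),
      lorentz_symm (coneForm F x X W)]
    ring
  rw [h2, neg_smul, sub_neg_eq_add, neg_add_eq_sub, ← smul_sub] at h1
  rw [hh.symm]
  refine (smul_eq_zero.mp h1).resolve_right (sub_ne_zero.mpr ?_)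
  exact hP.moebiusPrincipalNormal_ne hx hij

/-- Semi-parallelism expressed by `coneForm`, through the Gauss equation. -/
theorem lorentz_coneForm_comm (hx : x ∈ U) {i j : Fin k} (hij : i ≠ j) {Z W : Euc n}
    (hZ : Z ∈ eigenspace F x (η i x)) (hW : W ∈ eigenspace F x (η j x)) (X Y : Euc n) :
    lorentz m (coneForm F x Y Z) (coneForm F x X W)
      = lorentz m (coneForm F x X Z) (coneForm F x Y W) := by
  have h1 := H.metric_curvature_eq_zero hx hij hZ hW X Y
  rw [H.toIsProperOn.isMetricOf_coneMap.gauss hx] at h1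
  exact sub_eq_zero.mp h1

theorem eq_zero_of_lorentz (hx : x ∈ U) {t : ℝ} {Z : Euc n} (hZ : Z ≠ 0)
    (h0 : lorentz m (coneForm F x Z Z) (t • cone (F x)) = 0) : t = 0 := by
  have hP := H.toIsProperOn
  rw [map_smul, hP.lorentz_coneForm_cone hx, smul_eq_mul, mul_neg, neg_eq_zero] at h0
  have h1 := (hP.isInner_moebiusMetric hx).pos Z hZ
  have h2 := inv_pos.mpr (hP.moebiusFactor_pos hx)
  exact (mul_eq_zero.mp h0).resolve_right (mul_pos h2 h1).ne'

/-- Orthogonal eigenvectors are conjugate directions of the immersion into the light cone. A third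
eigenspace, orthogonal to both vectors, is used to see that the component of `coneForm` along the
position vector vanishes. -/
theorem coneForm_eq_zero (hx : x ∈ U) {j l : Fin k} {X W : Euc n}
    (hX : X ∈ eigenspace F x (η l x)) (hW : W ∈ eigenspace F x (η j x))
    (hXW : moebiusMetric F x X W = 0) : coneForm F x X W = 0 := by
  have hP := H.toIsProperOn
  obtain ⟨i, hil, hij⟩ := exists_ne_ne H.three_le l j
  obtain ⟨Z, hZ, hZ0⟩ := hP.exists_ne_zero hx i
  obtain ⟨t, ht⟩ := hP.coneForm_eq_smul_cone hx hX hXW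
  obtain ⟨s, hs⟩ := hP.coneForm_eq_smul_cone hx hX (hP.moebiusMetric_eq_zero hx hil.symm hX hZ)
  obtain ⟨s', hs'⟩ := hP.coneForm_eq_smul_cone hx hZ (hP.moebiusMetric_eq_zero hx hij hZ hW)
  have h1 := H.lorentz_coneForm_comm hx hij hZ hW X Z
  rw [hs, hs', ht, map_smul, map_smul (lorentz m) s, smul_apply,
    map_smul (lorentz m (cone (F x))), lorentz_cone_cone, smul_zero, smul_zero, ← map_smul] at h1
  rw [ht, H.eq_zero_of_lorentz hx hZ0 h1, zero_smul]

theorem lorentz_coneForm_eq_zero (hx : x ∈ U) {i j : Fin k} (hij : i ≠ j) {Z W : Euc n}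
    (hZ : Z ∈ eigenspace F x (η i x)) (hW : W ∈ eigenspace F x (η j x)) :
    lorentz m (coneForm F x Z Z) (coneForm F x W W) = 0 := by
  have hP := H.toIsProperOn
  rw [H.lorentz_coneForm_comm hx hij hZ hW W Z,
    H.coneForm_eq_zero hx hZ hW (hP.moebiusMetric_eq_zero hx hij hZ hW), map_zero]

/-- The value of `coneForm` on unit vectors of an eigenspace does not depend on the vector. -/
theorem metric_smul_coneForm (hx : x ∈ U) {j : Fin k} {W W' : Euc n}
    (hW : W ∈ eigenspace F x (η j x)) (hW' : W' ∈ eigenspace F x (η j x)) :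
    moebiusMetric F x W' W' • coneForm F x W W
      = moebiusMetric F x W W • coneForm F x W' W' := by
  have hP := H.toIsProperOn
  obtain ⟨i, hij, -⟩ := exists_ne_ne H.three_le j j
  obtain ⟨Z, hZ, hZ0⟩ := hP.exists_ne_zero hx i
  rw [← sub_eq_zero]
  set v := moebiusMetric F x W' W' • coneForm F x W W
      - moebiusMetric F x W W • coneForm F x W' W' with hv
  have h1 : v = v.1 • cone (F x) := by
    refine hP.eq_smul_cone hx (fun Y => ?_) ?_ fun ξ hξ => ?_
    · rw [hv, map_sub, map_smul, map_smul, hP.coneForm_normal hx, hP.coneForm_normal hx]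
      simp
    · rw [hv, map_sub, map_smul, map_smul, sub_apply, smul_apply, smul_apply,
        hP.lorentz_coneForm_cone hx, hP.lorentz_coneForm_cone hx, smul_eq_mul, smul_eq_mul]
      ring
    · have h2 := hP.lorentz_coneForm_lift hx hW W hξ 0
      have h3 := hP.lorentz_coneForm_lift hx hW' W' hξ 0
      rw [zero_smul, add_zero] at h2 h3
      rw [hv, map_sub, map_smul, map_smul, sub_apply, smul_apply, smul_apply, h2, h3,
        smul_eq_mul, smul_eq_mul]
      ring
  have h2 : lorentz m (coneForm F x Z Z) v = 0 := by
    rw [hv, map_sub, map_smul, map_smul, H.lorentz_coneForm_eq_zero hx hij hZ hW,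
      H.lorentz_coneForm_eq_zero hx hij hZ hW']
    simp
  rw [h1] at h2
  rw [h1, H.eq_zero_of_lorentz hx hZ0 h2, zero_smul]

theorem exists_coneNormal (hx : x ∈ U) (j : Fin k) : ∃ B : Lor m,
    ∀ W ∈ eigenspace F x (η j x), ∀ X, coneForm F x W X = moebiusMetric F x W X • B := by
  have hP := H.toIsProperOn
  have hM := hP.isMetricOf_coneMap
  have hN : IsBilinearMap ℝ (coneForm F x) := hM.isBilinearMap_ambientForm hx
  have hh := hP.isInner_moebiusMetric hx
  obtain ⟨W₀, hW₀, hne⟩ := hP.exists_ne_zero hx j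
  have hpos := (hh.pos W₀ hne).ne'
  set B := (moebiusMetric F x W₀ W₀)⁻¹ • coneForm F x W₀ W₀ with hB
  have hdiag : ∀ W ∈ eigenspace F x (η j x), coneForm F x W W = moebiusMetric F x W W • B := by
    intro W hW
    rw [hB, smul_comm, ← H.metric_smul_coneForm hx hW hW₀, inv_smul_smul₀ hpos]
  refine ⟨B, fun W hW X => hP.induction_on hx
    (p := fun X => coneForm F x W X = moebiusMetric F x W X • B) ?_ ?_ X⟩
  · intro l Y hY
    by_cases hl : j = l
    · subst hl
      have h1 := hdiag _ (add_mem hW hY)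
      rw [hN.add_left, hN.add_right, hN.add_right, hdiag W hW, hdiag Y hY, hh.bilin.add_left,
        hh.bilin.add_right, hh.bilin.add_right, hP.coneForm_symm hx Y W, hh.symm Y W] at h1
      have h2 : (2 : ℝ) • (coneForm F x W Y - moebiusMetric F x W Y • B) = 0 := by
        rw [← sub_eq_zero] at h1
        rw [← h1]
        module
      exact sub_eq_zero.mp ((smul_eq_zero.mp h2).resolve_left two_ne_zero)
    · have h0 := hP.moebiusMetric_eq_zero hx hl hW hY
      rw [H.coneForm_eq_zero hx hW hY h0, h0, zero_smul]
  · intro Y Z hY hZ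
    rw [hN.add_right, hh.bilin.add_right, hY, hZ, add_smul]

theorem coneForm_of_mem (hx : x ∈ U) {j : Fin k} {W : Euc n} (hW : W ∈ eigenspace F x (η j x))
    (X : Euc n) : coneForm F x W X = moebiusMetric F x W X • coneNormal F (η j) x :=
  Classical.epsilon_spec (H.exists_coneNormal hx j) W hW X

theorem coneNormal_eq (hx : x ∈ U) {j : Fin k} {W : Euc n} (hW : W ∈ eigenspace F x (η j x))
    (hW0 : W ≠ 0) :
    coneNormal F (η j) x = (moebiusMetric F x W W)⁻¹ • coneForm F x W W := by
  rw [H.coneForm_of_mem hx hW,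
    inv_smul_smul₀ ((H.toIsProperOn.isInner_moebiusMetric hx).pos W hW0).ne']

/-- The principal normals of the immersion into the light cone are pairwise orthogonal. -/
theorem lorentz_coneNormal (hx : x ∈ U) {i j : Fin k} (hij : i ≠ j) :
    lorentz m (coneNormal F (η i) x) (coneNormal F (η j) x) = 0 := by
  obtain ⟨Z, hZ, hZ0⟩ := H.toIsProperOn.exists_ne_zero hx i
  obtain ⟨W, hW, hW0⟩ := H.toIsProperOn.exists_ne_zero hx j
  rw [H.coneNormal_eq hx hZ hZ0, H.coneNormal_eq hx hW hW0, map_smul, map_smul, smul_apply,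
    H.lorentz_coneForm_eq_zero hx hij hZ hW, smul_zero, smul_zero]

theorem coneNormal_normal (hx : x ∈ U) (j : Fin k) (Z : Euc n) :
    lorentz m (fderiv ℝ (coneMap F) x Z) (coneNormal F (η j) x) = 0 := by
  obtain ⟨W, hW, hW0⟩ := H.toIsProperOn.exists_ne_zero hx j
  rw [H.coneNormal_eq hx hW hW0, map_smul, H.toIsProperOn.coneForm_normal hx, smul_zero]

theorem lorentz_coneNormal_lift (hx : x ∈ U) (j : Fin k) {ξ : Euc m} (hξ : ξ ∈ normalSpace F x)
    (t : ℝ) : lorentz m (coneNormal F (η j) x) (coneDeriv (F x) ξ + t • cone (F x))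
      = (moebiusFactor F x)⁻¹ * (inner ℝ (η j x) ξ - t) := by
  obtain ⟨W, hW, hW0⟩ := H.toIsProperOn.exists_ne_zero hx j
  have h1 := ((H.toIsProperOn.isInner_moebiusMetric hx).pos W hW0).ne'
  rw [H.coneNormal_eq hx hW hW0, map_smul (lorentz m), smul_apply,
    H.toIsProperOn.lorentz_coneForm_lift hx hW W hξ, smul_eq_mul, inv_mul_cancel_left₀ h1]

/-- The differences of the principal normals in the Lorentz space are lifts of the differences of
the Moebius principal normals. -/
theorem coneNormal_sub (hx : x ∈ U) (i j : Fin k) :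
    coneNormal F (η i) x - coneNormal F (η j) x
      = coneDeriv (F x) (moebiusPrincipalNormal F (η i) x - moebiusPrincipalNormal F (η j) x)
        + (coneNormal F (η i) x - coneNormal F (η j) x).1 • cone (F x) := by
  have hP := H.toIsProperOn
  set v := coneNormal F (η i) x - coneNormal F (η j) x with hv
  have hlift : ∀ ξ ∈ normalSpace F x, ∀ t : ℝ,
      lorentz m v (coneDeriv (F x) ξ + t • cone (F x))
        = inner ℝ (moebiusPrincipalNormal F (η i) x - moebiusPrincipalNormal F (η j) x) ξ := by
    intro ξ hξ t
    rw [hv, map_sub, sub_apply, H.lorentz_coneNormal_lift hx i hξ,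
      H.lorentz_coneNormal_lift hx j hξ, moebiusPrincipalNormal, moebiusPrincipalNormal, ← smul_sub,
      sub_sub_sub_cancel_right, inner_smul_left, conj_trivial, inner_sub_left]
    ring
  have h0 := hlift 0 (zero_mem _) 1
  rw [coneDeriv_zero, zero_add, one_smul, inner_zero_right] at h0
  obtain ⟨h1, h2⟩ := hP.eq_lift hx (v := v) (fun Z => by
    rw [hv, map_sub, H.coneNormal_normal hx, H.coneNormal_normal hx, sub_zero]) h0
  set ξ₀ := v.2.2 - v.1 • F x
  set w := moebiusPrincipalNormal F (η i) x - moebiusPrincipalNormal F (η j) x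
  have hw : w ∈ normalSpace F x :=
    Submodule.sub_mem _ (hP.moebiusPrincipalNormal_mem hx i) (hP.moebiusPrincipalNormal_mem hx j)
  have h3 : ξ₀ = w := by
    rw [← sub_eq_zero, ← inner_self_eq_zero (𝕜 := ℝ)]
    have h4 := hlift (ξ₀ - w) (Submodule.sub_mem _ h1 hw) 0
    rw [h2, zero_smul, add_zero, map_add, map_smul, add_apply, smul_apply, lorentz_coneDeriv,
      lorentz_symm (cone (F x)), lorentz_coneDeriv_cone, smul_zero, add_zero] at h4
    rw [inner_sub_left, h4, sub_self]
  rw [h3] at h2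
  exact h2

theorem lorentz_coneNormal_sub_self (hx : x ∈ U) (i j : Fin k) :
    lorentz m (coneNormal F (η i) x - coneNormal F (η j) x)
        (coneNormal F (η i) x - coneNormal F (η j) x)
      = ‖moebiusPrincipalNormal F (η i) x - moebiusPrincipalNormal F (η j) x‖ ^ 2 := by
  rw [H.coneNormal_sub hx i j]
  simp only [map_add, map_smul, add_apply, smul_apply, lorentz_coneDeriv, lorentz_coneDeriv_cone,
    lorentz_cone_cone]
  rw [lorentz_symm (cone (F x)), lorentz_coneDeriv_cone, real_inner_self_eq_norm_sq]
  simp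

/-- `|B_i|² + |B_j|² = |β_i - β_j|²`, where `B_i` and `β_i` are the principal normals in the
Lorentz space and the Moebius principal normals. -/
theorem lorentz_self_add (hx : x ∈ U) {i j : Fin k} (hij : i ≠ j) :
    lorentz m (coneNormal F (η i) x) (coneNormal F (η i) x)
        + lorentz m (coneNormal F (η j) x) (coneNormal F (η j) x)
      = ‖moebiusPrincipalNormal F (η i) x - moebiusPrincipalNormal F (η j) x‖ ^ 2 := by
  rw [← H.lorentz_coneNormal_sub_self hx i j, map_sub, map_sub, sub_apply,
    sub_apply, H.lorentz_coneNormal hx hij, H.lorentz_coneNormal hx hij.symm]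
  ring

theorem lorentz_self_add_pos (hx : x ∈ U) {i j : Fin k} (hij : i ≠ j) :
    0 < lorentz m (coneNormal F (η i) x) (coneNormal F (η i) x)
        + lorentz m (coneNormal F (η j) x) (coneNormal F (η j) x) := by
  rw [H.lorentz_self_add hx hij]
  have h1 := H.toIsProperOn.moebiusPrincipalNormal_ne hx hij
  exact pow_pos (norm_pos_iff.mpr (sub_ne_zero.mpr h1)) 2

theorem differentiableAt_coneNormal (hx : x ∈ U) (j : Fin k) :
    DifferentiableAt ℝ (coneNormal F (η j)) x := by
  have hP := H.toIsProperOn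
  have hM := hP.isMetricOf_coneMap
  obtain ⟨W₀, hW₀, hne⟩ := hP.exists_ne_zero hx j
  obtain ⟨Y, hYd, hYx, hY⟩ := hP.exists_section hx j hW₀
  have hU := H.isOpen.mem_nhds hx
  have h1 : DifferentiableAt ℝ (fun y => moebiusMetric F y (Y y) (Y y)) x :=
    differentiableAt_bilin (hM.eventually_isBilinearMap hx)
      (fun X Y => differentiableAt_of_contDiffOn H.isOpen (hM.smooth_metric X Y) hx) hYd hYd
  have h2 : DifferentiableAt ℝ (fun y => coneForm F y (Y y) (Y y)) x :=
    differentiableAt_bilin (t := coneForm F)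
      (by filter_upwards [hU] with y hy using hM.isBilinearMap_ambientForm hy)
      (fun X Y => differentiableAt_of_contDiffOn H.isOpen (hM.smooth_ambientForm X Y) hx) hYd hYd
  have h3 : moebiusMetric F x (Y x) (Y x) ≠ 0 := by
    rw [hYx]
    exact ((hP.isInner_moebiusMetric hx).pos W₀ hne).ne'
  refine ((h1.fun_inv h3).fun_smul h2).congr_of_eventuallyEq ?_
  filter_upwards [hU, hYd.continuousAt.eventually_ne (hYx ▸ hne)] with y hy hy0
  exact H.coneNormal_eq hy (hY y hy) hy0

end IsSemiParallelOn

end SemiParallel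

/-! ### Covariant derivatives along the eigenbundles -/

section Parallel

variable {n m k : ℕ}

/-- The algebraic core of the argument: `lam j` is the coefficient of the derivative of the principal
normal with index `j` along the eigenspace with index `i`, `q j` is its squared norm in the Lorentz
space, and `μ j` its multiplicity. -/
theorem lam_eq_zero (i l₀ : Fin k) (q lam : Fin k → ℝ) (μ : Fin k → ℕ)
    (h₀ : lam l₀ = 0) (hq : ∀ a c, a ≠ c → 0 < q a + q c) (hμ : ∀ j, 0 < μ j)
    (h1 : ∀ j, j ≠ i → j ≠ l₀ → lam j * (μ i * q i + μ j * q j) = 0)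
    (h2 : ∑ j ∈ Finset.univ.erase i, μ j * (lam j * (q i + q j)) = 0)
    (h3 : μ i = 1 ∨ ∀ j, j ≠ i → lam j * q i = 0) (j : Fin k) (hj : j ≠ i) : lam j = 0 := by
  by_cases hjl : j = l₀
  · rw [hjl, h₀]
  have hμ' : ∀ j, (0 : ℝ) < μ j := fun j => by exact_mod_cast hμ j
  have h4 := hq i j hj.symm
  rcases h3 with h3 | h3
  · by_contra hne
    have hneg : ∀ c, c ≠ i → c ≠ l₀ → lam c ≠ 0 → q c < 0 := by
      intro c hci hcl hc
      have h5 := (mul_eq_zero.mp (h1 c hci hcl)).resolve_left hc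
      have h6 := hq i c hci.symm
      rw [h3, Nat.cast_one, one_mul] at h5
      -- here `q i = - μ c * q c`, so that `q i + q c = (1 - μ c) q c` is positive
      have h7 : (1 : ℝ) ≤ μ c := by exact_mod_cast hμ c
      by_contra hge
      nlinarith [not_lt.mp hge]
    have hother : ∀ c ∈ Finset.univ.erase i, c ≠ j → μ c * (lam c * (q i + q c)) = 0 := by
      intro c hc hcj
      have h6 : lam c = 0 := by
        by_contra hc0
        have hcl : c ≠ l₀ := fun h => hc0 (h ▸ h₀)
        have h7 := hneg c (Finset.ne_of_mem_erase hc) hcl hc0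
        have h8 := hneg j hj hjl hne
        have h9 := hq c j hcj
        linarith
      rw [h6]
      ring
    rw [Finset.sum_eq_single j hother (fun h => absurd (by simp [hj]) h)] at h2
    have h6 := (mul_eq_zero.mp ((mul_eq_zero.mp h2).resolve_left (hμ' j).ne')).resolve_left hne
    exact h4.ne' h6
  · have h5 := h1 j hj hjl
    have h6 := h3 j hj
    have h7 : lam j * q j = 0 := by
      have h8 : μ j * (lam j * q j) = 0 := by linear_combination h5 - μ i * h6
      exact (mul_eq_zero.mp h8).resolve_left (hμ' j).ne'
    have h8 : lam j * (q i + q j) = 0 := by linear_combination h6 + h7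
    exact (mul_eq_zero.mp h8).resolve_right h4.ne'

namespace IsProperOn

variable {U : Set (Euc n)} {F : Euc n → Euc m} {η : Fin k → Euc n → Euc m}
  (H : IsProperOn U F η) {x : Euc n}
include H

section CovDeriv

variable {W : Type*} [NormedAddCommGroup W] [NormedSpace ℝ W] {t : Euc n → Euc n → Euc n → W}
  {c : Fin k → Euc n → W}

/-- The vanishing of `∇ h` for the Moebius metric `h`, evaluated on vector fields. -/
theorem fderiv_metric_sections (hx : x ∈ U) {Y Z : Euc n → Euc n}
    (hY : DifferentiableAt ℝ Y x) (hZ : DifferentiableAt ℝ Z x) (X : Euc n) :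
    fderiv ℝ (fun y => moebiusMetric F y (Y y) (Z y)) x X
      = moebiusMetric F x (fderiv ℝ Y x X + leviCivita (moebiusMetric F) x X (Y x)) (Z x)
        + moebiusMetric F x (Y x) (fderiv ℝ Z x X + leviCivita (moebiusMetric F) x X (Z x)) := by
  have hM := H.isMetricOf_coneMap
  have h1 := hM.covDeriv_eq (t := moebiusMetric F) (fun y hy => (hM.isInner hy).bilin) hx
    (fun X Y => differentiableAt_of_contDiffOn H.isOpen (hM.smooth_metric X Y) hx) hY hZ X
  rw [hM.covDeriv_metric hx] at h1
  linarith

theorem covDeriv_of_ne (ht : ∀ y ∈ U, IsBilinearMap ℝ (t y))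
    (hs : ∀ y ∈ U, ∀ X Y, t y X Y = t y Y X)
    (hc : ∀ y ∈ U, ∀ i, ∀ X ∈ eigenspace F y (η i y), ∀ Y,
      t y X Y = moebiusMetric F y X Y • c i y)
    (hx : x ∈ U) (hd : ∀ X Y, DifferentiableAt ℝ (fun y => t y X Y) x)
    {i j : Fin k} (hij : i ≠ j) {Y Z : Euc n → Euc n}
    (hY : DifferentiableAt ℝ Y x) (hZ : DifferentiableAt ℝ Z x)
    (hYm : ∀ y ∈ U, Y y ∈ eigenspace F y (η i y)) (hZm : ∀ y ∈ U, Z y ∈ eigenspace F y (η j y))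
    (X : Euc n) :
    covDeriv (moebiusMetric F) t x X (Y x) (Z x)
      = moebiusMetric F x (fderiv ℝ Y x X + leviCivita (moebiusMetric F) x X (Y x)) (Z x)
        • (c i x - c j x) := by
  have hM := H.isMetricOf_coneMap
  have hU := H.isOpen.mem_nhds hx
  have h1 : (fun y => t y (Y y) (Z y)) =ᶠ[𝓝 x] fun _ => 0 := by
    filter_upwards [hU] with y hy
    rw [hc y hy i _ (hYm y hy), H.moebiusMetric_eq_zero hy hij (hYm y hy) (hZm y hy), zero_smul]
  have h2 : (fun y => moebiusMetric F y (Y y) (Z y)) =ᶠ[𝓝 x] fun _ => 0 := by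
    filter_upwards [hU] with y hy using H.moebiusMetric_eq_zero hy hij (hYm y hy) (hZm y hy)
  have h3 := H.fderiv_metric_sections hx hY hZ X
  rw [h2.fderiv_eq, fderiv_fun_const, Pi.zero_apply, zero_apply] at h3
  rw [hM.covDeriv_eq ht hx hd hY hZ, h1.fderiv_eq, hs x hx _ (Z x), hc x hx j _ (hZm x hx),
    hc x hx i _ (hYm x hx), (H.isInner_moebiusMetric hx).symm (Z x),
    eq_neg_of_add_eq_zero_right h3.symm]
  simp only [fderiv_fun_const, Pi.zero_apply, zero_apply]
  module

theorem covDeriv_of_eq (ht : ∀ y ∈ U, IsBilinearMap ℝ (t y))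
    (hs : ∀ y ∈ U, ∀ X Y, t y X Y = t y Y X)
    (hc : ∀ y ∈ U, ∀ i, ∀ X ∈ eigenspace F y (η i y), ∀ Y,
      t y X Y = moebiusMetric F y X Y • c i y)
    (hx : x ∈ U) (hd : ∀ X Y, DifferentiableAt ℝ (fun y => t y X Y) x)
    {i : Fin k} (hci : DifferentiableAt ℝ (c i) x) {Y Z : Euc n → Euc n}
    (hY : DifferentiableAt ℝ Y x) (hZ : DifferentiableAt ℝ Z x)
    (hYm : ∀ y ∈ U, Y y ∈ eigenspace F y (η i y)) (hZm : ∀ y ∈ U, Z y ∈ eigenspace F y (η i y))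
    (X : Euc n) :
    covDeriv (moebiusMetric F) t x X (Y x) (Z x)
      = moebiusMetric F x (Y x) (Z x) • fderiv ℝ (c i) x X := by
  have hM := H.isMetricOf_coneMap
  have hU := H.isOpen.mem_nhds hx
  have h1 : (fun y => t y (Y y) (Z y))
      =ᶠ[𝓝 x] fun y => moebiusMetric F y (Y y) (Z y) • c i y := by
    filter_upwards [hU] with y hy using hc y hy i _ (hYm y hy) _
  have h3 := H.fderiv_metric_sections hx hY hZ X
  have h4 := differentiableAt_bilin (hM.eventually_isBilinearMap hx)
      (fun X Y => differentiableAt_of_contDiffOn H.isOpen (hM.smooth_metric X Y) hx) hY hZ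
  rw [hM.covDeriv_eq ht hx hd hY hZ, h1.fderiv_eq, fderiv_fun_smul h4 hci, hs x hx _ (Z x),
    hc x hx i _ (hZm x hx), hc x hx i _ (hYm x hx), (H.isInner_moebiusMetric hx).symm (Z x)]
  simp only [add_apply, smul_apply, ContinuousLinearMap.smulRight_apply, h3]
  module

end CovDeriv

theorem differentiableAt_moebiusPrincipalNormal (hx : x ∈ U) (i : Fin k) :
    DifferentiableAt ℝ (moebiusPrincipalNormal F (η i)) x :=
  differentiableAt_of_contDiffOn H.isOpen (H.smooth_moebiusPrincipalNormal i) hx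

theorem sum_smul_fderiv_moebiusPrincipalNormal (hx : x ∈ U) (X : Euc n) :
    ∑ i, (multiplicity F η x i : ℝ) • fderiv ℝ (moebiusPrincipalNormal F (η i)) x X = 0 := by
  have h1 : (fun y => ∑ i, (multiplicity F η x i : ℝ) • moebiusPrincipalNormal F (η i) y)
      =ᶠ[𝓝 x] fun _ => 0 := by
    filter_upwards [H.eventually_multiplicity_eq hx, H.isOpen.mem_nhds hx] with y hy hyU
    simp only [← hy]
    exact H.sum_smul_moebiusPrincipalNormal hyU
  have h2 := DFunLike.congr_fun (h1.fderiv_eq (𝕜 := ℝ)) X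
  rw [fderiv_fun_sum fun i _ =>
    (H.differentiableAt_moebiusPrincipalNormal hx i).fun_const_smul _] at h2
  simp only [sum_apply, fderiv_fun_const, Pi.zero_apply, zero_apply] at h2
  rw [← h2]
  refine Finset.sum_congr rfl fun i _ => ?_
  rw [fderiv_fun_const_smul (H.differentiableAt_moebiusPrincipalNormal hx i), smul_apply]

theorem sum_mul_inner_fderiv_moebiusPrincipalNormal (hx : x ∈ U) (X : Euc n) :
    ∑ i, (multiplicity F η x i : ℝ) * inner ℝ (fderiv ℝ (moebiusPrincipalNormal F (η i)) x X)
      (moebiusPrincipalNormal F (η i) x) = 0 := by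
  have h1 : (fun y => ∑ i, (multiplicity F η x i : ℝ) * innerForm m
      (moebiusPrincipalNormal F (η i) y) (moebiusPrincipalNormal F (η i) y))
      =ᶠ[𝓝 x] fun _ => ((n : ℝ) - 1) / n := by
    filter_upwards [H.eventually_multiplicity_eq hx, H.isOpen.mem_nhds hx] with y hy hyU
    simp only [← hy, innerForm_apply, real_inner_self_eq_norm_sq]
    exact H.sum_mul_norm_moebiusPrincipalNormal hyU
  have hd := fun i => H.differentiableAt_moebiusPrincipalNormal hx i
  have h2 := DFunLike.congr_fun (h1.fderiv_eq (𝕜 := ℝ)) X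
  rw [fderiv_fun_sum fun i _ => (differentiableAt_form (innerForm m) (hd i) (hd i)).const_mul _]
    at h2
  simp only [sum_apply, fderiv_fun_const, Pi.zero_apply, zero_apply] at h2
  have h3 : ∀ i, fderiv ℝ (fun y => (multiplicity F η x i : ℝ) * innerForm m
      (moebiusPrincipalNormal F (η i) y) (moebiusPrincipalNormal F (η i) y)) x X
      = 2 * ((multiplicity F η x i : ℝ) * inner ℝ (fderiv ℝ (moebiusPrincipalNormal F (η i)) x X)
        (moebiusPrincipalNormal F (η i) x)) := by
    intro i
    rw [fderiv_const_mul (differentiableAt_form (innerForm m) (hd i) (hd i)), smul_apply,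
      fderiv_form (innerForm m) (hd i) (hd i), innerForm_apply, innerForm_apply,
      real_inner_comm (fderiv ℝ (moebiusPrincipalNormal F (η i)) x X), smul_eq_mul]
    ring
  simp only [h3, ← Finset.mul_sum] at h2
  linarith

end IsProperOn

namespace IsSemiParallelOn

variable {U : Set (Euc n)} {F : Euc n → Euc m} {η : Fin k → Euc n → Euc m}
  (H : IsSemiParallelOn U F η) {x : Euc n}
include H

theorem differentiableAt_coneForm (hx : x ∈ U) (X Y : Euc n) :
    DifferentiableAt ℝ (fun y => coneForm F y X Y) x :=
  differentiableAt_of_contDiffOn H.isOpen (H.toIsProperOn.isMetricOf_coneMap.smooth_ambientForm X Y)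
    hx

theorem isBilinearMap_coneForm (hx : x ∈ U) : IsBilinearMap ℝ (coneForm F x) :=
  H.toIsProperOn.isMetricOf_coneMap.isBilinearMap_ambientForm hx

/-- The mixed components of the covariant derivatives of `coneForm` and of the Moebius second
fundamental form have the same coefficient. -/
theorem exists_covDeriv_of_ne (hx : x ∈ U) {i j : Fin k} (hij : i ≠ j) {Y Z : Euc n}
    (hY : Y ∈ eigenspace F x (η i x)) (hZ : Z ∈ eigenspace F x (η j x)) (X : Euc n) : ∃ s : ℝ,
    covDeriv (moebiusMetric F) (coneForm F) x X Y Z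
        = s • (coneNormal F (η i) x - coneNormal F (η j) x) ∧
      covDeriv (moebiusMetric F) (moebiusForm F) x X Y Z
        = s • (moebiusPrincipalNormal F (η i) x - moebiusPrincipalNormal F (η j) x) := by
  have hP := H.toIsProperOn
  obtain ⟨Y', hYd, rfl, hYm⟩ := hP.exists_section hx i hY
  obtain ⟨Z', hZd, rfl, hZm⟩ := hP.exists_section hx j hZ
  exact ⟨_, hP.covDeriv_of_ne (c := fun i => coneNormal F (η i))
    (fun y hy => H.isBilinearMap_coneForm hy)
    (fun y hy => hP.coneForm_symm hy) (fun y hy i X hX Y => H.coneForm_of_mem hy hX Y) hx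
    (H.differentiableAt_coneForm hx) hij hYd hZd hYm hZm X,
    hP.covDeriv_of_ne (c := fun i => moebiusPrincipalNormal F (η i))
    (fun y hy => isBilinearMap_moebiusForm (H.toIsImmersionOn.isInner hy).bilin)
    (fun y hy => hP.moebiusForm_symm hy) (fun y hy i X hX Y => hP.moebiusForm_of_mem hy hX Y) hx
    (fun X Y => differentiableAt_of_contDiffOn H.isOpen (hP.smooth_moebiusForm X Y) hx)
    hij hYd hZd hYm hZm X⟩

theorem covDeriv_coneForm_of_eq (hx : x ∈ U) {i : Fin k} {Y Z : Euc n}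
    (hY : Y ∈ eigenspace F x (η i x)) (hZ : Z ∈ eigenspace F x (η i x)) (X : Euc n) :
    covDeriv (moebiusMetric F) (coneForm F) x X Y Z
      = moebiusMetric F x Y Z • fderiv ℝ (coneNormal F (η i)) x X := by
  have hP := H.toIsProperOn
  obtain ⟨Y', hYd, rfl, hYm⟩ := hP.exists_section hx i hY
  obtain ⟨Z', hZd, rfl, hZm⟩ := hP.exists_section hx i hZ
  exact hP.covDeriv_of_eq (c := fun i => coneNormal F (η i))
    (fun y hy => H.isBilinearMap_coneForm hy)
    (fun y hy => hP.coneForm_symm hy) (fun y hy i X hX Y => H.coneForm_of_mem hy hX Y) hx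
    (H.differentiableAt_coneForm hx) (H.differentiableAt_coneNormal hx i) hYd hZd hYm hZm X

theorem covDeriv_moebiusForm_of_eq (hx : x ∈ U) {i : Fin k} {Y Z : Euc n}
    (hY : Y ∈ eigenspace F x (η i x)) (hZ : Z ∈ eigenspace F x (η i x)) (X : Euc n) :
    covDeriv (moebiusMetric F) (moebiusForm F) x X Y Z
      = moebiusMetric F x Y Z • fderiv ℝ (moebiusPrincipalNormal F (η i)) x X := by
  have hP := H.toIsProperOn
  obtain ⟨Y', hYd, rfl, hYm⟩ := hP.exists_section hx i hY
  obtain ⟨Z', hZd, rfl, hZm⟩ := hP.exists_section hx i hZ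
  exact hP.covDeriv_of_eq (c := fun i => moebiusPrincipalNormal F (η i))
    (fun y hy => isBilinearMap_moebiusForm (H.toIsImmersionOn.isInner hy).bilin)
    (fun y hy => hP.moebiusForm_symm hy) (fun y hy i X hX Y => hP.moebiusForm_of_mem hy hX Y) hx
    (fun X Y => differentiableAt_of_contDiffOn H.isOpen (hP.smooth_moebiusForm X Y) hx)
    (hP.differentiableAt_moebiusPrincipalNormal hx i) hYd hZd hYm hZm X

theorem codazzi_coneForm (hx : x ∈ U) {v : Lor m}
    (hv : ∀ Z, lorentz m (fderiv ℝ (coneMap F) x Z) v = 0) (X Y Z : Euc n) :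
    lorentz m (covDeriv (moebiusMetric F) (coneForm F) x X Y Z) v
      = lorentz m (covDeriv (moebiusMetric F) (coneForm F) x Y X Z) v :=
  H.toIsProperOn.isMetricOf_coneMap.codazzi hx hv X Y Z

theorem covDeriv_coneForm_symm (hx : x ∈ U) (X Y Z : Euc n) :
    covDeriv (moebiusMetric F) (coneForm F) x X Y Z
      = covDeriv (moebiusMetric F) (coneForm F) x X Z Y := by
  have hP := H.toIsProperOn
  have h1 : (fun y => coneForm F y Y Z) =ᶠ[𝓝 x] fun y => coneForm F y Z Y := by
    filter_upwards [H.isOpen.mem_nhds hx] with y hy using hP.coneForm_symm hy Y Z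
  rw [covDeriv, covDeriv, h1.fderiv_eq, hP.coneForm_symm hx _ Z, hP.coneForm_symm hx Y]
  abel

/-- Along `E_i` the derivative of the principal normal with index `j ≠ i` is proportional to the
difference of the two principal normals. -/
theorem exists_lorentz_fderiv_coneNormal (hx : x ∈ U) {i j : Fin k} (hij : i ≠ j) {X : Euc n}
    (hX : X ∈ eigenspace F x (η i x)) : ∃ c : ℝ, ∀ v : Lor m,
      (∀ Z, lorentz m (fderiv ℝ (coneMap F) x Z) v = 0) →
      lorentz m (fderiv ℝ (coneNormal F (η j)) x X) v
        = c * lorentz m (coneNormal F (η j) x - coneNormal F (η i) x) v := by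
  have hP := H.toIsProperOn
  obtain ⟨Y, hY, hY0⟩ := hP.exists_ne_zero hx j
  obtain ⟨s, hs, -⟩ := H.exists_covDeriv_of_ne hx hij hX hY Y
  have hpos := ((hP.isInner_moebiusMetric hx).pos Y hY0).ne'
  refine ⟨-((moebiusMetric F x Y Y)⁻¹ * s), fun v hv => ?_⟩
  have h1 := H.codazzi_coneForm hx hv X Y Y
  rw [hs, H.covDeriv_coneForm_of_eq hx hY hY X] at h1
  simp only [map_smul, map_sub, smul_apply, sub_apply, smul_eq_mul] at h1 ⊢
  field_simp
  linarith

/-- Along an eigenspace of dimension at least two its principal normal is parallel. -/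
theorem lorentz_fderiv_coneNormal_of_one_lt (hx : x ∈ U) {i : Fin k}
    (hi : 1 < multiplicity F η x i) {X : Euc n} (hX : X ∈ eigenspace F x (η i x)) {v : Lor m}
    (hv : ∀ Z, lorentz m (fderiv ℝ (coneMap F) x Z) v = 0) :
    lorentz m (fderiv ℝ (coneNormal F (η i)) x X) v = 0 := by
  have hP := H.toIsProperOn
  have hh := hP.isInner_moebiusMetric hx
  let L : eigenspace F x (η i x) →ₗ[ℝ] ℝ := (hh.bilin.toLinearMap X).comp (Submodule.subtype _)
  have hker : LinearMap.ker L ≠ ⊥ := by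
    refine LinearMap.ker_ne_bot_of_finrank_lt ?_
    rw [Module.finrank_self]
    exact hi
  obtain ⟨Y, hYL, hY0⟩ := Submodule.exists_mem_ne_zero_of_ne_bot hker
  have hXY : moebiusMetric F x X Y = 0 := hYL
  have hY0' : (Y : Euc n) ≠ 0 := fun h => hY0 (Subtype.ext h)
  have h1 := H.codazzi_coneForm hx hv X Y Y
  rw [H.covDeriv_coneForm_of_eq hx Y.2 Y.2 X, H.covDeriv_coneForm_of_eq hx hX Y.2 Y, hXY, zero_smul,
    map_zero, zero_apply, map_smul, smul_apply, smul_eq_mul] at h1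
  exact (mul_eq_zero.mp h1).resolve_left (hh.pos _ hY0').ne'

/-- The normal derivatives of the lifts of the differences `β_i - β_j` are the lifts of the normal
derivatives. -/
theorem lorentz_fderiv_coneNormal_sub (hx : x ∈ U) (i j : Fin k) (X : Euc n) {ξ : Euc m}
    (hξ : ξ ∈ normalSpace F x) (t : ℝ) :
    lorentz m (fderiv ℝ (coneNormal F (η i)) x X) (coneDeriv (F x) ξ + t • cone (F x))
        - lorentz m (fderiv ℝ (coneNormal F (η j)) x X) (coneDeriv (F x) ξ + t • cone (F x))
      = inner ℝ (fderiv ℝ (moebiusPrincipalNormal F (η i)) x X) ξ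
        - inner ℝ (fderiv ℝ (moebiusPrincipalNormal F (η j)) x X) ξ := by
  have hP := H.toIsProperOn
  have hF := differentiableAt_of_contDiffOn H.isOpen H.smooth hx
  have hdi := H.differentiableAt_coneNormal hx i
  have hdj := H.differentiableAt_coneNormal hx j
  have hβi := hP.differentiableAt_moebiusPrincipalNormal hx i
  have hβj := hP.differentiableAt_moebiusPrincipalNormal hx j
  have hc : DifferentiableAt ℝ (fun y => cone (F y)) x :=
    (contDiff_cone.differentiable (by simp) (F x)).comp x hF
  have hτ : DifferentiableAt ℝ
      (fun y => (coneNormal F (η i) y - coneNormal F (η j) y).1) x := (hdi.sub hdj).fst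
  obtain ⟨L, hL, hLX⟩ := hasFDerivAt_coneDeriv_comp hF (hβi.fun_sub hβj)
  have h1 : (fun y => coneNormal F (η i) y - coneNormal F (η j) y) =ᶠ[𝓝 x] fun y =>
      coneDeriv (F y) (moebiusPrincipalNormal F (η i) y - moebiusPrincipalNormal F (η j) y)
        + (coneNormal F (η i) y - coneNormal F (η j) y).1 • cone (F y) := by
    filter_upwards [H.isOpen.mem_nhds hx] with y hy using H.coneNormal_sub hy i j
  have h2 := DFunLike.congr_fun (h1.fderiv_eq (𝕜 := ℝ)) X
  rw [fderiv_fun_sub hdi hdj, fderiv_fun_add hL.differentiableAt (hτ.fun_smul hc), hL.fderiv,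
    fderiv_fun_smul hτ hc] at h2
  have h3 : inner ℝ (fderiv ℝ F x X) (moebiusPrincipalNormal F (η i) x
      - moebiusPrincipalNormal F (η j) x) = 0 := by
    rw [real_inner_comm]
    exact mem_normalSpace.mp (Submodule.sub_mem _ (hP.moebiusPrincipalNormal_mem hx i)
      (hP.moebiusPrincipalNormal_mem hx j)) X
  have h4 : inner ℝ (fderiv ℝ F x X) ξ = 0 := by
    rw [real_inner_comm]
    exact mem_normalSpace.mp hξ X
  have h5 : ∀ w, lorentz m (cone (F x)) (coneDeriv (F x) w) = 0 := fun w => by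
    rw [lorentz_symm, lorentz_coneDeriv_cone]
  have h6 : ((0, 2 * 0, 0) : Lor m) = 0 := by simp
  simp only [sub_apply, add_apply, smul_apply, ContinuousLinearMap.smulRight_apply, hLX, h3, h6,
    fderiv_cone_comp hF, fderiv_fun_sub hβi hβj] at h2
  rw [← sub_apply, ← map_sub, h2]
  simp only [map_add, map_smul, add_apply, smul_apply, lorentz_coneDeriv, lorentz_coneDeriv_cone,
    lorentz_cone_cone, h5, h4, map_zero, zero_apply, inner_sub_left, smul_eq_mul]
  ring

theorem fderiv_lorentz_coneNormal (hx : x ∈ U) {i j : Fin k} (hij : i ≠ j) (X : Euc n) :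
    lorentz m (fderiv ℝ (coneNormal F (η i)) x X) (coneNormal F (η j) x)
      + lorentz m (fderiv ℝ (coneNormal F (η j)) x X) (coneNormal F (η i) x) = 0 := by
  have h1 : (fun y => lorentz m (coneNormal F (η i) y) (coneNormal F (η j) y))
      =ᶠ[𝓝 x] fun _ => 0 := by
    filter_upwards [H.isOpen.mem_nhds hx] with y hy using H.lorentz_coneNormal hy hij
  have h2 := DFunLike.congr_fun (h1.fderiv_eq (𝕜 := ℝ)) X
  simp only [fderiv_form (lorentz m) (H.differentiableAt_coneNormal hx i)
    (H.differentiableAt_coneNormal hx j), fderiv_fun_const, Pi.zero_apply, zero_apply] at h2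
  rwa [lorentz_symm (coneNormal F (η i) x)] at h2

theorem fderiv_lorentz_self_add (hx : x ∈ U) {i j : Fin k} (hij : i ≠ j) (X : Euc n) :
    lorentz m (fderiv ℝ (coneNormal F (η i)) x X) (coneNormal F (η i) x)
      + lorentz m (fderiv ℝ (coneNormal F (η j)) x X) (coneNormal F (η j) x)
      = inner ℝ (fderiv ℝ (moebiusPrincipalNormal F (η i)) x X
          - fderiv ℝ (moebiusPrincipalNormal F (η j)) x X)
        (moebiusPrincipalNormal F (η i) x - moebiusPrincipalNormal F (η j) x) := by
  have hdi := H.differentiableAt_coneNormal hx i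
  have hdj := H.differentiableAt_coneNormal hx j
  have hβi := H.toIsProperOn.differentiableAt_moebiusPrincipalNormal hx i
  have hβj := H.toIsProperOn.differentiableAt_moebiusPrincipalNormal hx j
  have h1 : (fun y => lorentz m (coneNormal F (η i) y) (coneNormal F (η i) y)
      + lorentz m (coneNormal F (η j) y) (coneNormal F (η j) y)) =ᶠ[𝓝 x] fun y => innerForm m
        (moebiusPrincipalNormal F (η i) y - moebiusPrincipalNormal F (η j) y)
        (moebiusPrincipalNormal F (η i) y - moebiusPrincipalNormal F (η j) y) := by
    filter_upwards [H.isOpen.mem_nhds hx] with y hy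
    rw [H.lorentz_self_add hy hij, innerForm_apply, real_inner_self_eq_norm_sq]
  have h2 := DFunLike.congr_fun (h1.fderiv_eq (𝕜 := ℝ)) X
  rw [fderiv_fun_add (differentiableAt_form _ hdi hdi) (differentiableAt_form _ hdj hdj)] at h2
  simp only [add_apply, fderiv_form (lorentz m) hdi hdi, fderiv_form (lorentz m) hdj hdj,
    fderiv_form (innerForm m) (hβi.fun_sub hβj) (hβi.fun_sub hβj), fderiv_fun_sub hβi hβj,
    sub_apply] at h2
  simp only [innerForm_apply] at h2
  rw [lorentz_symm (coneNormal F (η i) x), lorentz_symm (coneNormal F (η j) x),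
    real_inner_comm (fderiv ℝ (moebiusPrincipalNormal F (η i)) x X
      - fderiv ℝ (moebiusPrincipalNormal F (η j)) x X)
      (moebiusPrincipalNormal F (η i) x - moebiusPrincipalNormal F (η j) x)] at h2
  linarith

end IsSemiParallelOn

end Parallel

/-! ### Parallelism of the Moebius second fundamental form -/

section Main

variable {n m k : ℕ}

theorem inner_fderiv_of_normalDeriv {F : Euc n → Euc m} {ν : Euc n → Euc m} {x X : Euc n}
    (hν : normalDeriv F (moebiusPrincipalNormal F ν) x X = 0) {ξ : Euc m}
    (hξ : ξ ∈ normalSpace F x) :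
    inner ℝ (fderiv ℝ (moebiusPrincipalNormal F ν) x X) ξ = 0 := by
  rw [← inner_normalProj_of_mem _ hξ]
  rw [normalDeriv] at hν
  rw [hν, inner_zero_left]

namespace IsSemiParallelOn

variable {U : Set (Euc n)} {F : Euc n → Euc m} {η : Fin k → Euc n → Euc m}
  (H : IsSemiParallelOn U F η) {x : Euc n}
include H

/-- The difference of two principal normals of `coneMap F` is a lift of a normal vector of `F`. -/
theorem exists_lift_sub (hx : x ∈ U) (a c : Fin k) : ∃ ξ ∈ normalSpace F x, ∃ t : ℝ,
    coneNormal F (η a) x - coneNormal F (η c) x = coneDeriv (F x) ξ + t • cone (F x) :=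
  ⟨_, Submodule.sub_mem _ (H.toIsProperOn.moebiusPrincipalNormal_mem hx a)
    (H.toIsProperOn.moebiusPrincipalNormal_mem hx c), _, H.coneNormal_sub hx a c⟩

/-- If three Moebius principal normals are parallel at `x`, the normal derivatives of all principal
normals of the immersion into the light cone along the eigenvectors vanish up to multiples of the
position vector. -/
theorem lorentz_fderiv_coneNormal_lift_of_mem (hx : x ∈ U) (S : Finset (Fin k)) (hS : 3 ≤ S.card)
    (hpar : ∀ i ∈ S, ∀ X, normalDeriv F (moebiusPrincipalNormal F (η i)) x X = 0)
    {i : Fin k} {X : Euc n} (hX : X ∈ eigenspace F x (η i x)) (l : Fin k) {ξ : Euc m}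
    (hξ : ξ ∈ normalSpace F x) (t : ℝ) :
    lorentz m (fderiv ℝ (coneNormal F (η l)) x X) (coneDeriv (F x) ξ + t • cone (F x)) = 0 := by
  have hP := H.toIsProperOn
  set B : Fin k → Lor m := fun j => coneNormal F (η j) x with hB
  set d : Fin k → Lor m := fun j => fderiv ℝ (coneNormal F (η j)) x X with hd
  set q : Fin k → ℝ := fun j => lorentz m (B j) (B j) with hq
  have hBn : ∀ j Z, lorentz m (fderiv ℝ (coneMap F) x Z) (B j) = 0 :=
    fun j Z => H.coneNormal_normal hx j Z
  have hBo : ∀ a c, a ≠ c → lorentz m (B a) (B c) = 0 := fun a c h => H.lorentz_coneNormal hx h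
  have hqpos : ∀ a c, a ≠ c → 0 < q a + q c := fun a c h => H.lorentz_self_add_pos hx h
  have hμpos := hP.multiplicity_pos hx
  -- the coefficients `lam j` of the derivatives along the eigenspace with index `i`
  have hex : ∀ j, ∃ c : ℝ, j ≠ i → ∀ v : Lor m,
      (∀ Z, lorentz m (fderiv ℝ (coneMap F) x Z) v = 0) →
      lorentz m (d j) v = c * lorentz m (B j - B i) v := by
    intro j
    by_cases hj : j = i
    · exact ⟨0, fun h => absurd hj h⟩
    · obtain ⟨c, hc⟩ := H.exists_lorentz_fderiv_coneNormal hx (Ne.symm hj) hX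
      exact ⟨c, fun _ => hc⟩
  choose lam hlam using hex
  have hDB : ∀ j, j ≠ i → ∀ a, lorentz m (d j) (B a)
      = lam j * (lorentz m (B j) (B a) - lorentz m (B i) (B a)) := by
    intro j hj a
    rw [hlam j hj (B a) (hBn a), map_sub, sub_apply]
  have hDself : ∀ j, j ≠ i → lorentz m (d j) (B j) = lam j * q j := fun j hj => by
    rw [hDB j hj, hBo i j hj.symm, sub_zero]
  have hDi : ∀ j, j ≠ i → lorentz m (d j) (B i) = - (lam j * q i) := fun j hj => by
    rw [hDB j hj, hBo j i hj]
    ring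
  have hD0 : ∀ j, j ≠ i → ∀ a, a ≠ i → a ≠ j → lorentz m (d j) (B a) = 0 := by
    intro j hj a hai haj
    rw [hDB j hj, hBo j a haj.symm, hBo i a hai.symm]
    ring
  have hdi : ∀ j, j ≠ i → lorentz m (d i) (B j) = lam j * q i := by
    intro j hj
    have h1 := H.fderiv_lorentz_coneNormal hx hj.symm X
    have h2 := hDi j hj
    simp only [hd, hB] at h2 ⊢
    linarith
  -- the squared norms of the principal normals in `S` are constant
  have hsum : ∀ a ∈ S, ∀ c ∈ S, a ≠ c →
      lorentz m (d a) (B a) + lorentz m (d c) (B c) = 0 := by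
    intro a ha c hc hac
    have hmem : moebiusPrincipalNormal F (η a) x - moebiusPrincipalNormal F (η c) x
        ∈ normalSpace F x := Submodule.sub_mem _ (hP.moebiusPrincipalNormal_mem hx a)
      (hP.moebiusPrincipalNormal_mem hx c)
    rw [hd, hB]
    rw [H.fderiv_lorentz_self_add hx hac X, inner_sub_left,
      inner_fderiv_of_normalDeriv (hpar a ha X) hmem,
      inner_fderiv_of_normalDeriv (hpar c hc X) hmem, sub_zero]
  have hSconst : ∀ a ∈ S, lorentz m (d a) (B a) = 0 := by
    intro a ha
    have h1 : 1 < (S.erase a).card := by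
      rw [Finset.card_erase_of_mem ha]
      omega
    obtain ⟨c, hc, e, he, hce⟩ := Finset.one_lt_card.mp h1
    rw [Finset.mem_erase] at hc he
    have h2 := hsum a ha c hc.2 hc.1.symm
    have h3 := hsum a ha e he.2 he.1.symm
    have h4 := hsum c hc.2 e he.2 hce
    linarith
  -- one of the parallel principal normals, with index different from `i`, has nonzero norm
  have hj₀ : ∃ j₀ ∈ S, j₀ ≠ i ∧ lam j₀ = 0 := by
    have h1 : 1 < (S.erase i).card := by
      have := Finset.pred_card_le_card_erase (a := i) (s := S)
      omega
    obtain ⟨a, ha, c, hc, hac⟩ := Finset.one_lt_card.mp h1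
    rw [Finset.mem_erase] at ha hc
    have h2 := (hDself a ha.1).symm.trans (hSconst a ha.2)
    have h3 := (hDself c hc.1).symm.trans (hSconst c hc.2)
    by_cases h4 : lam a = 0
    · exact ⟨a, ha.2, ha.1, h4⟩
    · refine ⟨c, hc.2, hc.1, (mul_eq_zero.mp h3).resolve_right fun h5 => ?_⟩
      have h6 := hqpos a c hac
      rw [(mul_eq_zero.mp h2).resolve_left h4, h5] at h6
      linarith
  obtain ⟨j₀, hj₀S, hj₀i, hlam₀⟩ := hj₀
  -- hence the Moebius form vanishes: derivatives in the Lorentz space agree with those of `F`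
  have hlink : ∀ j, ∀ ζ ∈ normalSpace F x, ∀ s : ℝ,
      lorentz m (d j) (coneDeriv (F x) ζ + s • cone (F x))
        = inner ℝ (fderiv ℝ (moebiusPrincipalNormal F (η j)) x X) ζ := by
    intro j ζ hζ s
    have h1 := H.lorentz_fderiv_coneNormal_sub hx j j₀ X hζ s
    have h2 := hlam j₀ hj₀i _ (hP.lift_normal hx hζ s)
    rw [hlam₀, zero_mul] at h2
    simp only [hd] at h2 ⊢
    rw [h2, inner_fderiv_of_normalDeriv (hpar j₀ hj₀S X) hζ] at h1
    linarith
  have hSlift : ∀ j ∈ S, ∀ ζ ∈ normalSpace F x, ∀ s : ℝ,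
      lorentz m (d j) (coneDeriv (F x) ζ + s • cone (F x)) = 0 := by
    intro j hj ζ hζ s
    rw [hlink j ζ hζ, inner_fderiv_of_normalDeriv (hpar j hj X) hζ]
  -- the derivative of `∑ j, m j • β j = 0`
  have htrace : ∀ ζ ∈ normalSpace F x, ∀ s : ℝ, ∑ j, (multiplicity F η x j : ℝ)
      * lorentz m (d j) (coneDeriv (F x) ζ + s • cone (F x)) = 0 := by
    intro ζ hζ s
    have h1 := congrArg (fun v => inner ℝ v ζ) (hP.sum_smul_fderiv_moebiusPrincipalNormal hx X)
    simp only [sum_inner, inner_smul_left, conj_trivial, inner_zero_left] at h1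
    simpa only [hlink _ ζ hζ s] using h1
  have htraceB : ∀ a c, ∑ j, (multiplicity F η x j : ℝ) * lorentz m (d j) (B a)
      = ∑ j, (multiplicity F η x j : ℝ) * lorentz m (d j) (B c) := by
    intro a c
    obtain ⟨ζ, hζ, s, hs⟩ := H.exists_lift_sub hx a c
    have h1 := htrace ζ hζ s
    rw [← hs] at h1
    simp only [map_sub, mul_sub, Finset.sum_sub_distrib] at h1
    exact sub_eq_zero.mp h1
  have hSB : ∀ j ∈ S, ∀ a c, lorentz m (d j) (B a) = lorentz m (d j) (B c) := by
    intro j hj a c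
    obtain ⟨ζ, hζ, s, hs⟩ := H.exists_lift_sub hx a c
    have h1 := hSlift j hj ζ hζ s
    rw [← hs, map_sub] at h1
    exact sub_eq_zero.mp h1
  -- the derivative of the constant function `∑ j, m j * ‖β j‖ ^ 2`
  have hnorm : ∑ j, (multiplicity F η x j : ℝ) * lorentz m (d j) (B j) = 0 := by
    have h1 := hP.sum_mul_inner_fderiv_moebiusPrincipalNormal hx X
    have h2 := congrArg (fun v => inner ℝ v (moebiusPrincipalNormal F (η j₀) x))
      (hP.sum_smul_fderiv_moebiusPrincipalNormal hx X)
    simp only [sum_inner, inner_smul_left, conj_trivial, inner_zero_left] at h2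
    have h3 : ∀ j, lorentz m (d j) (B j)
        = inner ℝ (fderiv ℝ (moebiusPrincipalNormal F (η j)) x X)
            (moebiusPrincipalNormal F (η j) x)
          - inner ℝ (fderiv ℝ (moebiusPrincipalNormal F (η j)) x X)
            (moebiusPrincipalNormal F (η j₀) x) := by
      intro j
      by_cases hj : j = j₀
      · rw [hj, hSconst j₀ hj₀S, sub_self]
      · have h4 := H.fderiv_lorentz_self_add hx hj X
        have h5 := hSconst j₀ hj₀S
        have hmem : moebiusPrincipalNormal F (η j) x - moebiusPrincipalNormal F (η j₀) x
          ∈ normalSpace F x := Submodule.sub_mem _ (hP.moebiusPrincipalNormal_mem hx j)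
          (hP.moebiusPrincipalNormal_mem hx j₀)
        rw [inner_sub_left, inner_fderiv_of_normalDeriv (hpar j₀ hj₀S X) hmem, sub_zero,
          inner_sub_right] at h4
        simp only [hd, hB] at h5 ⊢
        linarith
    simp only [h3, mul_sub, Finset.sum_sub_distrib, h1, h2, sub_zero]
  have hsumi : ∑ j, (multiplicity F η x j : ℝ) * lorentz m (d j) (B j₀) = 0 := by
    refine Finset.sum_eq_zero fun j _ => ?_
    by_cases hj : j = i
    · rw [hj, hdi j₀ hj₀i, hlam₀]
      ring
    · by_cases hjj : j = j₀
      · rw [hjj, hSconst j₀ hj₀S, mul_zero]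
      · rw [hD0 j hj j₀ hj₀i (Ne.symm hjj), mul_zero]
  have hE1 : ∀ j, j ≠ i → j ≠ j₀ → lam j * (multiplicity F η x i * q i
      + multiplicity F η x j * q j) = 0 := by
    intro j hj _
    have h1 := htraceB j j₀
    rw [hsumi, ← Finset.add_sum_erase _ _ (Finset.mem_univ i),
      Finset.sum_eq_single j (fun a ha haj => by
        rw [hD0 a (Finset.ne_of_mem_erase ha) j hj (Ne.symm haj), mul_zero])
        (fun h => absurd (Finset.mem_erase.mpr ⟨hj, Finset.mem_univ j⟩) h),
      hdi j hj, hDself j hj] at h1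
    linear_combination h1
  have hE4 : ∑ j ∈ Finset.univ.erase i, (multiplicity F η x j : ℝ) * (lam j * (q i + q j)) = 0 := by
    have h1 := htraceB i j₀
    rw [hsumi, ← Finset.add_sum_erase _ _ (Finset.mem_univ i)] at h1
    have h2 := hnorm
    rw [← Finset.add_sum_erase _ _ (Finset.mem_univ i)] at h2
    have h3 := h2.trans h1.symm
    rw [add_right_inj, ← sub_eq_zero, ← Finset.sum_sub_distrib] at h3
    rw [← h3]
    refine Finset.sum_congr rfl fun j hj => ?_
    rw [hDself j (Finset.ne_of_mem_erase hj), hDi j (Finset.ne_of_mem_erase hj)]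
    ring
  have hcase : multiplicity F η x i = 1 ∨ ∀ j, j ≠ i → lam j * q i = 0 := by
    rcases (Nat.succ_le_of_lt (hμpos i)).eq_or_lt with h1 | h1
    · exact Or.inl h1.symm
    · refine Or.inr fun j hj => ?_
      rw [← hdi j hj]
      exact H.lorentz_fderiv_coneNormal_of_one_lt hx h1 hX (hBn j)
  have hlam0 := lam_eq_zero i j₀ q lam (multiplicity F η x) hlam₀ hqpos hμpos hE1 hE4 hcase
  have hne : ∀ j, j ≠ i → ∀ ζ ∈ normalSpace F x, ∀ s : ℝ,
      lorentz m (d j) (coneDeriv (F x) ζ + s • cone (F x)) = 0 := by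
    intro j hj ζ hζ s
    rw [hlam j hj _ (hP.lift_normal hx hζ s), hlam0 j hj, zero_mul]
  by_cases hl : l = i
  · subst hl
    have h1 := htrace ξ hξ t
    rw [Finset.sum_eq_single l (fun a _ hal => by rw [hne a hal ξ hξ t, mul_zero])
      (fun h => absurd (Finset.mem_univ l) h)] at h1
    exact (mul_eq_zero.mp h1).resolve_left (by exact_mod_cast (hμpos l).ne')
  · exact hne l hl ξ hξ t

/-- With three parallel Moebius principal normals at `x`, the Moebius second fundamental form is
parallel at `x`. -/
theorem moebiusFormDeriv_eq_zero (hx : x ∈ U) (S : Finset (Fin k)) (hS : 3 ≤ S.card)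
    (hpar : ∀ i ∈ S, ∀ X, normalDeriv F (moebiusPrincipalNormal F (η i)) x X = 0)
    (X Y Z : Euc n) : moebiusFormDeriv F x X Y Z = 0 := by
  have hP := H.toIsProperOn
  have hM := hP.isMetricOf_coneMap
  have hlift : ∀ X l, ∀ ξ ∈ normalSpace F x, ∀ t : ℝ,
      lorentz m (fderiv ℝ (coneNormal F (η l)) x X) (coneDeriv (F x) ξ + t • cone (F x)) = 0 := by
    intro X l ξ hξ t
    refine hP.induction_on hx (p := fun X => lorentz m (fderiv ℝ (coneNormal F (η l)) x X)
      (coneDeriv (F x) ξ + t • cone (F x)) = 0) (fun i X hX => ?_) (fun X X' h h' => ?_) X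
    · exact H.lorentz_fderiv_coneNormal_lift_of_mem hx S hS hpar hX l hξ t
    · rw [map_add (fderiv ℝ _ x), map_add (lorentz m), add_apply, h, h', add_zero]
  obtain ⟨j₀, hj₀⟩ : S.Nonempty := Finset.card_pos.mp (by omega)
  have hβ : ∀ X l, normalProj F x (fderiv ℝ (moebiusPrincipalNormal F (η l)) x X) = 0 := by
    intro X l
    rw [← inner_self_eq_zero (𝕜 := ℝ), inner_normalProj, normalProj_idem]
    have hξ := normalProj_mem F x (fderiv ℝ (moebiusPrincipalNormal F (η l)) x X)
    have h1 := H.lorentz_fderiv_coneNormal_sub hx l j₀ X hξ 0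
    rw [hlift X l _ hξ, hlift X j₀ _ hξ, inner_fderiv_of_normalDeriv (hpar j₀ hj₀ X) hξ] at h1
    linarith
  have hlinB : ∀ y ∈ U, IsBilinearMap ℝ (moebiusForm F y) :=
    fun y hy => isBilinearMap_moebiusForm (H.toIsImmersionOn.isInner hy).bilin
  have hdB := fun X Y => differentiableAt_of_contDiffOn H.isOpen (hP.smooth_moebiusForm X Y) hx
  have hproj : ∀ X Y Z, moebiusFormDeriv F x X Y Z
      = normalProj F x (covDeriv (moebiusMetric F) (moebiusForm F) x X Y Z) := by
    intro X Y Z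
    rw [covDeriv, map_sub, map_sub, normalProj_eq_self.mpr (moebiusForm_mem F x _ Z),
      normalProj_eq_self.mpr (moebiusForm_mem F x Y _)]
    rfl
  rw [hproj]
  -- by additivity it suffices to treat eigenvectors
  refine hP.induction_on hx (p := fun Y => normalProj F x
    (covDeriv (moebiusMetric F) (moebiusForm F) x X Y Z) = 0) (fun i Y hY => ?_)
    (fun Y Y' h h' => by rw [hM.covDeriv_add_left hlinB hx hdB, map_add, h, h', add_zero]) Y
  refine hP.induction_on hx (p := fun Z => normalProj F x
    (covDeriv (moebiusMetric F) (moebiusForm F) x X Y Z) = 0) (fun j Z hZ => ?_)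
    (fun Z Z' h h' => by rw [hM.covDeriv_add_right hlinB hx hdB, map_add, h, h', add_zero]) Z
  by_cases hij : i = j
  · subst hij
    rw [H.covDeriv_moebiusForm_of_eq hx hY hZ, map_smul, hβ, smul_zero]
  refine hP.induction_on hx (p := fun X => normalProj F x
    (covDeriv (moebiusMetric F) (moebiusForm F) x X Y Z) = 0) (fun l X hX => ?_)
    (fun X X' h h' => by rw [hM.covDeriv_add_dir hlinB hx, map_add, h, h', add_zero]) X
  obtain ⟨s, hs, hs'⟩ := H.exists_covDeriv_of_ne hx hij hY hZ X
  suffices hs0 : s = 0 by rw [hs', hs0, zero_smul, map_zero]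
  have hBn := fun a => H.coneNormal_normal hx a
  have hBo : ∀ {a c : Fin k}, a ≠ c → lorentz m (coneNormal F (η a) x) (coneNormal F (η c) x) = 0 :=
    fun h => H.lorentz_coneNormal hx h
  obtain ⟨ξ, hξ, t, ht⟩ := H.exists_lift_sub hx i j
  set v := coneNormal F (η i) x - coneNormal F (η j) x with hv
  have hvn : ∀ W, lorentz m (fderiv ℝ (coneMap F) x W) v = 0 := fun W => by
    rw [hv, map_sub, hBn, hBn, sub_zero]
  have hvv : lorentz m v v ≠ 0 := by
    have h1 := H.lorentz_self_add_pos hx hij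
    rw [hv, map_sub, map_sub, sub_apply, sub_apply, hBo hij, hBo (Ne.symm hij)]
    linarith
  have hvd : ∀ W a, lorentz m (fderiv ℝ (coneNormal F (η a)) x W) v = 0 := fun W a => by
    rw [ht]
    exact hlift W a ξ hξ t
  by_cases hlj : l = j
  · subst hlj
    have h1 := H.codazzi_coneForm hx hvn X Y Z
    rw [hs, H.covDeriv_coneForm_of_eq hx hX hZ, map_smul, map_smul, smul_apply, smul_apply, hvd,
      smul_zero] at h1
    exact (smul_eq_zero.mp h1).resolve_right hvv
  by_cases hli : l = i
  · subst hli
    have h1 := H.codazzi_coneForm hx hvn X Z Y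
    rw [H.covDeriv_coneForm_symm hx X, hs, H.covDeriv_coneForm_of_eq hx hX hY, map_smul, map_smul,
      smul_apply, smul_apply, hvd, smul_zero] at h1
    exact (smul_eq_zero.mp h1).resolve_right hvv
  -- three different eigenspaces: the differences of the principal normals are independent
  obtain ⟨s', hs'', -⟩ := H.exists_covDeriv_of_ne hx hlj hX hZ Y
  have key : ∀ a, s * lorentz m v (coneNormal F (η a) x)
      = s' * lorentz m (coneNormal F (η l) x - coneNormal F (η j) x) (coneNormal F (η a) x) := by
    intro a
    have h1 := H.codazzi_coneForm hx (hBn a) X Y Z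
    rwa [hs, hs'', map_smul, map_smul, smul_apply, smul_apply, smul_eq_mul, smul_eq_mul] at h1
  have h1 := key i
  have h2 := key j
  have h3 := key l
  rw [hv] at h1 h2 h3
  simp only [map_sub, sub_apply, hBo hij, hBo (Ne.symm hij), hBo hlj, hBo (Ne.symm hlj), hBo hli,
    hBo (Ne.symm hli), sub_zero, zero_sub, mul_zero, sub_self] at h1 h2 h3
  have hp := H.lorentz_self_add_pos hx hij
  have hp' := H.lorentz_self_add_pos hx hli
  by_contra hs0
  have hqi := (mul_eq_zero.mp h1).resolve_left hs0
  rw [hqi, zero_add] at hp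
  rw [hqi, add_zero] at hp'
  have h4 := (mul_eq_zero.mp h3.symm).resolve_right hp'.ne'
  rw [h4, zero_mul] at h2
  exact (mul_ne_zero hs0 (neg_ne_zero.mpr hp.ne')) h2

end IsSemiParallelOn

/-! ### Charts -/

/-- The parametrization of an immersion by the inverse of a chart is an immersion. -/
theorem injective_fderiv_comp_symm {M : Type*} [TopologicalSpace M] [ChartedSpace (Euc n) M]
    [IsManifold (𝓡 n) ∞ M] {f : M → Euc m} (hf : IsSmoothImmersion n f)
    {φ : OpenPartialHomeomorph M (Euc n)} (hφ : φ ∈ IsManifold.maximalAtlas (𝓡 n) ∞ M)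
    {u : Euc n} (hu : u ∈ φ.target) : Function.Injective (fderiv ℝ (f ∘ φ.symm) u) := by
  have h1 : MDifferentiableAt (𝓡 n) (𝓡 n) φ.symm u :=
    (contMDiffAt_symm_of_mem_maximalAtlas hφ hu).mdifferentiableAt (by simp)
  have h2 : MDifferentiableAt (𝓡 n) (𝓡 n) φ (φ.symm u) :=
    (contMDiffAt_of_mem_maximalAtlas hφ (φ.map_target hu)).mdifferentiableAt (by simp)
  have h3 : MDifferentiableAt (𝓡 n) (𝓡 m) f (φ.symm u) :=
    (hf.1 (φ.symm u)).mdifferentiableAt (by simp)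
  rw [← mfderiv_eq_fderiv, mfderiv_comp u h3 h1]
  have h4 : Function.Injective (mfderiv (𝓡 n) (𝓡 n) φ.symm u) := by
    have h5 := mfderiv_comp u h2 h1
    have h6 : φ ∘ φ.symm =ᶠ[𝓝 u] id := by
      filter_upwards [φ.open_target.mem_nhds hu] with y hy using φ.right_inv hy
    rw [h6.mfderiv_eq, mfderiv_id] at h5
    refine Function.LeftInverse.injective (g := mfderiv (𝓡 n) (𝓡 n) φ (φ.symm u)) fun v => ?_
    exact (DFunLike.congr_fun h5 v).symm
  exact (hf.2 (φ.symm u)).comp h4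

theorem contDiffOn_comp_symm {M : Type*} [TopologicalSpace M] [ChartedSpace (Euc n) M]
    [IsManifold (𝓡 n) ∞ M] {f : M → Euc m} (hf : ContMDiff (𝓡 n) (𝓡 m) ∞ f)
    {φ : OpenPartialHomeomorph M (Euc n)} (hφ : φ ∈ IsManifold.maximalAtlas (𝓡 n) ∞ M) :
    ContDiffOn ℝ ∞ (f ∘ φ.symm) φ.target :=
  contMDiffOn_iff_contDiffOn.mp (hf.comp_contMDiffOn (contMDiffOn_symm_of_mem_maximalAtlas hφ))

end Main

end MoebiusGeometry

theorem theorem1p3 {n p k : ℕ} (hn : 4 ≤ n)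
    {M : Type*} [TopologicalSpace M] [ChartedSpace (Euc n) M] [IsManifold (𝓡 n) ∞ M]
    (f : M → Euc (n + p)) (hf : IsSmoothImmersion n f) (humb : UmbilicFree n f)
    (hflat : HasFlatNormalBundle n f) (hsemi : IsMoebiusSemiParallel n f)
    (η : Fin k → M → Euc (n + p)) (hη : ArePrincipalNormals n f η)
    (S : Finset (Fin k)) (hS : 3 ≤ S.card)
    (hpar : ∀ i ∈ S, IsMoebiusPrincipalNormalParallel n f (η i))
    (hmult : ∃ i ∈ S, HasMultiplicityGtOne n f (η i)) :
    IsMoebiusParallel n f := by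
  intro φ hφ u hu
  obtain ⟨hηs, hηd, hηp⟩ := hη
  have H : IsSemiParallelOn φ.target (f ∘ φ.symm) (fun i => η i ∘ φ.symm) :=
    { isOpen := φ.open_target
      smooth := contDiffOn_comp_symm hf.1 hφ
      injective := fun y hy => injective_fderiv_comp_symm hf hφ hy
      two_le := by omega
      flat := hflat φ hφ
      not_umbilic := humb φ hφ
      smooth_normal := fun i => contDiffOn_comp_symm (hηs i) hφ
      distinct := fun y _ i j hij h => hij (hηd (φ.symm y) h)
      principal := hηp φ hφ
      semi := hsemi φ hφ
      three_le := hS.trans (card_finset_fin_le S) }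
  exact H.moebiusFormDeriv_eq_zero hu S hS fun i hi => hpar i hi φ hφ u hu
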